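/- **Setting.** Let $n$ be even and $[n]=\{1,\dots,n\}$. Let $G_n$ be the union of the Hamilton cycle $(1\,2\cdots n)$ and a uniformly random perfect matching of $[n]$; $p(i)$ denotes the partner of $i$ in the matching. A vertex $j\le i$ is *unsaturated at time $i$* if $p(j)>i$. The *history* through time $i$ tells, for each $v\le i$, whether $p(v)<v$, and if so the value of $p(v)$. Put $i_0=\frac{n}{\log\log n}$, $i_1=n-\frac{n}{\log\log n}$, $\omega=n^{1/3}$, each rounded up or down to an integer (in any way). **Burn-in (BalancedGreedy).** The vertices $1,\dots,i_0$ are properly coloured with colours $1,2,3$ by a rule that sees only the history through time $i_0$. Divide $[i_0]$ into consecutive batches of $7$ vertices (the last may be shorter); a batch is good if it has $7$ vertices $v$, all with $p(v)>i_0$, and bad otherwise. The bad batches are coloured greedily in order (arbitrary admissible selections), then the good batches in order. Let $D$ be the maximum minus the minimum, over the three colours, of the number of already coloured vertices $v\in[i_0]$ of that colour with $p(v)>i_0$. Each good batch is coloured properly so that $D$ decreases by at least $1$ if $D>1$ before, and so that $D\le 1$ afterwards if $D\le 1$ before. Any rule of this kind is allowed. **Sudoku.** It colours $i_0+1,\dots,i_1$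 one after another, maintaining a pointer $\mathrm{ptr}$ and a set $S$, initially $\mathrm{ptr}=i_0$ and $S=[i_0]$. Suppose $1,\dots,i$ are coloured by $c$, and let $j=p(i+1)$. *If $\mathrm{ptr}=i$:* (A1) if $j<i+1$ and $c(j)\ne c(i)$, then $c(i+1)$ is the colour not in $\{c(j),c(i)\}$ and $\mathrm{ptr}:=i+1$; (A2) otherwise $c(i+1)$ is chosen uniformly at random (independently of everything else) from the two colours other than $c(i)$, and $\mathrm{ptr}$ is unchanged. $S$ is unchanged. *If $\mathrm{ptr}<i$:* let $C_{i+1}=\{c(i-1),c(i)\}$ if $p(i)>i$ and $C_{i+1}=\{c(p(i)),c(i)\}$ if $p(i)<i$. (B1) If $j\le\mathrm{ptr}$ and $c(j)\in C_{i+1}$, then $c(i+1)$ is the colour not in $C_{i+1}$; $\mathrm{ptr}$ and $S$ are unchanged. In all other cases $\mathrm{ptr}:=i+1$, and: (B2a) if $j>i+1$, then $c(i+1)$ is the colour not in $C_{i+1}$, and $i+1$ is added to $S$; (B2b) if $j\le\mathrm{ptr}$ (old pointer) and $c(j)\notin C_{i+1}$, then $c(i+1)$ is the colour not in $\{c(i),c(j)\}$,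 and $i$ is added to $S$; (B2c) if $\mathrm{ptr}<j\le i$ and $c(j)\in C_{i+1}$, then $c(i+1)$ is the colour not in $C_{i+1}$, and $i+1$ is added to $S$; (B2d) if $\mathrm{ptr}<j\le i$ and $c(j)\notin C_{i+1}$, then $c(i+1)$ is the colour not in $\{c(i),c(j)\}$, and $i$ and $i+1$ are added to $S$. **The constant.** For $q\in(0,1)$ let $Q_{\rm bal}$ be the Markov chain on the $18$ states $A_e^{(k)}$, $B_e^{(k\ell)}$ ($e\in\{b,f\}$, $k\ne\ell$ in $\{1,2,3\}$) whose non-zero transition probabilities are, for $\{k,\ell,m\}=\{1,2,3\}$: from $A_e^{(k)}$ to each of $A_b^{(\ell)},A_b^{(m)}$ with probability $\frac q3$, to each of $B_f^{(k\ell)},B_f^{(km)}$ with probability $\frac{1-q}2$, and to each of $B_b^{(k\ell)},B_b^{(km)}$ with probability $\frac q6$; from $B_e^{(k\ell)}$ to each of $A_b^{(k)},B_b^{(km)},B_b^{(\ell m)}$ with probability $\frac q3$, and to $A_f^{(m)}$ with probability $1-q$. Its stationary distribution $\pi_{\rm bal}$ gives each $A_b,A_f,B_b,B_f$ state the mass $\frac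 q6,\frac{1-q}6,\frac q{12},\frac{1-q}{12}$, respectively. Call $K>1$ *admissible* if for all $q\in(0,1)$ and all states $V,V'$, the chain $(W_i)$ started at $V$ satisfies $\Pr_V(W_6=V')\ge \pi_{\rm bal}(V')/K$ if $V'$ has index $b$, and $\Pr_V(W_i=V'\text{ for some }0\le i\le 6)\ge\pi_{\rm bal}(V')/K$ if $V'$ has index $f$. **Theorem.** Admissible constants exist. Let $C_{\rm cond}$ be an admissible constant and $C=54\,C_{\rm cond}+2$. Put $N=n/\omega$, $i_{\max}=\lfloor (i_1-i_0)/\omega\rfloor$, $t_i=\frac{i_0+i\omega}{n}$, $x(t)=t(1-t)$, $\varepsilon(t)=\frac{\log^3 n}{n^{1/3}(1-t)^{C}}$, and let $\widetilde X_k(i)=\frac1\omega X_k(i_0+i\omega)$, where $X_k(j)$ is the number of vertices of colour $k$ that are unsaturated at time $j$. Then, for all sufficiently large even $n$, a burn-in rule as described exists, and with probability tending to $1$ as $n\to\infty$ ($n$ even), uniformly over the choice of the burn-in rule and of the roundings, $$\Big|\widetilde X_k(i)-\frac N3\,x(t_i)\Big|\le\frac N3\,\varepsilon(t_i)\qquad\text{for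 all } 0\le i\le i_{\max}\text{ and } k\in\{1,2,3\}.$$ -/

import Mathlib

open Filter

noncomputable section

namespace SudokuColouring

/-! ### The random graph: a Hamilton cycle plus a random perfect matching -/

/-- The vertex set `[n] = {1, …, n}`. -/
abbrev Vertex (n : ℕ) : Type := ↥(Finset.Icc 1 n)

/-- Perfect matchings of `[n]`, as fixed-point-free involutions (`v` is matched to its image). -/
abbrev PerfectMatching (n : ℕ) : Type :=
  {σ : Equiv.Perm (Vertex n) // ∀ v, σ v ≠ v ∧ σ (σ v) = v}

/-- The partner `p(i)` of vertex `i ∈ [n]` (with the dummy value `0` if `i ∉ [n]`). -/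
def partner {n : ℕ} (M : PerfectMatching n) (i : ℕ) : ℕ :=
  if h : i ∈ Finset.Icc 1 n then (M.1 ⟨i, h⟩ : ℕ) else 0

/-- The union of the Hamilton cycle `(1 2 ⋯ n)` and the perfect matching `M`; multiple edges are
irrelevant for colourings. -/
def cycleMatchingGraph {n : ℕ} (M : PerfectMatching n) : SimpleGraph ℕ :=
  SimpleGraph.fromRel fun u v =>
    u ∈ Finset.Icc 1 n ∧ v ∈ Finset.Icc 1 n ∧ (v = u + 1 ∨ (u = n ∧ v = 1) ∨ v = partner M u)

/-- Probability of an event under the uniform distribution on a finite sample space. -/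
def prob {Ω : Type} (E : Set Ω) : ℝ := (E.ncard : ℝ) / (Nat.card Ω : ℝ)

/-- The history of the matching process through time `i`: each vertex `v ≤ i` with a backward edge
has its partner revealed; every other vertex carries the dummy value `0`. -/
def history {n : ℕ} (M : PerfectMatching n) (i : ℕ) (v : ℕ) : ℕ :=
  if v ≤ i ∧ partner M v < v then partner M v else 0

/-- The unique element of `Fin 3` that differs from the two distinct elements `a` and `b`. -/
def thirdColour (a b : Fin 3) : Fin 3 := -(a + b)

/-! ### The burn-in phase: `BalancedGreedy` on the vertices `1, …, i₀` -/

/-- Batch `b` is the block of vertices `7b+1, …, 7b+7`. It is good if it lies in `[i₀]` and all its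
seven vertices have long forward edges. -/
def IsGoodBatch {n : ℕ} (M : PerfectMatching n) (i₀ b : ℕ) : Prop :=
  7 * b + 7 ≤ i₀ ∧ ∀ v ∈ Finset.Icc (7 * b + 1) (7 * b + 7), i₀ < partner M v

open Classical in
/-- The number of unsaturated vertices in `[i₀]` of colour `k` which have been coloured once all bad
batches and those good batches with index `< b` have been coloured. -/
def batchCount {n : ℕ} (M : PerfectMatching n) (i₀ : ℕ) (c : ℕ → Fin 3) (b : ℕ) (k : Fin 3) : ℕ :=
  ((Finset.Icc 1 i₀).filter fun v => i₀ < partner M v ∧ c v = k ∧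
    (¬ IsGoodBatch M i₀ ((v - 1) / 7) ∨ (v - 1) / 7 < b)).card

/-- The colour discrepancy: maximum minus minimum of the counts in `batchCount`. -/
def discrepancy {n : ℕ} (M : PerfectMatching n) (i₀ : ℕ) (c : ℕ → Fin 3) (b : ℕ) : ℕ :=
  Finset.univ.sup' Finset.univ_nonempty (batchCount M i₀ c b) -
    Finset.univ.inf' Finset.univ_nonempty (batchCount M i₀ c b)

/-- `c` is a possible output of `BalancedGreedy` on `[i₀]`. The bad batches are coloured greedily,
with arbitrary admissible selections, and then the good batches are coloured properly, in order,
each of them lowering the discrepancy if it exceeds `1`, and otherwise keeping it at most `1`. -/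
def IsBalancedGreedy {n : ℕ} (M : PerfectMatching n) (i₀ : ℕ) (c : ℕ → Fin 3) : Prop :=
  (∀ u ∈ Finset.Icc 1 i₀, ∀ v ∈ Finset.Icc 1 i₀, (cycleMatchingGraph M).Adj u v → c u ≠ c v) ∧
  ∀ b, IsGoodBatch M i₀ b →
    (1 < discrepancy M i₀ c b → discrepancy M i₀ c (b + 1) + 1 ≤ discrepancy M i₀ c b) ∧
    (discrepancy M i₀ c b ≤ 1 → discrepancy M i₀ c (b + 1) ≤ 1)

/-- An implementation of `BalancedGreedy`: it sees only the history of the matching process through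
time `i₀`, and its output is always a possible output of `BalancedGreedy`. -/
def IsBalancedGreedyRule (n i₀ : ℕ) (rule : (ℕ → ℕ) → ℕ → Fin 3) : Prop :=
  ∀ M : PerfectMatching n, IsBalancedGreedy M i₀ (rule (history M i₀))

/-! ### The algorithm `Sudoku` -/

/-- State of `Sudoku`: the colouring, the pointer and the set `S`. After time `i` only the values of
`col` on `{1, …, i}` are meaningful. -/
structure State where
  col : ℕ → Fin 3
  ptr : ℕ
  S : Finset ℕ

/-- `s` is the state at time `i`; the step processes vertex `i + 1`. Here `p` is the partner function
and `ξ` supplies the fair coin for the choice between the two colours other than `c(i)`. -/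
def sudokuStep (p : ℕ → ℕ) (ξ : ℕ → Bool) (i : ℕ) (s : State) : State :=
  let c := s.col
  let j := p (i + 1)
  if s.ptr = i then
    -- run of type A
    if j < i + 1 ∧ c j ≠ c i then
      -- (A1)
      ⟨Function.update c (i + 1) (thirdColour (c j) (c i)), i + 1, s.S⟩
    else
      -- (A2)
      ⟨Function.update c (i + 1) (if ξ (i + 1) then c i + 1 else c i + 2), s.ptr, s.S⟩
  else
    -- run of type B; the set `C_{i+1}` is `{a, c i}`
    let a := if i < p i then c (i - 1) else c (p i)
    let k := thirdColour a (c i)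
    if i + 1 < j then
      -- (B2a)
      ⟨Function.update c (i + 1) k, i + 1, s.S ∪ {i + 1}⟩
    else if j ≤ s.ptr then
      if c j = a ∨ c j = c i then
        -- (B1)
        ⟨Function.update c (i + 1) k, s.ptr, s.S⟩
      else
        -- (B2b)
        ⟨Function.update c (i + 1) (thirdColour (c i) (c j)), i + 1, s.S ∪ {i}⟩
    else
      if c j = a ∨ c j = c i then
        -- (B2c)
        ⟨Function.update c (i + 1) k, i + 1, s.S ∪ {i + 1}⟩
      else
        -- (B2d)
        ⟨Function.update c (i + 1) (thirdColour (c i) (c j)), i + 1, s.S ∪ {i, i + 1}⟩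

/-- State of `Sudoku` after `m` steps, i.e. at time `i₀ + m`, started at time `i₀` from the
colouring `c₀` of `[i₀]` with `ptr = i₀` and `S = [i₀]`. -/
def sudokuState (p : ℕ → ℕ) (ξ : ℕ → Bool) (i₀ : ℕ) (c₀ : ℕ → Fin 3) : ℕ → State
  | 0 => ⟨c₀, i₀, Finset.Icc 1 i₀⟩
  | m + 1 => sudokuStep p ξ (i₀ + m) (sudokuState p ξ i₀ c₀ m)

/-- Sample space: a perfect matching and an independent fair coin for each vertex. -/
abbrev Sample (n : ℕ) : Type := PerfectMatching n × (Vertex n → Bool)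

/-- The coin of vertex `i` (with a dummy value if `i ∉ [n]`). -/
def coin {n : ℕ} (ξ : Vertex n → Bool) (i : ℕ) : Bool :=
  if h : i ∈ Finset.Icc 1 n then ξ ⟨i, h⟩ else false

/-- The state at time `i₀ + m` of the whole procedure: burn-in by `rule`, then `Sudoku`. -/
def runState {n : ℕ} (i₀ : ℕ) (rule : (ℕ → ℕ) → ℕ → Fin 3) (x : Sample n) (m : ℕ) : State :=
  sudokuState (partner x.1) (coin x.2) i₀ (rule (history x.1 i₀)) m

/-- `X_k(i₀ + m)`: the number of unsaturated vertices of colour `k` at time `i₀ + m`. -/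
def unsaturated {n : ℕ} (i₀ : ℕ) (rule : (ℕ → ℕ) → ℕ → Fin 3) (x : Sample n) (m : ℕ) (k : Fin 3) :
    ℕ :=
  ((Finset.Icc 1 (i₀ + m)).filter fun v =>
    i₀ + m < partner x.1 v ∧ (runState i₀ rule x m).col v = k).card

/-! ### The Markov chain on vertex types and the constant `C_cond` -/

/-- The 18 vertex types. `Sum.inl (e, k)` is `A_e^{(k)}` and `Sum.inr (e, (l, k))` is `B_e^{(l k)}`,
where `e = true` stands for a forward edge and `e = false` for a backward edge. -/
abbrev VertexType : Type := (Bool × Fin 3) ⊕ (Bool × {x : Fin 3 × Fin 3 // x.1 ≠ x.2})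

/-- The transition matrix `Q` with parameters `q₁, q₂, q₃`. -/
def transition (q : Fin 3 → ℝ) : Matrix VertexType VertexType ℝ :=
  Matrix.of fun V W =>
    match V, W with
    | Sum.inl (_, k), Sum.inl (false, l) => if l = k then 0 else q (thirdColour k l)
    | Sum.inl (_, _), Sum.inl (true, _) => 0
    | Sum.inl (_, k), Sum.inr (true, x) => if x.1.1 = k then (1 - ∑ i, q i) / 2 else 0
    | Sum.inl (_, k), Sum.inr (false, x) => if x.1.1 = k then q k / 2 else 0
    | Sum.inr (_, y), Sum.inl (false, l) =>
        if l = y.1.1 then q (thirdColour y.1.1 y.1.2) else 0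
    | Sum.inr (_, y), Sum.inl (true, l) =>
        if l = thirdColour y.1.1 y.1.2 then 1 - ∑ i, q i else 0
    | Sum.inr (_, y), Sum.inr (false, x) =>
        if x.1.2 = thirdColour y.1.1 y.1.2 then q x.1.1 else 0
    | Sum.inr (_, _), Sum.inr (true, _) => 0

/-- The balanced chain: all three parameters equal to `q / 3`. -/
def balancedTransition (q : ℝ) : Matrix VertexType VertexType ℝ := transition fun _ => q / 3

/-- The stationary distribution of the balanced chain. -/
def balancedStationary (q : ℝ) : VertexType → ℝ
  | Sum.inl (false, _) => q / 6
  | Sum.inl (true, _) => (1 - q) / 6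
  | Sum.inr (false, _) => q / 12
  | Sum.inr (true, _) => (1 - q) / 12

/-- The type has a forward edge. -/
def IsForward : VertexType → Prop
  | Sum.inl (e, _) => e = true
  | Sum.inr (e, _) => e = true

open Classical in
/-- The probability that the first `r + 1` positions `W₀, …, W_r` of the chain with transition matrix
`P` started at `V` form a sequence in `E`. -/
def chainProb (P : Matrix VertexType VertexType ℝ) (V : VertexType) (r : ℕ)
    (E : Set (Fin (r + 1) → VertexType)) : ℝ :=
  ∑ w : Fin (r + 1) → VertexType,
    if w 0 = V ∧ w ∈ E then ∏ i : Fin r, P (w i.castSucc) (w i.succ) else 0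

/-- `K` is an admissible value of the constant `C_cond`. -/
def IsConditionConstant (K : ℝ) : Prop :=
  1 < K ∧ ∀ q ∈ Set.Ioo (0 : ℝ) 1, ∀ V V' : VertexType,
    (¬ IsForward V' → balancedStationary q V' / K ≤
      chainProb (balancedTransition q) V 6 {w | w (Fin.last 6) = V'}) ∧
    (IsForward V' → balancedStationary q V' / K ≤
      chainProb (balancedTransition q) V 6 {w | ∃ i, w i = V'})

/-! ### The trajectory event -/

/-- `m` is the real number `x ≥ 0` rounded down or up to an integer. -/
def IsRounding (x : ℝ) (m : ℕ) : Prop := m = ⌊x⌋₊ ∨ m = ⌈x⌉₊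

/-- `x(t) = t (1 - t)`. -/
def xFun (t : ℝ) : ℝ := t * (1 - t)

/-- `ε(t) = log³ n / (n^{1/3} (1 - t)^C)`. -/
def errFun (n : ℕ) (C t : ℝ) : ℝ :=
  Real.log n ^ 3 / ((n : ℝ) ^ (1 / 3 : ℝ) * (1 - t) ^ C)

/-- The event that `|X̃_k(i) - (N/3) x(t_i)| ≤ (N/3) ε(t_i)` for every colour `k` and every
`i = 0, …, i_max`, where `i_max = (i₁ - i₀) / ω` (rounded down), `X̃_k(i) = X_k(i₀ + i ω) / ω`,
`N = n / ω` and `t_i = (i₀ + i ω) / n`. -/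
def trajectoryEvent (n ω i₀ i₁ : ℕ) (C : ℝ) (rule : (ℕ → ℕ) → ℕ → Fin 3) : Set (Sample n) :=
  {x | ∀ i : ℕ, i ≤ (i₁ - i₀) / ω → ∀ k : Fin 3,
    let N : ℝ := (n : ℝ) / ω
    let t : ℝ := ((i₀ : ℝ) + i * ω) / n
    |(unsaturated i₀ rule x (i * ω) k : ℝ) / ω - N / 3 * xFun t| ≤ N / 3 * errFun n C t}

end SudokuColouring

end

open SudokuColouring

open Filter
open SudokuColouring

namespace SudokuColouring

/-! Write t = i/n and let Y_k be the number of unsaturated vertices of colour k at time i minus its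
target (n - i)t/3. The one-step drift of Y_k depends on the type of the vertex i and vanishes only
after averaging over types, so Y_k is corrected first. If every colour had exactly (n - i)t/3
unsaturated vertices, the types would follow the balanced chain with q = t. The Poisson equation of
that chain has an explicit solution, polynomial in t: the combination `corrScale` · Y_k +
`corrector` has no drift when t is frozen (`frozenChange_balanced`).

In the true process the drift of the corrected imbalances is therefore O((∑ |Y_c| + 1)/(n - i))
(`abs_eventAverage_frozenChange_le`). The pointer causes only an O(1/(n - i)) error, since at most
one unsaturated vertex lies beyond it (`card_recent_le_one`). Hence the sum of the squares of the
corrected imbalances grows on average by at most a factor 1 + 12000/(n - i) and an additive constant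
(`eventAverage_potential_le`). Multiplied by (1 - t)^12000 and increased by 10^8 (n - i), it becomes
a nonnegative supermartingale (`sum_weightedPotential_succ_le`), and `maximal_inequality` controls
all times at once.

At the start, a second moment bound places the number of unsaturated vertices within n^(3/5) of its
target, up to a small failure probability (`card_unsaturatedDeviation_gt_le`). Few vertices of [i₀]
are then saturated, so most batches are good and the burn-in ends with discrepancy at most 1
(`card_unsaturated_le_of_isBalancedGreedy`). The weighted potential starts at O(n^(6/5)) and is
unlikely ever to exceed n^(5/4). Up to time i₁ the weight costs only a power of log log n, which
gives |Y_k| ≤ n^(2/3)/6 + 60. The allowed error is at least n^(2/3)/3, because ε(t) ≥ n^(-1/3).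

Probabilities are counts on a finite space. Exchanging two unprocessed vertices, or flipping a coin
not yet used, preserves the history; this yields the law of the next step (`sum_step_eq`), averaged
against functions of the history. Admissible constants come from short explicit paths of the
18-state chain. -/

/-! ### Existence of admissible constants -/

/-- The combinatorial support of the balanced chain. -/
def IsMove : VertexType → VertexType → Bool
  | Sum.inl (_, k), Sum.inl (false, l) => decide (l ≠ k)
  | Sum.inl _, Sum.inl (true, _) => false
  | Sum.inl (_, k), Sum.inr (_, x) => decide (x.1.1 = k)
  | Sum.inr (_, y), Sum.inl (false, l) => decide (l = y.1.1)
  | Sum.inr (_, y), Sum.inl (true, l) => decide (l = thirdColour y.1.1 y.1.2)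
  | Sum.inr (_, y), Sum.inr (false, x) => decide (x.1.2 = thirdColour y.1.1 y.1.2)
  | Sum.inr _, Sum.inr (true, _) => false

/-- Whether the vertex type has a forward edge, as a Boolean. -/
def forwardBit : VertexType → Bool
  | Sum.inl (e, _) => e
  | Sum.inr (e, _) => e

lemma isForward_iff_forwardBit (V : VertexType) : IsForward V ↔ forwardBit V = true := by
  rcases V with ⟨e, k⟩ | ⟨e, x⟩ <;> rfl

lemma balancedTransition_nonneg {q : ℝ} (hq : q ∈ Set.Ioo (0 : ℝ) 1) (V W : VertexType) :
    0 ≤ balancedTransition q V W := by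
  obtain ⟨h0, h1⟩ := hq
  rcases V with ⟨e, k⟩ | ⟨e, x⟩ <;> rcases W with ⟨_ | _, l⟩ | ⟨_ | _, y⟩ <;>
    simp only [balancedTransition, transition, Matrix.of_apply, Finset.sum_const, Finset.card_univ,
      Fintype.card_fin, nsmul_eq_mul] <;> (try split_ifs) <;> (try norm_num) <;> linarith

/-- Non-zero entries into backward types are q/3 or q/6, those into forward types (1 - q)/2 or 1 -
q. With one bound per kind of edge, a path can be priced by its word of edge kinds alone. -/
lemma le_balancedTransition {q : ℝ} (hq : q ∈ Set.Ioo (0 : ℝ) 1) {V W : VertexType}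
    (h : IsMove V W) :
    (if forwardBit W then (1 - q) / 2 else q / 6) ≤ balancedTransition q V W := by
  obtain ⟨h0, h1⟩ := hq
  rcases V with ⟨e, k⟩ | ⟨e, x⟩ <;> rcases W with ⟨_ | _, l⟩ | ⟨_ | _, y⟩ <;>
    simp [IsMove] at h <;>
    simp [balancedTransition, transition, forwardBit, h] <;> linarith

lemma prod_le_chainProb {q : ℝ} (hq : q ∈ Set.Ioo (0 : ℝ) 1) {V : VertexType}
    {E : Set (Fin 7 → VertexType)} (w : Fin 7 → VertexType) (h0 : w 0 = V) (hw : w ∈ E) :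
    ∏ i : Fin 6, balancedTransition q (w i.castSucc) (w i.succ) ≤
      chainProb (balancedTransition q) V 6 E := by
  classical
  have h := Finset.single_le_sum (s := Finset.univ)
    (f := fun w : Fin (6 + 1) → VertexType => if w 0 = V ∧ w ∈ E then
      ∏ i : Fin 6, balancedTransition q (w i.castSucc) (w i.succ) else 0)
    (fun w _ => by
      split_ifs
      · exact Finset.prod_nonneg fun i _ => balancedTransition_nonneg hq _ _
      · exact le_rfl) (Finset.mem_univ w)
  simp only [h0, hw, and_self, if_true] at h
  unfold chainProb
  convert h using 1

/-- `W` is reached from `V` by moves with the prescribed kinds of edges. -/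
def HasPath : List Bool → VertexType → VertexType → Prop
  | [], V, W => V = W
  | e :: es, V, W => ∃ U, (IsMove V U = true ∧ forwardBit U = e) ∧ HasPath es U W

instance decidableHasPath : ∀ es V W, Decidable (HasPath es V W)
  | [], V, W => inferInstanceAs (Decidable (V = W))
  | e :: es, V, W =>
    haveI := fun U => decidableHasPath es U W
    inferInstanceAs (Decidable (∃ U, (IsMove V U = true ∧ forwardBit U = e) ∧ HasPath es U W))

lemma HasPath.append {es fs : List Bool} {V U W : VertexType} (h : HasPath es V U)
    (h' : HasPath fs U W) : HasPath (es ++ fs) V W := by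
  induction es generalizing V with
  | nil => cases h; exact h'
  | cons e es ih =>
    obtain ⟨X, hX, hXU⟩ := h
    exact ⟨X, hX, ih hXU⟩

/-- A single path bounds the probability from below. It is cut after four and after five moves
because the hitting argument meets its target at time 4, 5 or 6, and `hE` has to refer to these
positions. -/
lemma HasPath.chainProb_ge {q : ℝ} (hq : q ∈ Set.Ioo (0 : ℝ) 1)
    {a b c d e f : Bool} {V X Y W : VertexType} (h : HasPath [a, b, c, d] V X)
    (hX : HasPath [e] X Y) (hY : HasPath [f] Y W)
    {E : Set (Fin 7 → VertexType)}
    (hE : ∀ w : Fin 7 → VertexType, w 0 = V → w 4 = X → w 5 = Y → w 6 = W → w ∈ E) :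
    ∏ i : Fin 6, (if ![a, b, c, d, e, f] i then (1 - q) / 2 else q / 6) ≤
      chainProb (balancedTransition q) V 6 E := by
  obtain ⟨h0, h1⟩ := hq
  obtain ⟨u, hu, v, hv, x, hx, X', hX', rfl⟩ := h
  obtain ⟨Y', hY', rfl⟩ := hX
  obtain ⟨W', hW', rfl⟩ := hY
  refine le_trans ?_
    (prod_le_chainProb ⟨h0, h1⟩ ![V, u, v, x, X', Y', W'] rfl (hE _ rfl rfl rfl rfl))
  apply Finset.prod_le_prod
  · intro i _
    split_ifs <;> linarith
  · have key : ∀ {A B : VertexType} {g : Bool}, IsMove A B = true ∧ forwardBit B = g →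
        (if g then (1 - q) / 2 else q / 6) ≤ balancedTransition q A B := by
      rintro A B g ⟨hm, rfl⟩
      exact le_balancedTransition ⟨h0, h1⟩ hm
    intro i _
    fin_cases i
    exacts [key hu, key hv, key hx, key hX', key hY', key hW']

lemma HasPath.split {es fs : List Bool} {V W : VertexType} (h : HasPath (es ++ fs) V W) :
    ∃ U, HasPath es V U ∧ HasPath fs U W := by
  induction es generalizing V with
  | nil => exact ⟨V, rfl, h⟩
  | cons e es ih =>
    obtain ⟨X, hX, hXW⟩ := h
    obtain ⟨U, hU, hUW⟩ := ih hXW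
    exact ⟨U, ⟨X, hX, hU⟩, hUW⟩

lemma HasPath.chainProb_ge_last {q : ℝ} (hq : q ∈ Set.Ioo (0 : ℝ) 1)
    {a b c d e f : Bool} {V W : VertexType} (h : HasPath [a, b, c, d, e, f] V W)
    {E : Set (Fin 7 → VertexType)} (hE : ∀ w : Fin 7 → VertexType, w 6 = W → w ∈ E) :
    ∏ i : Fin 6, (if ![a, b, c, d, e, f] i then (1 - q) / 2 else q / 6) ≤
      chainProb (balancedTransition q) V 6 E := by
  obtain ⟨Y, h, hY⟩ := HasPath.split (es := [a, b, c, d, e]) (fs := [f]) h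
  obtain ⟨X, h, hX⟩ := HasPath.split (es := [a, b, c, d]) (fs := [e]) h
  exact h.chainProb_ge hq hX hY fun w _ _ _ hw => hE w hw

set_option maxRecDepth 100000 in
lemma hasPath_backward_three : ∀ V W : VertexType, forwardBit W = false →
    HasPath [false, false, false] V W := by decide

set_option maxRecDepth 100000 in
lemma hasPath_backward_backward_forward : ∀ V W : VertexType, forwardBit W = true →
    HasPath [false, false, true] V W := by decide

/-- Two forward moves lead from A^(k) through B^(kl) to A^(m) with m the third colour, so they reach
either colour other than k. Two such double moves reach all three colours. -/
lemma hasPath_forward_four : ∀ (e : Bool) (k l : Fin 3),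
    HasPath [true, true, true, true] (Sum.inl (e, k)) (Sum.inl (true, l)) := by decide

lemma exists_hasPath_forward_backward : ∀ W : VertexType, forwardBit W = false →
    ∃ l, HasPath [true, false] (Sum.inl (true, l)) W := by decide

lemma exists_hasPath_backward : ∀ W : VertexType, forwardBit W = false →
    ∃ l, HasPath [false] (Sum.inl (true, l)) W := by decide

lemma exists_hasPath_forward_to_pair : ∀ x : {x : Fin 3 × Fin 3 // x.1 ≠ x.2},
    ∃ l, HasPath [true] (Sum.inl (true, l)) (Sum.inr (true, x)) := by decide

lemma exists_hasPath_forward : ∀ V : VertexType, ∃ W, HasPath [true] V W := by decide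

lemma exists_hasPath_forward_of_pair : ∀ (e : Bool) (x : {x : Fin 3 × Fin 3 // x.1 ≠ x.2}),
    ∃ l, HasPath [true] (Sum.inr (e, x)) (Sum.inl (true, l)) := by decide

/-- Forward moves alternate between A and B, so after five of them the parity of the start is still
visible. The final backward move must leave from B if the start is of type A, and from A if it is of
type B. -/
lemma hasPath_forward_five_backward (V W : VertexType) (hW : forwardBit W = false) :
    HasPath [true, true, true, true, true, false] V W := by
  rcases V with ⟨e, k⟩ | ⟨e, x⟩
  · obtain ⟨l, hl⟩ := exists_hasPath_forward_backward W hW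
    exact (hasPath_forward_four e k l).append hl
  · obtain ⟨l, hl⟩ := exists_hasPath_backward W hW
    obtain ⟨k, hk⟩ := exists_hasPath_forward_of_pair e x
    exact hk.append ((hasPath_forward_four true k l).append hl)

/-- Along forward edges every type with a forward edge is met within six steps. -/
lemma chainProb_hit_ge {q : ℝ} (hq : q ∈ Set.Ioo (0 : ℝ) 1) (V W : VertexType)
    (hW : forwardBit W = true) :
    ((1 - q) / 2) ^ 6 ≤ chainProb (balancedTransition q) V 6 {w | ∃ i, w i = W} := by
  have hprod : ∏ i : Fin 6, (if ![true, true, true, true, true, true] i then (1 - q) / 2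
      else q / 6) = ((1 - q) / 2) ^ 6 := by
    simp [Fin.prod_univ_six]; ring
  rw [← hprod]
  rcases V with ⟨e, k⟩ | ⟨e, x⟩
  · rcases W with ⟨e', l⟩ | ⟨e', y⟩ <;> obtain rfl : e' = true := hW
    · obtain ⟨Y, hY⟩ := exists_hasPath_forward (Sum.inl (true, l))
      obtain ⟨Z, hZ⟩ := exists_hasPath_forward Y
      exact (hasPath_forward_four e k l).chainProb_ge hq hY hZ fun w _ h4 _ _ => ⟨4, h4⟩
    · obtain ⟨l, hl⟩ := exists_hasPath_forward_to_pair y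
      obtain ⟨Z, hZ⟩ := exists_hasPath_forward (Sum.inr (true, y))
      exact (hasPath_forward_four e k l).chainProb_ge hq hl hZ fun w _ _ h5 _ => ⟨5, h5⟩
  · obtain ⟨k, hk⟩ := exists_hasPath_forward_of_pair e x
    rcases W with ⟨e', l⟩ | ⟨e', y⟩ <;> obtain rfl : e' = true := hW
    · obtain ⟨X, h, hX⟩ := HasPath.split (es := [true, true, true, true]) (fs := [true])
        (hk.append (hasPath_forward_four true k l))
      obtain ⟨Z, hZ⟩ := exists_hasPath_forward (Sum.inl (true, l))
      exact h.chainProb_ge hq hX hZ fun w _ _ h5 _ => ⟨5, h5⟩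
    · obtain ⟨l, hl⟩ := exists_hasPath_forward_to_pair y
      exact (hk.append ((hasPath_forward_four true k l).append hl)).chainProb_ge_last hq
        fun w h6 => ⟨6, h6⟩

/-- The bound must be uniform as q tends to 0 or 1. The path therefore uses the likelier kind of
edge, forward for q ≤ 1/2 and backward for q ≥ 1/2, except possibly for its last edge, which must be
of the kind of the target. The only factor that can become small is then the one contained in the
stationary mass, and the others are at least 1/12. For forward targets and small q the alternation
between A and B excludes a fixed time, hence the hitting event. -/
theorem exists_isConditionConstant : ∃ K : ℝ, IsConditionConstant K := by
  refine ⟨12 ^ 6, by norm_num, fun q hq V W => ⟨fun hW => ?_, fun hW => ?_⟩⟩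
  · obtain ⟨h0, h1⟩ := hq
    have hW' : forwardBit W = false := by
      rwa [isForward_iff_forwardBit, Bool.not_eq_true] at hW
    have hpi : balancedStationary q W ≤ q / 6 := by
      rcases W with ⟨e, k⟩ | ⟨e, x⟩ <;> obtain rfl : e = false := hW' <;>
        simp only [balancedStationary] <;> linarith
    rcases le_total q (1 / 2) with h2 | h2
    · refine le_trans ?_ ((hasPath_forward_five_backward V W hW').chainProb_ge_last ⟨h0, h1⟩
        fun w h => h)
      have h3 : (1 / 4 : ℝ) ^ 5 ≤ ((1 - q) / 2) ^ 5 :=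
        pow_le_pow_left₀ (by norm_num) (by linarith) 5
      have h4 : (1 / 4 : ℝ) ^ 5 * (q / 6) ≤ ((1 - q) / 2) ^ 5 * (q / 6) := by gcongr
      have h5 : ∏ i : Fin 6, (if ![true, true, true, true, true, false] i then (1 - q) / 2
          else q / 6) = ((1 - q) / 2) ^ 5 * (q / 6) := by
        simp only [Fin.prod_univ_six, Matrix.cons_val, Bool.false_eq_true, if_true, if_false]; ring
      rw [h5, div_le_iff₀ (by positivity)]
      nlinarith
    · have hpath := (hasPath_backward_three V (Sum.inl (false, 0)) rfl).append
        (hasPath_backward_three _ W hW')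
      refine le_trans ?_ (hpath.chainProb_ge_last ⟨h0, h1⟩ fun w h => h)
      have h3 : (1 / 12 : ℝ) ^ 5 ≤ (q / 6) ^ 5 :=
        pow_le_pow_left₀ (by norm_num) (by linarith) 5
      have h4 : (1 / 12 : ℝ) ^ 5 * (q / 6) ≤ (q / 6) ^ 5 * (q / 6) := by gcongr
      have h5 : ∏ i : Fin 6, (if ![false, false, false, false, false, false] i then (1 - q) / 2
          else q / 6) = (q / 6) ^ 5 * (q / 6) := by
        simp only [Fin.prod_univ_six, Matrix.cons_val, Bool.false_eq_true, if_false]; ring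
      rw [h5, div_le_iff₀ (by positivity)]
      nlinarith
  · obtain ⟨h0, h1⟩ := hq
    have hW' : forwardBit W = true := by rwa [isForward_iff_forwardBit] at hW
    have hpi : balancedStationary q W ≤ (1 - q) / 6 := by
      rcases W with ⟨e, k⟩ | ⟨e, x⟩ <;> obtain rfl : e = true := hW' <;>
        simp only [balancedStationary] <;> linarith
    rcases le_total q (1 / 2) with h2 | h2
    · refine le_trans ?_ (chainProb_hit_ge ⟨h0, h1⟩ V W hW')
      have h3 : (1 / 4 : ℝ) ^ 6 ≤ ((1 - q) / 2) ^ 6 :=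
        pow_le_pow_left₀ (by norm_num) (by linarith) 6
      rw [div_le_iff₀ (by positivity)]
      nlinarith
    · have hpath := (hasPath_backward_three V (Sum.inl (false, 0)) rfl).append
        (hasPath_backward_backward_forward _ W hW')
      refine le_trans ?_ (hpath.chainProb_ge_last ⟨h0, h1⟩ fun w h => ⟨6, h⟩)
      have h3 : (1 / 12 : ℝ) ^ 5 ≤ (q / 6) ^ 5 :=
        pow_le_pow_left₀ (by norm_num) (by linarith) 5
      have h4 : (1 / 12 : ℝ) ^ 5 * ((1 - q) / 2) ≤ (q / 6) ^ 5 * ((1 - q) / 2) := by gcongr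
      have h5 : ∏ i : Fin 6, (if ![false, false, false, false, false, true] i then (1 - q) / 2
          else q / 6) = (q / 6) ^ 5 * ((1 - q) / 2) := by
        simp only [Fin.prod_univ_six, Matrix.cons_val, Bool.false_eq_true, if_true, if_false]; ring
      rw [h5, div_le_iff₀ (by positivity)]
      nlinarith

/-! ### Basic facts on matchings and histories -/

section Matching

variable {n : ℕ} (M : PerfectMatching n)

lemma partner_mem {i : ℕ} (hi : i ∈ Finset.Icc 1 n) : partner M i ∈ Finset.Icc 1 n := by
  rw [partner, dif_pos hi]
  exact (M.1 ⟨i, hi⟩).2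

lemma partner_ne {i : ℕ} (hi : i ∈ Finset.Icc 1 n) : partner M i ≠ i := by
  rw [partner, dif_pos hi]
  intro h
  exact (M.2 ⟨i, hi⟩).1 (Subtype.ext h)

lemma partner_partner {i : ℕ} (hi : i ∈ Finset.Icc 1 n) : partner M (partner M i) = i := by
  have h := partner_mem M hi
  rw [partner, dif_pos h]
  simp only [partner, dif_pos hi]
  exact congrArg Subtype.val (M.2 ⟨i, hi⟩).2

lemma partner_of_notMem {i : ℕ} (hi : i ∉ Finset.Icc 1 n) : partner M i = 0 := dif_neg hi

lemma partner_le (i : ℕ) : partner M i ≤ n := by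
  by_cases hi : i ∈ Finset.Icc 1 n
  · exact (Finset.mem_Icc.1 (partner_mem M hi)).2
  · rw [partner_of_notMem M hi]; exact Nat.zero_le _

lemma partner_eq_iff {i j : ℕ} (hi : i ∈ Finset.Icc 1 n) (hj : j ∈ Finset.Icc 1 n) :
    partner M i = j ↔ partner M j = i := by
  constructor <;> rintro rfl
  · exact partner_partner M hi
  · exact partner_partner M hj

variable {M}

lemma partner_eq_of_history_eq {M' : PerfectMatching n} {i : ℕ}
    (h : history M i = history M' i) {v : ℕ} (hv : v ≤ i) (hb : partner M v < v) :
    partner M' v = partner M v := by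
  have h1 := congrFun h v
  have hv0 : v ∈ Finset.Icc 1 n ∨ v ∉ Finset.Icc 1 n := em _
  rcases hv0 with hv0 | hv0
  · have h2 := Finset.mem_Icc.1 (partner_mem M hv0)
    unfold history at h1
    rw [if_pos ⟨hv, hb⟩] at h1
    split_ifs at h1 <;> omega
  · rw [partner_of_notMem M hv0, partner_of_notMem M' hv0]

/-- A matching edge inside [i] is recorded at its larger endpoint, so the history determines which
vertices of [i] are still unsaturated. -/
lemma lt_partner_iff_of_history_eq {M' : PerfectMatching n} {i : ℕ}
    (h : history M i = history M' i) {v : ℕ} (hv : v ≤ i) :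
    i < partner M v ↔ i < partner M' v := by
  have key : ∀ M M' : PerfectMatching n, history M i = history M' i →
      i < partner M v → i < partner M' v := by
    intro M M' h hlt
    by_cases hv0 : v ∈ Finset.Icc 1 n
    · by_contra hcon
      have h1 := partner_mem M' hv0
      have h2 := partner_ne M' hv0
      rcases lt_or_gt_of_ne h2 with h3 | h3
      · have := partner_eq_of_history_eq h.symm hv h3
        omega
      · have h4 := partner_partner M' hv0
        have h5 := partner_eq_of_history_eq h.symm (v := partner M' v) (by omega) (by omega)
        rw [h4, partner_eq_iff M h1 hv0] at h5
        omega
    · rw [partner_of_notMem M hv0] at hlt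
      omega
  exact ⟨key M M' h, key M' M h.symm⟩

lemma history_eq_of_le {M' : PerfectMatching n} {i j : ℕ} (hij : i ≤ j)
    (h : history M j = history M' j) : history M i = history M' i := by
  funext v
  have h1 := congrFun h v
  unfold history at h1 ⊢
  by_cases hv : v ≤ i
  · simpa [hv, hv.trans hij] using h1
  · simp [hv]

lemma partner_eq_of_history_eq_of_le {M' : PerfectMatching n} {i : ℕ}
    (h : history M i = history M' i) {v : ℕ} (hv : v ≤ i) (hb : partner M v ≤ i) :
    partner M' v = partner M v := by
  by_cases hv0 : v ∈ Finset.Icc 1 n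
  · rcases lt_or_gt_of_ne (partner_ne M hv0) with h1 | h1
    · exact partner_eq_of_history_eq h hv h1
    · have h2 := partner_partner M hv0
      have h3 := partner_eq_of_history_eq h (v := partner M v) hb (by omega)
      rw [h2] at h3
      exact (partner_eq_iff M' (partner_mem M hv0) hv0).1 h3
  · rw [partner_of_notMem M hv0, partner_of_notMem M' hv0]

variable (M)

/-- As i < n, the closing edge {n, 1} of the cycle does not lie inside [i]; only path edges and
matching edges remain. -/
lemma adj_of_lt {i u v : ℕ} (hi : i < n) (hu : u ∈ Finset.Icc 1 i) (hv : v ∈ Finset.Icc 1 i)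
    (huv : u < v) :
    (cycleMatchingGraph M).Adj u v ↔ v = u + 1 ∨ partner M u = v := by
  rw [Finset.mem_Icc] at hu hv
  have hu' : u ∈ Finset.Icc 1 n := Finset.mem_Icc.2 (by omega)
  have hv' : v ∈ Finset.Icc 1 n := Finset.mem_Icc.2 (by omega)
  rw [cycleMatchingGraph, SimpleGraph.fromRel_adj]
  have h := partner_eq_iff M hu' hv'
  constructor
  · rintro ⟨-, ⟨-, -, h1 | h1 | h1⟩ | ⟨-, -, h1 | h1 | h1⟩⟩
    · exact Or.inl h1
    · omega
    · exact Or.inr h1.symm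
    · omega
    · omega
    · exact Or.inr (h.2 h1.symm)
  · intro h1
    refine ⟨huv.ne, Or.inl ⟨hu', hv', ?_⟩⟩
    rcases h1 with h1 | h1
    · exact Or.inl h1
    · exact Or.inr (Or.inr h1.symm)

/-- Properness of a colouring of `[i]`, in terms of the path and the matching. -/
def IsProperUpTo (i : ℕ) (c : ℕ → Fin 3) : Prop :=
  ∀ u v, 1 ≤ u → u < v → v ≤ i → (v = u + 1 ∨ partner M u = v) → c u ≠ c v

lemma isProperUpTo_iff {i : ℕ} (hi : i < n) (c : ℕ → Fin 3) :
    IsProperUpTo M i c ↔ ∀ u ∈ Finset.Icc 1 i, ∀ v ∈ Finset.Icc 1 i,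
      (cycleMatchingGraph M).Adj u v → c u ≠ c v := by
  constructor
  · intro h u hu v hv huv
    rcases lt_or_gt_of_ne huv.ne with hlt | hlt
    · exact h u v (Finset.mem_Icc.1 hu).1 hlt (Finset.mem_Icc.1 hv).2
        ((adj_of_lt M hi hu hv hlt).1 huv)
    · exact (h v u (Finset.mem_Icc.1 hv).1 hlt (Finset.mem_Icc.1 hu).2
        ((adj_of_lt M hi hv hu hlt).1 huv.symm)).symm
  · intro h u v hu huv hv hadj
    have hu' : u ∈ Finset.Icc 1 i := Finset.mem_Icc.2 (by omega)
    have hv' : v ∈ Finset.Icc 1 i := Finset.mem_Icc.2 (by omega)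
    exact h u hu' v hv' ((adj_of_lt M hi hu' hv' huv).2 hadj)

end Matching

/-! ### Existence of `BalancedGreedy` rules -/

lemma exists_ne_ne : ∀ a b : Fin 3, ∃ c, c ≠ a ∧ c ≠ b := by decide

/-- The greedy colouring: every vertex avoids the colours of at most two earlier ones. -/
lemma exists_greedy (f g : ℕ → ℕ) : ∃ c : ℕ → Fin 3, ∀ v,
    (f v < v → c v ≠ c (f v)) ∧ (g v < v → c v ≠ c (g v)) := by
  choose φ hφ using exists_ne_ne
  let F : (v : ℕ) → ((u : ℕ) → u < v → Fin 3) → Fin 3 := fun v c =>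
    φ (if h : f v < v then c (f v) h else 0) (if h : g v < v then c (g v) h else 0)
  have key : ∀ v, Nat.strongRec (motive := fun _ => Fin 3) F v =
      F v fun u _ => Nat.strongRec (motive := fun _ => Fin 3) F u := fun v => by
    conv_lhs => rw [Nat.strongRec]
  refine ⟨fun v => Nat.strongRec (motive := fun _ => Fin 3) F v, fun v => ⟨fun h => ?_, fun h => ?_⟩⟩
  · show Nat.strongRec (motive := fun _ => Fin 3) F v ≠ _
    rw [key v]
    have := (hφ (if h : f v < v then Nat.strongRec (motive := fun _ => Fin 3) F (f v) else 0)
      (if h : g v < v then Nat.strongRec (motive := fun _ => Fin 3) F (g v) else 0)).1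
    conv at this => rhs; rw [dif_pos h]
    exact this
  · show Nat.strongRec (motive := fun _ => Fin 3) F v ≠ _
    rw [key v]
    have := (hφ (if h : f v < v then Nat.strongRec (motive := fun _ => Fin 3) F (f v) else 0)
      (if h : g v < v then Nat.strongRec (motive := fun _ => Fin 3) F (g v) else 0)).2
    conv at this => rhs; rw [dif_pos h]
    exact this

/-- Maximum minus minimum of three numbers. -/
def spread (f : Fin 3 → ℕ) : ℕ :=
  Finset.univ.sup' Finset.univ_nonempty f - Finset.univ.inf' Finset.univ_nonempty f

lemma spread_le_iff {f : Fin 3 → ℕ} {d : ℕ} : spread f ≤ d ↔ ∀ k l, f k ≤ f l + d := by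
  unfold spread
  obtain ⟨a, -, ha⟩ := Finset.exists_mem_eq_sup' (Finset.univ_nonempty (α := Fin 3)) f
  obtain ⟨z, -, hz⟩ := Finset.exists_mem_eq_inf' (Finset.univ_nonempty (α := Fin 3)) f
  constructor
  · intro h k l
    have h1 := Finset.le_sup' f (Finset.mem_univ k)
    have h2 := Finset.inf'_le f (Finset.mem_univ l)
    omega
  · intro h
    have := h a z
    omega

lemma exists_spread (f : Fin 3 → ℕ) :
    ∃ a z, f a = f z + spread f ∧ ∀ l, f z ≤ f l ∧ f l ≤ f a := by
  unfold spread
  obtain ⟨a, -, ha⟩ := Finset.exists_mem_eq_sup' (Finset.univ_nonempty (α := Fin 3)) f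
  obtain ⟨z, -, hz⟩ := Finset.exists_mem_eq_inf' (Finset.univ_nonempty (α := Fin 3)) f
  have key : ∀ l, f z ≤ f l ∧ f l ≤ f a := fun l =>
    ⟨hz ▸ Finset.inf'_le f (Finset.mem_univ l), ha ▸ Finset.le_sup' f (Finset.mem_univ l)⟩
  refine ⟨a, z, ?_, key⟩
  have := (key a).1
  omega

/-- Seven vertices can be split as 3 + 2 + 2 or 1 + 3 + 3. If the spread exceeds 1 and both other
colours sit at the minimum, the largest colour gets 1 and the others 3. Otherwise a smallest colour
gets 3: for spread above 1 it is the only minimum, so the spread drops, and a spread of at most 1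
stays at most 1. -/
lemma exists_balancing (f : Fin 3 → ℕ) : ∃ g : Fin 3 → ℕ,
    ((∃ k, ∀ l, g l = if l = k then 3 else 2) ∨ ∃ k, ∀ l, g l = if l = k then 1 else 3) ∧
    (1 < spread f → spread (fun l => f l + g l) + 1 ≤ spread f) ∧
    (spread f ≤ 1 → spread (fun l => f l + g l) ≤ 1) := by
  obtain ⟨a, z, haz, hl⟩ := exists_spread f
  have h0 := hl 0
  have h1 := hl 1
  have h2 := hl 2
  by_cases hcase : 1 < spread f ∧ ∀ l, l ≠ a → f l = f z
  · obtain ⟨hD, hc⟩ := hcase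
    refine ⟨fun l => if l = a then 1 else 3, Or.inr ⟨a, fun l => rfl⟩, fun _ => ?_, fun h => by omega⟩
    have : spread (fun l => f l + if l = a then 1 else 3) ≤ spread f - 1 := by
      rw [spread_le_iff]
      intro k l
      have hk := hc k
      have hl' := hc l
      split_ifs with h3 h4 h4
      · subst h3 h4; omega
      · subst h3; have := hl' h4; omega
      · subst h4; have := hk h3; omega
      · have := hl' h4; have := hk h3; omega
    change spread (fun l => f l + if l = a then 1 else 3) + 1 ≤ spread f
    omega
  · refine ⟨fun l => if l = z then 3 else 2, Or.inl ⟨z, fun l => rfl⟩, ?_, ?_⟩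
    · intro hD
      push Not at hcase
      obtain ⟨m, hma, hmz⟩ := hcase hD
      have hm := hl m
      have : spread (fun l => f l + if l = z then 3 else 2) ≤ spread f - 1 := by
        rw [spread_le_iff]
        intro k l
        have hk := hl k
        have hl' := hl l
        have hne : l ≠ z → f z + 1 ≤ f l := by
          intro hlz
          have hzm : z ≠ m := fun h => hmz (by rw [h])
          have hza : z ≠ a := fun h => by rw [h] at haz; omega
          have : l = a ∨ l = m := by omega
          rcases this with rfl | rfl <;> omega
        split_ifs with h3 h4 h4
        · subst h3 h4; omega
        · subst h3; have := hne h4; omega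
        · subst h4; omega
        · have := hne h4; omega
      change spread (fun l => f l + if l = z then 3 else 2) + 1 ≤ spread f
      omega
    · intro hD
      change spread (fun l => f l + if l = z then 3 else 2) ≤ 1
      rw [spread_le_iff]
      intro k l
      have hk := hl k
      have hl' := hl l
      split_ifs with h3 h4 h4
      · subst h3 h4; omega
      · subst h3; omega
      · subst h4; omega
      · omega

-- The properness conditions are interleaved with the quantifiers so that an improper prefix is
-- discarded before its continuations are searched.
set_option maxRecDepth 100000 in
set_option maxHeartbeats 4000000 in
lemma exists_word_list_surplus : ∀ x y k : Fin 3,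
    ∃ a, a ≠ x ∧ ∃ b, b ≠ a ∧ ∃ c, c ≠ b ∧ ∃ d, d ≠ c ∧ ∃ e, e ≠ d ∧ ∃ f, f ≠ e ∧ ∃ g, g ≠ f ∧
      g ≠ y ∧ ∀ l, [a, b, c, d, e, f, g].count l = if l = k then 3 else 2 := by decide

set_option maxRecDepth 100000 in
set_option maxHeartbeats 4000000 in
lemma exists_word_list_deficit : ∀ x y k : Fin 3,
    ∃ a, a ≠ x ∧ ∃ b, b ≠ a ∧ ∃ c, c ≠ b ∧ ∃ d, d ≠ c ∧ ∃ e, e ≠ d ∧ ∃ f, f ≠ e ∧ ∃ g, g ≠ f ∧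
      g ≠ y ∧ ∀ l, [a, b, c, d, e, f, g].count l = if l = k then 1 else 3 := by decide

/-- A batch can be coloured with a prescribed almost balanced distribution of the colours, whatever
the colours of its two neighbours on the path. -/
lemma exists_word (x y : Fin 3) (μ : Fin 3 → ℕ)
    (hμ : (∃ k, ∀ l, μ l = if l = k then 3 else 2) ∨ ∃ k, ∀ l, μ l = if l = k then 1 else 3) :
    ∃ w : ℕ → Fin 3, w 0 ≠ x ∧ w 6 ≠ y ∧ (∀ i < 6, w i ≠ w (i + 1)) ∧
      ∀ l, ((Finset.range 7).filter fun i => w i = l).card = μ l := by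
  have key : ∃ a, a ≠ x ∧ ∃ b, b ≠ a ∧ ∃ c, c ≠ b ∧ ∃ d, d ≠ c ∧ ∃ e, e ≠ d ∧ ∃ f, f ≠ e ∧
      ∃ g, g ≠ f ∧ g ≠ y ∧ ∀ l, [a, b, c, d, e, f, g].count l = μ l := by
    rcases hμ with ⟨k, hk⟩ | ⟨k, hk⟩
    · simp only [hk]
      exact exists_word_list_surplus x y k
    · simp only [hk]
      exact exists_word_list_deficit x y k
  obtain ⟨a, ha, b, hb, c, hc, d, hd, e, he, f, hf, g, hg, hy, hl⟩ := key
  refine ⟨fun i => [a, b, c, d, e, f, g].getD i 0, ha, hy, ?_, fun l => ?_⟩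
  · intro i hi
    interval_cases i
    exacts [hb.symm, hc.symm, hd.symm, he.symm, hf.symm, hg.symm]
  · rw [← hl l, Finset.card_filter]
    simp only [Finset.sum_range_succ, Finset.sum_range_zero, List.count_cons, List.count_nil,
      List.getD_cons_zero, List.getD_cons_succ, beq_iff_eq]
    ring

section Batches

variable {n : ℕ} (M : PerfectMatching n) {i₀ : ℕ}

lemma discrepancy_eq_spread (c : ℕ → Fin 3) (b : ℕ) :
    discrepancy M i₀ c b = spread (batchCount M i₀ c b) := rfl

lemma batchCount_congr {c c' : ℕ → Fin 3} {b : ℕ}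
    (h : ∀ v ∈ Finset.Icc 1 i₀, (¬ IsGoodBatch M i₀ ((v - 1) / 7) ∨ (v - 1) / 7 < b) → c v = c' v) :
    batchCount M i₀ c b = batchCount M i₀ c' b := by
  funext k
  unfold batchCount
  congr 1
  ext v
  simp only [Finset.mem_filter]
  refine and_congr_right fun hv => ?_
  constructor
  · rintro ⟨h1, h2, h3⟩
    exact ⟨h1, (h v hv h3) ▸ h2, h3⟩
  · rintro ⟨h1, h2, h3⟩
    exact ⟨h1, (h v hv h3).trans h2, h3⟩

lemma batchCount_succ_of_bad (c : ℕ → Fin 3) {b : ℕ} (hb : ¬ IsGoodBatch M i₀ b) :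
    batchCount M i₀ c (b + 1) = batchCount M i₀ c b := by
  funext k
  unfold batchCount
  congr 1
  ext v
  simp only [Finset.mem_filter]
  have : (¬ IsGoodBatch M i₀ ((v - 1) / 7) ∨ (v - 1) / 7 < b + 1) ↔
      (¬ IsGoodBatch M i₀ ((v - 1) / 7) ∨ (v - 1) / 7 < b) := by
    constructor
    · rintro (h | h)
      · exact Or.inl h
      · rcases Nat.lt_succ_iff_lt_or_eq.1 h with h | h
        · exact Or.inr h
        · exact Or.inl (h ▸ hb)
    · rintro (h | h)
      · exact Or.inl h
      · exact Or.inr (by omega)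
  rw [this]

lemma batchCount_succ_of_good (c : ℕ → Fin 3) {b : ℕ} (hb : IsGoodBatch M i₀ b) (k : Fin 3) :
    batchCount M i₀ c (b + 1) k = batchCount M i₀ c b k +
      ((Finset.range 7).filter fun i => c (7 * b + 1 + i) = k).card := by
  classical
  unfold batchCount
  have himg : ((Finset.range 7).filter fun i => c (7 * b + 1 + i) = k).card =
      (((Finset.range 7).filter fun i => c (7 * b + 1 + i) = k).image
        fun i => 7 * b + 1 + i).card :=
    (Finset.card_image_of_injective _ (add_right_injective _)).symm
  rw [himg, ← Finset.card_union_of_disjoint]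
  · congr 1
    ext v
    simp only [Finset.mem_filter, Finset.mem_union, Finset.mem_image, Finset.mem_range]
    constructor
    · rintro ⟨h1, h2, h3, h4⟩
      by_cases h5 : (v - 1) / 7 = b
      · right
        have := Finset.mem_Icc.1 h1
        refine ⟨v - (7 * b + 1), ⟨by omega, ?_⟩, by omega⟩
        rwa [show 7 * b + 1 + (v - (7 * b + 1)) = v by omega]
      · left
        refine ⟨h1, h2, h3, ?_⟩
        rcases h4 with h4 | h4
        · exact Or.inl h4
        · exact Or.inr (by omega)
    · rintro (⟨h1, h2, h3, h4⟩ | ⟨i, ⟨hi, h2⟩, rfl⟩)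
      · refine ⟨h1, h2, h3, ?_⟩
        rcases h4 with h4 | h4
        · exact Or.inl h4
        · exact Or.inr (by omega)
      · have h1 := hb.1
        exact ⟨Finset.mem_Icc.2 (by omega), hb.2 _ (Finset.mem_Icc.2 (by omega)), h2,
          Or.inr (by omega)⟩
  · rw [Finset.disjoint_left]
    intro v h1 h2
    simp only [Finset.mem_filter, Finset.mem_image, Finset.mem_range] at h1 h2
    obtain ⟨i, ⟨hi, -⟩, rfl⟩ := h2
    have h3 : (7 * b + 1 + i - 1) / 7 = b := by omega
    rw [h3] at h1
    rcases h1.2.2.2 with h4 | h4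
    · exact h4 hb
    · omega

/-- A proper colouring can be changed on a good batch so as to balance the colours. -/
lemma exists_recolour (hi : i₀ < n) {c : ℕ → Fin 3} (hc : IsProperUpTo M i₀ c) {b : ℕ}
    (hb : IsGoodBatch M i₀ b) : ∃ c' : ℕ → Fin 3, IsProperUpTo M i₀ c' ∧
      (∀ v, (v - 1) / 7 ≠ b → c' v = c v) ∧
      (1 < discrepancy M i₀ c' b → discrepancy M i₀ c' (b + 1) + 1 ≤ discrepancy M i₀ c' b) ∧
      (discrepancy M i₀ c' b ≤ 1 → discrepancy M i₀ c' (b + 1) ≤ 1) := by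
  obtain ⟨g, hg, h1, h2⟩ := exists_balancing (batchCount M i₀ c b)
  -- The path neighbours of the batch are 7b and 7b + 8. If one of them lies outside [i₀], avoiding
  -- its meaningless colour does no harm.
  obtain ⟨w, hw0, hw6, hw, hcount⟩ := exists_word (c (7 * b)) (c (7 * b + 8)) g hg
  have hb1 := hb.1
  let c' : ℕ → Fin 3 := fun v => if 7 * b + 1 ≤ v ∧ v ≤ 7 * b + 7 then w (v - (7 * b + 1)) else c v
  have hin : ∀ v, 7 * b + 1 ≤ v → v ≤ 7 * b + 7 → c' v = w (v - (7 * b + 1)) := fun v h h' =>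
    if_pos ⟨h, h'⟩
  have hout : ∀ v, ¬ (7 * b + 1 ≤ v ∧ v ≤ 7 * b + 7) → c' v = c v := fun v h => if_neg h
  have hbc : batchCount M i₀ c' b = batchCount M i₀ c b := by
    apply batchCount_congr
    intro v hv h
    have hv1 := Finset.mem_Icc.1 hv
    apply hout
    rintro ⟨h3, h4⟩
    have h5 : (v - 1) / 7 = b := by omega
    rw [h5] at h
    rcases h with h | h
    · exact h hb
    · omega
  have hbs : batchCount M i₀ c' (b + 1) = fun l => batchCount M i₀ c b l + g l := by
    funext l
    rw [batchCount_succ_of_good M c' hb, hbc, ← hcount l]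
    congr 2
    apply Finset.filter_congr
    intro i hi
    rw [Finset.mem_range] at hi
    rw [hin _ (by omega) (by omega), show 7 * b + 1 + i - (7 * b + 1) = i by omega]
  refine ⟨c', ?_, ?_, ?_, ?_⟩
  · intro u v hu huv hv hadj
    -- All matching edges of a good batch leave [i₀], so an edge of [i₀] that touches the batch is a
    -- path edge.
    by_cases hu' : 7 * b + 1 ≤ u ∧ u ≤ 7 * b + 7
    · have hpu := hb.2 u (Finset.mem_Icc.2 hu')
      have hvu : v = u + 1 := by omega
      subst hvu
      rw [hin u hu'.1 hu'.2]
      by_cases h7 : u = 7 * b + 7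
      · rw [hout _ (by omega)]
        subst h7
        rw [show 7 * b + 7 - (7 * b + 1) = 6 by omega]
        exact hw6
      · rw [hin (u + 1) (by omega) (by omega),
          show u + 1 - (7 * b + 1) = u - (7 * b + 1) + 1 by omega]
        exact hw _ (by omega)
    · rw [hout u hu']
      by_cases hv' : 7 * b + 1 ≤ v ∧ v ≤ 7 * b + 7
      · have hpv := hb.2 v (Finset.mem_Icc.2 hv')
        have hvu : v = u + 1 := by
          rcases hadj with h | h
          · exact h
          · have := (partner_eq_iff M (i := u) (j := v) (Finset.mem_Icc.2 (by omega))
              (Finset.mem_Icc.2 (by omega))).1 h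
            omega
        have hu7 : u = 7 * b := by omega
        subst hvu hu7
        rw [hin _ le_rfl (by omega), Nat.sub_self]
        exact hw0.symm
      · rw [hout v hv']
        exact hc u v hu huv hv hadj
  · intro v hv
    apply hout
    omega
  · rw [discrepancy_eq_spread, discrepancy_eq_spread, hbs, hbc]
    exact h1
  · rw [discrepancy_eq_spread, discrepancy_eq_spread, hbs, hbc]
    exact h2

/-- A greedy colouring of all of [i₀] is repaired one good batch at a time. Recolouring the good
batch B does not disturb what was achieved before: the discrepancies with index at most B count no
vertex of it. -/
lemma exists_isBalancedGreedy (hi : i₀ < n) : ∃ c : ℕ → Fin 3, IsBalancedGreedy M i₀ c := by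
  have key : ∀ B, ∃ c : ℕ → Fin 3, IsProperUpTo M i₀ c ∧ ∀ b < B, IsGoodBatch M i₀ b →
      (1 < discrepancy M i₀ c b → discrepancy M i₀ c (b + 1) + 1 ≤ discrepancy M i₀ c b) ∧
      (discrepancy M i₀ c b ≤ 1 → discrepancy M i₀ c (b + 1) ≤ 1) := by
    intro B
    induction B with
    | zero =>
      obtain ⟨c, hc⟩ := exists_greedy (fun v => v - 1) (partner M)
      refine ⟨c, fun u v hu huv hv hadj => ?_, fun b hb => absurd hb (Nat.not_lt_zero b)⟩
      rcases hadj with rfl | h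
      · exact ((hc (u + 1)).1 (by simp)).symm
      · have h' := (partner_eq_iff M (i := u) (j := v) (Finset.mem_Icc.2 (by omega))
          (Finset.mem_Icc.2 (by omega))).1 h
        have := (hc v).2 (by omega)
        rw [h'] at this
        exact this.symm
    | succ B ih =>
      obtain ⟨c, hc, hB⟩ := ih
      by_cases hgood : IsGoodBatch M i₀ B
      · obtain ⟨c', hc', hagree, hD⟩ := exists_recolour M hi hc hgood
        refine ⟨c', hc', fun b hb hbg => ?_⟩
        rcases Nat.lt_succ_iff_lt_or_eq.1 hb with hlt | rfl
        · have hcongr : ∀ b' ≤ B, discrepancy M i₀ c' b' = discrepancy M i₀ c b' := by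
            intro b' hb'
            rw [discrepancy_eq_spread, discrepancy_eq_spread]
            congr 1
            apply batchCount_congr
            intro v _ hv
            apply hagree
            rintro h
            rw [h] at hv
            rcases hv with hv | hv
            · exact hv hgood
            · omega
          rw [hcongr b (by omega), hcongr (b + 1) (by omega)]
          exact hB b hlt hbg
        · exact hD
      · refine ⟨c, hc, fun b hb hbg => ?_⟩
        rcases Nat.lt_succ_iff_lt_or_eq.1 hb with hlt | rfl
        · exact hB b hlt hbg
        · exact absurd hbg hgood
  obtain ⟨c, hc, hB⟩ := key i₀
  refine ⟨c, (isProperUpTo_iff M hi c).1 hc, fun b hb => hB b ?_ hb⟩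
  have := hb.1
  omega

variable {M}

lemma isGoodBatch_congr {M' : PerfectMatching n} (h : history M i₀ = history M' i₀) (b : ℕ) :
    IsGoodBatch M i₀ b ↔ IsGoodBatch M' i₀ b := by
  unfold IsGoodBatch
  refine and_congr_right fun hb => forall₂_congr fun v hv => ?_
  have := Finset.mem_Icc.1 hv
  exact lt_partner_iff_of_history_eq h (by omega)

lemma IsBalancedGreedy.congr {M' : PerfectMatching n} (hi : i₀ < n)
    (h : history M i₀ = history M' i₀) {c : ℕ → Fin 3} (hc : IsBalancedGreedy M i₀ c) :
    IsBalancedGreedy M' i₀ c := by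
  have hcount : ∀ b, discrepancy M i₀ c b = discrepancy M' i₀ c b := by
    intro b
    rw [discrepancy_eq_spread, discrepancy_eq_spread]
    congr 1
    funext k
    unfold batchCount
    congr 1
    ext v
    simp only [Finset.mem_filter]
    refine and_congr_right fun hv => ?_
    rw [lt_partner_iff_of_history_eq h (Finset.mem_Icc.1 hv).2, isGoodBatch_congr h]
  refine ⟨?_, fun b hb => ?_⟩
  · rw [← isProperUpTo_iff M' hi]
    have := (isProperUpTo_iff M hi c).2 hc.1
    intro u v hu huv hv hadj
    refine this u v hu huv hv ?_
    rcases hadj with hadj | hadj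
    · exact Or.inl hadj
    · right
      rw [← hadj]
      exact partner_eq_of_history_eq_of_le h.symm (by omega) (by omega)
  · rw [← hcount, ← hcount]
    exact hc.2 b ((isGoodBatch_congr h b).2 hb)

/-- The rule colours one chosen matching with the given history. Being an output of `BalancedGreedy`
depends on the history only, so the colouring serves every matching with that history. -/
theorem exists_isBalancedGreedyRule {n i₀ : ℕ} (hi : i₀ < n) :
    ∃ rule : (ℕ → ℕ) → ℕ → Fin 3, IsBalancedGreedyRule n i₀ rule := by
  classical
  refine ⟨fun h => if hM : ∃ M : PerfectMatching n, history M i₀ = h then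
    (exists_isBalancedGreedy hM.choose hi).choose else 0, fun M => ?_⟩
  have hM : ∃ M' : PerfectMatching n, history M' i₀ = history M i₀ := ⟨M, rfl⟩
  beta_reduce
  rw [dif_pos hM]
  exact (exists_isBalancedGreedy hM.choose hi).choose_spec.congr hi hM.choose_spec

end Batches

/-! ### The outcome of the burn-in phase -/

section BurnIn

variable {n : ℕ} (M : PerfectMatching n) {i₀ : ℕ}

/-- The saturated vertices of `[i]`. -/
def saturatedSet (i : ℕ) : Finset ℕ := (Finset.Icc 1 i).filter fun v => partner M v ≤ i

/-- The unsaturated vertices of `[i]`. -/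
def unsaturatedSet (i : ℕ) : Finset ℕ := (Finset.Icc 1 i).filter fun v => i < partner M v

-- A full batch is bad only if it contains a saturated vertex.
open Classical in
lemma card_bad_le : ((Finset.range (i₀ / 7)).filter fun b => ¬ IsGoodBatch M i₀ b).card ≤
    (saturatedSet M i₀).card := by
  refine le_trans (Finset.card_le_card ?_) (Finset.card_image_le (f := fun v => (v - 1) / 7))
  intro b hb
  simp only [Finset.mem_filter, Finset.mem_range, IsGoodBatch, not_and, not_forall, not_lt] at hb
  obtain ⟨hb1, hb2⟩ := hb
  obtain ⟨v, hv, hp⟩ := hb2 (by omega)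
  rw [Finset.mem_Icc] at hv
  rw [Finset.mem_image]
  exact ⟨v, Finset.mem_filter.2 ⟨Finset.mem_Icc.2 (by omega), hp⟩, by omega⟩

/-- Before the first good batch only vertices of bad batches are counted, at most seven in each; the
additional 1 accounts for the last, shorter batch. -/
lemma discrepancy_zero_le (c : ℕ → Fin 3) :
    discrepancy M i₀ c 0 ≤ 7 * ((saturatedSet M i₀).card + 1) := by
  classical
  rw [discrepancy_eq_spread, spread_le_iff]
  intro k l
  refine le_trans ?_ (Nat.le_add_left _ _)
  have hbad : ((Finset.range (i₀ / 7 + 1)).filter fun b => ¬ IsGoodBatch M i₀ b).card ≤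
      (saturatedSet M i₀).card + 1 := by
    rw [Finset.range_add_one, Finset.filter_insert]
    split_ifs
    · exact (card_bad_le M).trans (Nat.le_succ _)
    · exact (Finset.card_insert_le _ _).trans (Nat.succ_le_succ (card_bad_le M))
  refine le_trans ?_ (Nat.mul_le_mul_left 7 hbad)
  unfold batchCount
  refine Finset.card_le_mul_card_image_of_maps_to (f := fun v => (v - 1) / 7) ?_ 7 ?_
  · intro v hv
    simp only [Finset.mem_filter, Finset.mem_Icc, Finset.mem_range, Nat.not_lt_zero, or_false]
      at hv ⊢
    exact ⟨by omega, hv.2.2.2⟩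
  · intro b _
    refine le_trans (Finset.card_le_card (t := Finset.Icc (7 * b + 1) (7 * b + 7)) ?_) (by simp)
    intro v hv
    simp only [Finset.mem_filter, Finset.mem_Icc] at hv ⊢
    omega

open Classical in
lemma discrepancy_add_card_good_le {c : ℕ → Fin 3} (hc : IsBalancedGreedy M i₀ c) (b : ℕ) :
    discrepancy M i₀ c b ≤ 1 ∨ discrepancy M i₀ c b +
      ((Finset.range b).filter fun b => IsGoodBatch M i₀ b).card ≤ discrepancy M i₀ c 0 := by
  induction b with
  | zero => right; simp
  | succ b ih =>
    by_cases hb : IsGoodBatch M i₀ b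
    · obtain ⟨h1, h2⟩ := hc.2 b hb
      rcases le_or_gt (discrepancy M i₀ c b) 1 with h3 | h3
      · exact Or.inl (h2 h3)
      · right
        have h4 := h1 h3
        rw [Finset.range_add_one, Finset.filter_insert, if_pos hb, Finset.card_insert_of_notMem
          (by simp)]
        omega
    · rw [discrepancy_eq_spread M c (b + 1), batchCount_succ_of_bad M c hb,
        Finset.range_add_one, Finset.filter_insert, if_neg hb]
      exact ih

/-- If few vertices of `[i₀]` are saturated, then the unsaturated vertices are evenly coloured. -/
theorem card_unsaturated_le_of_isBalancedGreedy {c : ℕ → Fin 3} (hc : IsBalancedGreedy M i₀ c)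
    (hs : 8 * (saturatedSet M i₀).card + 7 ≤ i₀ / 7) (k l : Fin 3) :
    ((unsaturatedSet M i₀).filter fun v => c v = k).card ≤
      ((unsaturatedSet M i₀).filter fun v => c v = l).card + 1 := by
  classical
  have hcount : ∀ k, batchCount M i₀ c i₀ k =
      ((unsaturatedSet M i₀).filter fun v => c v = k).card := by
    intro k
    unfold batchCount unsaturatedSet
    rw [Finset.filter_filter]
    congr 1
    ext v
    simp only [Finset.mem_filter, Finset.mem_Icc]
    refine and_congr_right fun hv => ?_
    have : (v - 1) / 7 < i₀ := by omega
    tauto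
  -- With s saturated vertices the discrepancy starts at 7(s + 1) or less, and at least i₀/7 - s
  -- good batches lower it. The hypothesis `hs` says that these suffice.
  have hD : discrepancy M i₀ c i₀ ≤ 1 := by
    rcases discrepancy_add_card_good_le M hc i₀ with h | h
    · exact h
    · have h0 := discrepancy_zero_le M (i₀ := i₀) c
      have h1 := card_bad_le M (i₀ := i₀)
      have h2 := Finset.card_filter_add_card_filter_not (s := Finset.range (i₀ / 7))
        (fun b => IsGoodBatch M i₀ b)
      rw [Finset.card_range] at h2
      have h3 : ((Finset.range (i₀ / 7)).filter fun b => IsGoodBatch M i₀ b).card ≤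
          ((Finset.range i₀).filter fun b => IsGoodBatch M i₀ b).card :=
        Finset.card_le_card (Finset.filter_subset_filter _
          (Finset.range_subset_range.2 (Nat.div_le_self _ _)))
      omega
  rw [discrepancy_eq_spread, spread_le_iff] at hD
  rw [← hcount, ← hcount]
  exact hD k l

end BurnIn

/-! ### Revealing the matching one vertex at a time -/

section Conjugation

variable {n : ℕ} (M : PerfectMatching n)

/-- The image of a matching under a permutation of the vertices. -/
def conjMatching (τ : Equiv.Perm (Vertex n)) : PerfectMatching n :=
  ⟨(τ.symm.trans M.1).trans τ, fun v => by
    have h := M.2 (τ.symm v)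
    refine ⟨fun h' => h.1 ?_, ?_⟩
    · have := congrArg τ.symm h'
      simpa using this
    · simp [h.2]⟩

lemma conjMatching_conjMatching {τ : Equiv.Perm (Vertex n)} (hτ : ∀ v, τ (τ v) = v) :
    conjMatching (conjMatching M τ) τ = M := by
  have hs : ∀ v, τ.symm v = τ v := fun v => by rw [Equiv.symm_apply_eq, hτ]
  apply Subtype.ext
  ext v
  simp [conjMatching, hs, hτ]

variable {i u v : ℕ} (hu : u ∈ Finset.Icc 1 n) (hv : v ∈ Finset.Icc 1 n)

/-- The matching in which the vertices `u` and `v` have changed places. -/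
def swapMatching : PerfectMatching n := conjMatching M (Equiv.swap ⟨u, hu⟩ ⟨v, hv⟩)

lemma swapMatching_swapMatching : swapMatching (swapMatching M hu hv) hu hv = M :=
  conjMatching_conjMatching M fun _ => Equiv.swap_apply_self _ _ _

lemma partner_swapMatching {j : ℕ} (hj : j ∈ Finset.Icc 1 n) (hju : j ≠ u) (hjv : j ≠ v) :
    partner (swapMatching M hu hv) j =
      if partner M j = u then v else if partner M j = v then u else partner M j := by
  have h1 : Equiv.swap (⟨u, hu⟩ : Vertex n) ⟨v, hv⟩ ⟨j, hj⟩ = ⟨j, hj⟩ :=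
    Equiv.swap_apply_of_ne_of_ne (by simpa [Subtype.ext_iff] using hju)
      (by simpa [Subtype.ext_iff] using hjv)
  simp only [partner, dif_pos hj]
  simp only [swapMatching, conjMatching, Equiv.symm_swap, Equiv.trans_apply, h1,
    Equiv.swap_apply_def, Subtype.ext_iff]
  split_ifs <;> rfl

/-- A vertex of [i] matched to u or v has a forward edge both before and after the exchange, and the
history does not tell to which later vertex it goes. -/
lemma history_swapMatching (hiu : i < u) (hiv : i < v) :
    history (swapMatching M hu hv) i = history M i := by
  funext j
  by_cases hji : j ≤ i
  · by_cases hj : j ∈ Finset.Icc 1 n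
    · unfold history
      rw [partner_swapMatching M hu hv hj (by omega) (by omega)]
      split_ifs <;> omega
    · unfold history
      rw [partner_of_notMem M hj, partner_of_notMem _ hj]
  · simp [history, hji]

end Conjugation

/-! ### Averages over the next partner and the next coin. -/

section Averages

variable {n : ℕ}

/-- The information available at time `i`: a function of the sample which depends only on the
history of the matching and on the coins of the vertices up to `i`. -/
def IsAdapted {α : Type*} (i : ℕ) (f : Sample n → α) : Prop :=
  ∀ x y : Sample n, history x.1 i = history y.1 i → (∀ v ≤ i, coin x.2 v = coin y.2 v) → f x = f y

lemma IsAdapted.mono {α : Type*} {i j : ℕ} (hij : i ≤ j) {f : Sample n → α} (hf : IsAdapted i f) :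
    IsAdapted j f := fun x y h h' => hf x y (history_eq_of_le hij h) fun v hv => h' v (hv.trans hij)

lemma IsAdapted.comp₂ {α β γ : Type*} {i : ℕ} {f : Sample n → α} {g : Sample n → β}
    (hf : IsAdapted i f) (hg : IsAdapted i g) (φ : α → β → γ) :
    IsAdapted i fun x => φ (f x) (g x) := fun x y h h' => by
  change φ _ _ = φ _ _
  rw [hf x y h h', hg x y h h']

lemma IsAdapted.comp {α β : Type*} {i : ℕ} {f : Sample n → α} (hf : IsAdapted i f) (φ : α → β) :
    IsAdapted i fun x => φ (f x) := fun x y h h' => congrArg φ (hf x y h h')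

lemma isAdapted_unsaturatedSet (i : ℕ) : IsAdapted i fun x : Sample n => unsaturatedSet x.1 i :=
  fun x y h _ => by
    refine Finset.filter_congr fun v hv => ?_
    exact lt_partner_iff_of_history_eq h (Finset.mem_Icc.1 hv).2

/-- Given the history through time `i`, an unsaturated vertex is matched to each later vertex
with the same probability. -/
lemma sum_partner_eq {i j : ℕ} (hj : j ∈ Finset.Icc 1 i) (hi : i < n) {f : Sample n → ℝ}
    (hf : IsAdapted i f) :
    ((n : ℝ) - i) * ∑ x, (if partner x.1 (i + 1) = j then f x else 0) =
      ∑ x, if j ∈ unsaturatedSet x.1 i then f x else 0 := by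
  rw [Finset.mem_Icc] at hj
  have hjn : j ∈ Finset.Icc 1 n := Finset.mem_Icc.2 (by omega)
  have hin : i + 1 ∈ Finset.Icc 1 n := Finset.mem_Icc.2 (by omega)
  -- Exchanging i + 1 with another unprocessed vertex v is an involution that preserves the history,
  -- hence f. All n - i later vertices are therefore equally likely as the partner of j.
  have hswap : ∀ v ∈ Finset.Icc (i + 1) n,
      ∑ x : Sample n, (if partner x.1 j = v then f x else 0) =
        ∑ x : Sample n, if partner x.1 (i + 1) = j then f x else 0 := by
    intro v hv
    rw [Finset.mem_Icc] at hv
    have hvn : v ∈ Finset.Icc 1 n := Finset.mem_Icc.2 (by omega)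
    let T : Sample n → Sample n := fun x => (swapMatching x.1 hin hvn, x.2)
    have hT : Function.Involutive T := fun x =>
      Prod.ext (swapMatching_swapMatching x.1 hin hvn) rfl
    refine Fintype.sum_equiv hT.toPerm _ _ fun x => ?_
    have h1 : partner (T x).1 j =
        if partner x.1 j = i + 1 then v else if partner x.1 j = v then i + 1 else partner x.1 j :=
      partner_swapMatching x.1 hin hvn hjn (by omega) (by omega)
    have h2 : f (T x) = f x :=
      hf _ _ (history_swapMatching x.1 hin hvn (by omega) (by omega)) fun _ _ => rfl
    change _ = if partner (T x).1 (i + 1) = j then f (T x) else 0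
    rw [h2]
    have h3 : partner (T x).1 (i + 1) = j ↔ partner x.1 j = v := by
      rw [partner_eq_iff _ hin hjn, h1]
      split_ifs <;> omega
    simp only [h3]
  have hcard : ((Finset.Icc (i + 1) n).card : ℝ) = (n : ℝ) - i := by
    rw [Nat.card_Icc, show n + 1 - (i + 1) = n - i by omega, Nat.cast_sub hi.le]
  rw [← hcard, ← nsmul_eq_mul, ← Finset.sum_const, ← Finset.sum_congr rfl hswap, Finset.sum_comm]
  refine Finset.sum_congr rfl fun x _ => ?_
  rw [Finset.sum_ite_eq]
  have := partner_le x.1 j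
  refine if_congr ?_ rfl rfl
  simp only [unsaturatedSet, Finset.mem_filter, Finset.mem_Icc]
  omega

/-- Flip the coin of the vertex `u`. -/
def flipCoin {u : ℕ} (hu : u ∈ Finset.Icc 1 n) (x : Sample n) : Sample n :=
  (x.1, Function.update x.2 ⟨u, hu⟩ (!x.2 ⟨u, hu⟩))

lemma flipCoin_involutive {u : ℕ} (hu : u ∈ Finset.Icc 1 n) :
    Function.Involutive (flipCoin hu) := fun x => by
  simp [flipCoin]

lemma coin_flipCoin {u : ℕ} (hu : u ∈ Finset.Icc 1 n) (x : Sample n) (v : ℕ) :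
    coin (flipCoin hu x).2 v = if v = u then !coin x.2 v else coin x.2 v := by
  unfold coin flipCoin
  by_cases hv : v ∈ Finset.Icc 1 n
  · simp only [dif_pos hv, Function.update_apply, Subtype.ext_iff]
    split_ifs with h
    · subst h; rfl
    · rfl
  · rw [dif_neg hv, dif_neg hv, if_neg]
    rintro rfl
    exact hv hu

lemma sum_coin_eq {u : ℕ} (hu : u ∈ Finset.Icc 1 n) {f : Sample n → ℝ}
    (hf : ∀ x, f (flipCoin hu x) = f x) (b : Bool) :
    ∑ x, (if coin x.2 u = b then f x else 0) = ∑ x, f x / 2 := by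
  have h : ∀ b : Bool, ∑ x : Sample n, (if coin x.2 u = b then f x else 0) =
      ∑ x : Sample n, if coin x.2 u = !b then f x else 0 := by
    intro b
    refine Fintype.sum_equiv (flipCoin_involutive hu).toPerm _ _ fun x => ?_
    change _ = if coin (flipCoin hu x).2 u = !b then f (flipCoin hu x) else 0
    rw [hf, coin_flipCoin, if_pos rfl]
    cases b <;> cases coin x.2 u <;> rfl
  have h2 : ∑ x : Sample n, (if coin x.2 u = b then f x else 0) +
      ∑ x : Sample n, (if coin x.2 u = !b then f x else 0) = ∑ x, f x := by
    rw [← Finset.sum_add_distrib]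
    refine Finset.sum_congr rfl fun x _ => ?_
    cases b <;> cases coin x.2 u <;> simp
  rw [← h b] at h2
  rw [← Finset.sum_div]
  linarith

/-- What is learnt about the matching when the vertex `v` is processed: the partner of `v` if it
precedes `v`, and nothing else otherwise. -/
def backwardPartner (M : PerfectMatching n) (v : ℕ) : Option ℕ :=
  if partner M v < v then some (partner M v) else none

/-- The average of a function of the next outcome and of the next coin, given the history. -/
noncomputable def stepAverage (i : ℕ) (h : Sample n → Option ℕ → Bool → ℝ) (x : Sample n) : ℝ :=
  (∑ j ∈ unsaturatedSet x.1 i, (h x (some j) true + h x (some j) false) / 2) / ((n : ℝ) - i) +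
    (1 - (unsaturatedSet x.1 i).card / ((n : ℝ) - i)) * ((h x none true + h x none false) / 2)

lemma sum_coin_average {i : ℕ} (hi : i < n) {h : Sample n → Option ℕ → Bool → ℝ}
    (hh : ∀ o b, IsAdapted i fun x => h x o b) {P : PerfectMatching n → Prop} [DecidablePred P]
    (o : Option ℕ) :
    ∑ x : Sample n, (if P x.1 then h x o (coin x.2 (i + 1)) else 0) =
      ∑ x : Sample n, if P x.1 then (h x o true + h x o false) / 2 else 0 := by
  have hin : i + 1 ∈ Finset.Icc 1 n := Finset.mem_Icc.2 (by omega)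
  have key : ∀ b, ∑ x : Sample n, (if coin x.2 (i + 1) = b then (if P x.1 then h x o b else 0)
      else 0) = ∑ x : Sample n, (if P x.1 then h x o b else 0) / 2 := by
    intro b
    refine sum_coin_eq hin (fun x => ?_) b
    have h1 : h (flipCoin hin x) o b = h x o b :=
      hh o b _ _ rfl fun v hv => by rw [coin_flipCoin, if_neg (by omega)]
    rw [h1]
    rfl
  have h1 : ∀ x : Sample n, (if P x.1 then h x o (coin x.2 (i + 1)) else 0) =
      (if coin x.2 (i + 1) = true then (if P x.1 then h x o true else 0) else 0) +
      (if coin x.2 (i + 1) = false then (if P x.1 then h x o false else 0) else 0) := by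
    intro x
    cases coin x.2 (i + 1) <;> simp
  rw [Finset.sum_congr rfl fun x _ => h1 x, Finset.sum_add_distrib, key, key,
    ← Finset.sum_add_distrib]
  refine Finset.sum_congr rfl fun x _ => ?_
  split_ifs <;> ring

/-- The law of the next step given the history. -/
theorem sum_step_eq {i : ℕ} (hi : i < n) {h : Sample n → Option ℕ → Bool → ℝ}
    (hh : ∀ o b, IsAdapted i fun x => h x o b) :
    ∑ x : Sample n, h x (backwardPartner x.1 (i + 1)) (coin x.2 (i + 1)) =
      ∑ x : Sample n, stepAverage i h x := by
  have hin : i + 1 ∈ Finset.Icc 1 n := Finset.mem_Icc.2 (by omega)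
  have hN : (0 : ℝ) < (n : ℝ) - i := by
    have : (i : ℝ) < n := by exact_mod_cast hi
    linarith
  -- The forward case is written as the total minus the backward cases, so that only the law of a
  -- single backward partner is needed.
  have hsplit : ∀ x : Sample n, h x (backwardPartner x.1 (i + 1)) (coin x.2 (i + 1)) =
      ∑ j ∈ Finset.Icc 1 i, (if partner x.1 (i + 1) = j then h x (some j) (coin x.2 (i + 1)) else 0)
      + (h x none (coin x.2 (i + 1)) - ∑ j ∈ Finset.Icc 1 i,
        (if partner x.1 (i + 1) = j then h x none (coin x.2 (i + 1)) else 0)) := by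
    intro x
    have h1 := Finset.mem_Icc.1 (partner_mem x.1 hin)
    have h2 := partner_ne x.1 hin
    rw [Finset.sum_ite_eq, Finset.sum_ite_eq]
    unfold backwardPartner
    by_cases hlt : partner x.1 (i + 1) < i + 1
    · have : partner x.1 (i + 1) ∈ Finset.Icc 1 i := Finset.mem_Icc.2 (by omega)
      simp [hlt, this]
    · have : partner x.1 (i + 1) ∉ Finset.Icc 1 i := fun h => by
        rw [Finset.mem_Icc] at h; omega
      simp only [if_neg hlt, if_neg this]
      ring
  have hstep : ∀ o j, j ∈ Finset.Icc 1 i →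
      ∑ x : Sample n, (if partner x.1 (i + 1) = j then h x o (coin x.2 (i + 1)) else 0) =
        ∑ x : Sample n, (if j ∈ unsaturatedSet x.1 i then
          (h x o true + h x o false) / 2 / ((n : ℝ) - i) else 0) := by
    intro o j hj
    rw [sum_coin_average hi hh (P := fun M => partner M (i + 1) = j) o]
    have := sum_partner_eq hj hi ((hh o true).comp₂ (hh o false) fun a b => (a + b) / 2)
    rw [← mul_right_inj' hN.ne', this, Finset.mul_sum]
    refine Finset.sum_congr rfl fun x _ => ?_
    split_ifs
    · field_simp
    · simp
  have hnone : ∑ x : Sample n, h x none (coin x.2 (i + 1)) =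
      ∑ x : Sample n, (h x none true + h x none false) / 2 := by
    simpa using sum_coin_average hi hh (P := fun _ => True) none
  have hunsat : ∀ x : Sample n, ∀ g : ℕ → ℝ,
      ∑ j ∈ Finset.Icc 1 i, (if j ∈ unsaturatedSet x.1 i then g j else 0) =
        ∑ j ∈ unsaturatedSet x.1 i, g j := by
    intro x g
    rw [← Finset.sum_filter]
    congr 1
    ext j
    simp [unsaturatedSet]
  rw [Finset.sum_congr rfl fun x _ => hsplit x, Finset.sum_add_distrib, Finset.sum_sub_distrib,
    Finset.sum_comm, Finset.sum_comm (s := Finset.univ) (t := Finset.Icc 1 i),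
    Finset.sum_congr rfl fun j hj => hstep (some j) j hj,
    Finset.sum_congr rfl fun j hj => hstep none j hj, hnone,
    Finset.sum_comm, Finset.sum_comm (s := Finset.Icc 1 i), ← Finset.sum_sub_distrib,
    ← Finset.sum_add_distrib]
  refine Finset.sum_congr rfl fun x _ => ?_
  rw [hunsat, hunsat, ← Finset.sum_div, Finset.sum_const, nsmul_eq_mul]
  unfold stepAverage
  ring

end Averages

/-! ### The type of a run and the exact solution of the Poisson equation -/

/-- The type of a vertex, without its kind of matching edge: `Sum.inl l` is `A^{(l)}` and
`Sum.inr (a, l)` is `B^{(a l)}`, where `l` is the colour of the vertex. -/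
abbrev RunType : Type := Fin 3 ⊕ (Fin 3 × Fin 3)

/-- The colour of a vertex of the given type. -/
def lastColour : RunType → Fin 3
  | Sum.inl l => l
  | Sum.inr (_, l) => l

/-- The two colours of a type of `B` are distinct. -/
def IsValidType : RunType → Prop
  | Sum.inl _ => True
  | Sum.inr (a, l) => a ≠ l

/-- The colour other than `l` chosen by the coin. -/
def coinColour (b : Bool) (l : Fin 3) : Fin 3 := if b then l + 1 else l + 2

/-- The type of the next vertex. The event is `none` for a forward edge, and `some (c, old)` for a
backward edge to a vertex of colour `c`, where `old` tells whether that vertex does not exceed the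
pointer. -/
def nextType : RunType → Option (Fin 3 × Bool) → Bool → RunType
  | Sum.inl l, none, b => Sum.inr (l, coinColour b l)
  | Sum.inl l, some (c, _), b =>
      if c = l then Sum.inr (l, coinColour b l) else Sum.inl (thirdColour c l)
  | Sum.inr (a, l), none, _ => Sum.inl (thirdColour a l)
  | Sum.inr (a, l), some (c, true), _ =>
      if c = a ∨ c = l then Sum.inr (c, thirdColour a l) else Sum.inl (thirdColour l c)
  | Sum.inr (a, l), some (c, false), _ =>
      if c = a ∨ c = l then Sum.inl (thirdColour a l) else Sum.inl (thirdColour l c)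

/-- The change of the number of unsaturated vertices of colour `k`. -/
noncomputable def countChange (e : Option (Fin 3 × Bool)) (W : RunType) (k : Fin 3) : ℝ :=
  match e with
  | none => if lastColour W = k then 1 else 0
  | some (c, _) => if c = k then -1 else 0

/-- The centred indicator of the colour `l`. -/
noncomputable def centredIndicator (l k : Fin 3) : ℝ := (if l = k then 1 else 0) - 1 / 3

/-- The scale of the corrector. -/
noncomputable def corrScale (t : ℝ) : ℝ := 27 - 9 * t + 9 * t ^ 2 + 2 * t ^ 3

/-- The corrector: together with `corrScale` it solves the Poisson equation of the balanced chain. -/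
noncomputable def corrector (W : RunType) (t : ℝ) (k : Fin 3) : ℝ :=
  match W with
  | Sum.inl l => -((1 - t) * (18 - 3 * t)) * centredIndicator l k
  | Sum.inr (a, l) => -((1 - t) * (9 + 15 * t + 4 * t ^ 2)) * centredIndicator a k -
      ((1 - t) * (9 + 9 * t + 5 * t ^ 2)) * centredIndicator l k

lemma abs_centredIndicator_le (l k : Fin 3) : |centredIndicator l k| ≤ 1 := by
  unfold centredIndicator
  rw [abs_le]
  split_ifs <;> norm_num

lemma abs_countChange_le (e : Option (Fin 3 × Bool)) (W : RunType) (k : Fin 3) :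
    |countChange e W k| ≤ 1 := by
  rcases e with _ | ⟨c, o⟩ <;> simp only [countChange] <;> split_ifs <;> norm_num

lemma abs_corrScale_le {t : ℝ} (ht : t ∈ Set.Icc (0 : ℝ) 1) : |corrScale t| ≤ 50 := by
  obtain ⟨h0, h1⟩ := ht
  unfold corrScale
  have h2 : t ^ 2 ≤ 1 := pow_le_one₀ h0 h1
  have h3 : t ^ 3 ≤ 1 := pow_le_one₀ h0 h1
  rw [abs_le]
  constructor <;> nlinarith [pow_nonneg h0 2, pow_nonneg h0 3]

lemma one_le_corrScale {t : ℝ} (ht : t ∈ Set.Icc (0 : ℝ) 1) : 1 ≤ corrScale t := by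
  obtain ⟨h0, h1⟩ := ht
  unfold corrScale
  nlinarith [pow_nonneg h0 2, pow_nonneg h0 3]

lemma abs_corrector_le (W : RunType) {t : ℝ} (ht : t ∈ Set.Icc (0 : ℝ) 1) (k : Fin 3) :
    |corrector W t k| ≤ 60 := by
  obtain ⟨h0, h1⟩ := ht
  have h2 : t ^ 2 ≤ 1 := pow_le_one₀ h0 h1
  have hm : ∀ {x y C : ℝ}, 0 ≤ x → x ≤ C → |y| ≤ 1 → |(1 - t) * x * y| ≤ C := by
    intro x y C hx hxC hy
    rw [abs_mul, abs_of_nonneg (mul_nonneg (by linarith) hx)]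
    calc (1 - t) * x * |y| ≤ 1 * x * 1 := by gcongr; linarith
      _ ≤ C := by linarith
  rcases W with l | ⟨a, l⟩
  · have := hm (x := 18 - 3 * t) (C := 18) (by linarith) (by linarith)
      (abs_centredIndicator_le l k)
    simp only [corrector, neg_mul, abs_neg]
    linarith
  · have e1 := hm (x := 9 + 15 * t + 4 * t ^ 2) (C := 28) (by positivity) (by linarith)
      (abs_centredIndicator_le a k)
    have e2 := hm (x := 9 + 9 * t + 5 * t ^ 2) (C := 23) (by positivity) (by linarith)
      (abs_centredIndicator_le l k)
    simp only [corrector, neg_mul]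
    rw [abs_le] at e1 e2 ⊢
    constructor <;> linarith [e1.1, e1.2, e2.1, e2.2]

lemma abs_corrScale_sub_le {s t : ℝ} (hs : s ∈ Set.Icc (0 : ℝ) 1) (ht : t ∈ Set.Icc (0 : ℝ) 1) :
    |corrScale s - corrScale t| ≤ 50 * |s - t| := by
  obtain ⟨hs0, hs1⟩ := hs
  obtain ⟨ht0, ht1⟩ := ht
  have h : corrScale s - corrScale t =
      (-9 + 9 * (s + t) + 2 * (s ^ 2 + s * t + t ^ 2)) * (s - t) := by
    unfold corrScale; ring
  rw [h, abs_mul]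
  gcongr
  rw [abs_le]
  constructor <;> nlinarith [mul_nonneg hs0 ht0, mul_le_one₀ hs1 ht0 ht1, pow_le_one₀ hs0 hs1 (n := 2),
    pow_le_one₀ ht0 ht1 (n := 2), pow_nonneg hs0 2, pow_nonneg ht0 2]

lemma abs_corrector_sub_le (W : RunType) {s t : ℝ} (hs : s ∈ Set.Icc (0 : ℝ) 1)
    (ht : t ∈ Set.Icc (0 : ℝ) 1) (k : Fin 3) :
    |corrector W s k - corrector W t k| ≤ 200 * |s - t| := by
  obtain ⟨hs0, hs1⟩ := hs
  obtain ⟨ht0, ht1⟩ := ht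
  have b1 := mul_nonneg hs0 ht0
  have b2 := mul_le_one₀ hs1 ht0 ht1
  have b3 := pow_le_one₀ hs0 hs1 (n := 2)
  have b4 := pow_le_one₀ ht0 ht1 (n := 2)
  have b5 := pow_nonneg hs0 2
  have b6 := pow_nonneg ht0 2
  have hm : ∀ {x y C : ℝ}, |x| ≤ C → |y| ≤ 1 → |x * y| ≤ C := by
    intro x y C hx hy
    rw [abs_mul]
    calc |x| * |y| ≤ C * 1 := by gcongr; exact (abs_nonneg x).trans hx
      _ = C := mul_one C
  rcases W with l | ⟨a, l⟩
  · have h : corrector (Sum.inl l) s k - corrector (Sum.inl l) t k =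
        ((21 - 3 * (s + t)) * centredIndicator l k) * (s - t) := by
      simp only [corrector]; ring
    rw [h, abs_mul]
    gcongr
    refine (hm (C := 30) ?_ (abs_centredIndicator_le l k)).trans (by norm_num)
    rw [abs_le]
    constructor <;> linarith
  · have h : corrector (Sum.inr (a, l)) s k - corrector (Sum.inr (a, l)) t k =
        ((-6 + 11 * (s + t) + 4 * (s ^ 2 + s * t + t ^ 2)) * centredIndicator a k +
          (4 * (s + t) + 5 * (s ^ 2 + s * t + t ^ 2)) * centredIndicator l k) * (s - t) := by
      simp only [corrector]; ring
    rw [h, abs_mul]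
    gcongr
    have e1 := hm (C := 60) (x := -6 + 11 * (s + t) + 4 * (s ^ 2 + s * t + t ^ 2))
      (by rw [abs_le]; constructor <;> linarith) (abs_centredIndicator_le a k)
    have e2 := hm (C := 60) (x := 4 * (s + t) + 5 * (s ^ 2 + s * t + t ^ 2))
      (by rw [abs_le]; constructor <;> linarith) (abs_centredIndicator_le l k)
    exact (abs_add_le _ _).trans (by linarith)

/-- The change of the corrected imbalance of the colour `k`, with all coefficients frozen. -/
noncomputable def frozenChange (W : RunType) (t : ℝ) (k : Fin 3) (e : Option (Fin 3 × Bool))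
    (b : Bool) : ℝ :=
  corrScale t * (countChange e (nextType W e b) k - (1 - 2 * t) / 3) +
    (corrector (nextType W e b) t k - corrector W t k)

lemma abs_frozenChange_le (W : RunType) {t : ℝ} (ht : t ∈ Set.Icc (0 : ℝ) 1) (k : Fin 3)
    (e : Option (Fin 3 × Bool)) (b : Bool) : |frozenChange W t k e b| ≤ 250 := by
  have h1 := abs_corrector_le (nextType W e b) ht k
  have h2 := abs_corrector_le W ht k
  have h3 : |corrScale t * (countChange e (nextType W e b) k - (1 - 2 * t) / 3)| ≤ 50 * 2 := by
    rw [abs_mul]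
    refine mul_le_mul (abs_corrScale_le ht) ?_ (abs_nonneg _) (by norm_num)
    have h4 := abs_countChange_le e (nextType W e b) k
    obtain ⟨h0, h1⟩ := ht
    rw [abs_le] at h4 ⊢
    constructor <;> linarith [h4.1, h4.2]
  unfold frozenChange
  rw [abs_le] at *
  constructor <;> linarith [h1.1, h1.2, h2.1, h2.2, h3.1, h3.2]

/-- The Poisson equation: in the balanced chain the corrected imbalances have no drift. -/
lemma frozenChange_balanced {W : RunType} (hW : IsValidType W) (t : ℝ) (k : Fin 3) :
    ∑ c : Fin 3, t / 3 * ((frozenChange W t k (some (c, true)) true +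
      frozenChange W t k (some (c, true)) false) / 2) +
      (1 - t) * ((frozenChange W t k none true + frozenChange W t k none false) / 2) = 0 := by
  have h1 : (-1 : Fin 3) = 2 := rfl
  have h2 : (-2 : Fin 3) = 1 := rfl
  -- A finite check: for each type and each colour, the mean change is a polynomial in t that
  -- vanishes identically. Restricting to events with `old = true` gives exactly the moves of the
  -- balanced chain.
  rcases W with l | ⟨a, l⟩
  · fin_cases l <;> fin_cases k <;>
      simp [Fin.sum_univ_three, frozenChange, countChange, nextType, corrector, centredIndicator,
        thirdColour, coinColour, lastColour, corrScale, h1, h2] <;> ring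
  · fin_cases a <;> fin_cases l <;> first
    | exact absurd rfl hW
    | (fin_cases k <;>
        simp [Fin.sum_univ_three, frozenChange, countChange, nextType, corrector, centredIndicator,
          thirdColour, lastColour, corrScale, h1, h2] <;> ring)

/-! ### The drift of the potential -/

section Average

variable {U : Finset ℕ} {col : ℕ → Fin 3} {old : ℕ → Bool} {N : ℝ}

/-- The average over the next event, when the next vertex is matched to each element of `U` with
probability `1 / N`, and over the next coin. -/
noncomputable def eventAverage (U : Finset ℕ) (col : ℕ → Fin 3) (old : ℕ → Bool) (N : ℝ)
    (g : Option (Fin 3 × Bool) → Bool → ℝ) : ℝ :=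
  (∑ j ∈ U, (g (some (col j, old j)) true + g (some (col j, old j)) false) / 2) / N +
    (1 - U.card / N) * ((g none true + g none false) / 2)

lemma eventAverage_add (g h : Option (Fin 3 × Bool) → Bool → ℝ) :
    eventAverage U col old N (fun e b => g e b + h e b) =
      eventAverage U col old N g + eventAverage U col old N h := by
  unfold eventAverage
  have : ∑ j ∈ U, (g (some (col j, old j)) true + h (some (col j, old j)) true +
      (g (some (col j, old j)) false + h (some (col j, old j)) false)) / 2 =
      ∑ j ∈ U, (g (some (col j, old j)) true + g (some (col j, old j)) false) / 2 +
      ∑ j ∈ U, (h (some (col j, old j)) true + h (some (col j, old j)) false) / 2 := by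
    rw [← Finset.sum_add_distrib]
    exact Finset.sum_congr rfl fun j _ => by ring
  rw [this]
  ring

lemma eventAverage_mul_left (a : ℝ) (g : Option (Fin 3 × Bool) → Bool → ℝ) :
    eventAverage U col old N (fun e b => a * g e b) = a * eventAverage U col old N g := by
  unfold eventAverage
  have : ∑ j ∈ U, (a * g (some (col j, old j)) true + a * g (some (col j, old j)) false) / 2 =
      a * ∑ j ∈ U, (g (some (col j, old j)) true + g (some (col j, old j)) false) / 2 := by
    rw [Finset.mul_sum]
    exact Finset.sum_congr rfl fun j _ => by ring
  rw [this]
  ring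

lemma eventAverage_const (hN : 0 < N) (a : ℝ) :
    eventAverage U col old N (fun _ _ => a) = a := by
  unfold eventAverage
  rw [Finset.sum_const, nsmul_eq_mul]
  field_simp
  ring

lemma eventAverage_mono (hN : 0 < N) (hU : (U.card : ℝ) ≤ N)
    {g h : Option (Fin 3 × Bool) → Bool → ℝ} (hgh : ∀ e b, g e b ≤ h e b) :
    eventAverage U col old N g ≤ eventAverage U col old N h := by
  unfold eventAverage
  have h1 : (U.card : ℝ) / N ≤ 1 := (div_le_one hN).2 hU
  gcongr with j
  · exact hgh _ _
  · exact hgh _ _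
  · exact hgh _ _
  · exact hgh _ _

lemma eventAverage_sum (s : Finset (Fin 3)) (g : Fin 3 → Option (Fin 3 × Bool) → Bool → ℝ) :
    eventAverage U col old N (fun e b => ∑ k ∈ s, g k e b) =
      ∑ k ∈ s, eventAverage U col old N (g k) := by
  induction s using Finset.induction_on with
  | empty => simp [eventAverage]
  | insert a s ha ih =>
    simp only [Finset.sum_insert ha]
    rw [eventAverage_add, ih]

/-- The drift of the frozen corrected imbalances is bounded by the imbalances. -/
lemma abs_eventAverage_frozenChange_le (hN : 0 < N) {W : RunType} (hW : IsValidType W) {t : ℝ}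
    (ht : t ∈ Set.Icc (0 : ℝ) 1) (hold : (U.filter fun j => old j = false).card ≤ 1) (k : Fin 3) :
    |eventAverage U col old N (frozenChange W t k)| ≤
      500 * (∑ c : Fin 3, |((U.filter fun j => col j = c).card : ℝ) - N * t / 3| + 1) / N := by
  set X : Fin 3 → ℝ := fun c => ((U.filter fun j => col j = c).card : ℝ) with hX
  set G : Option (Fin 3 × Bool) → ℝ := fun e =>
    (frozenChange W t k e true + frozenChange W t k e false) / 2 with hG
  have hGb : ∀ e, |G e| ≤ 250 := by
    intro e
    have h1 := abs_frozenChange_le W ht k e true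
    have h2 := abs_frozenChange_le W ht k e false
    simp only [hG]
    rw [abs_le] at *
    constructor <;> linarith [h1.1, h1.2, h2.1, h2.2]
  have hsub : ∀ e f, |G e - G f| ≤ 500 := by
    intro e f
    have h1 := hGb e
    have h2 := hGb f
    rw [abs_le] at *
    constructor <;> linarith [h1.1, h1.2, h2.1, h2.2]
  have hbal : ∑ c : Fin 3, t / 3 * G (some (c, true)) + (1 - t) * G none = 0 :=
    frozenChange_balanced hW t k
  -- The cost of treating the vertex beyond the pointer, if there is one, as an old vertex.
  set dev : ℝ := ∑ j ∈ U.filter (fun j => old j = false),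
    (G (some (col j, false)) - G (some (col j, true))) with hdev
  have hdevb : |dev| ≤ 500 := by
    refine (Finset.abs_sum_le_sum_abs _ _).trans ((Finset.sum_le_card_nsmul _ _ 500
      fun j _ => hsub _ _).trans ?_)
    rw [nsmul_eq_mul]
    have : ((U.filter fun j => old j = false).card : ℝ) ≤ 1 := by exact_mod_cast hold
    linarith
  have hsum : ∑ j ∈ U, G (some (col j, old j)) = ∑ c, X c * G (some (c, true)) + dev := by
    have h1 : ∀ j, G (some (col j, old j)) = G (some (col j, true)) +
        if old j = false then G (some (col j, false)) - G (some (col j, true)) else 0 := by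
      intro j
      cases old j <;> simp
    rw [Finset.sum_congr rfl fun j _ => h1 j, Finset.sum_add_distrib, hdev, Finset.sum_filter,
      ← Finset.sum_fiberwise U col]
    congr 1
    refine Finset.sum_congr rfl fun c _ => ?_
    rw [hX, ← nsmul_eq_mul, ← Finset.sum_const]
    refine Finset.sum_congr rfl fun j hj => ?_
    rw [(Finset.mem_filter.1 hj).2]
  have hcard : (U.card : ℝ) = ∑ c, X c := by
    rw [hX, ← Nat.cast_sum, ← Finset.card_eq_sum_card_fiberwise fun j _ => Finset.mem_univ (col j)]
  -- Subtracting N times the Poisson equation leaves an expression linear in the imbalances.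
  have hkey : N * eventAverage U col old N (frozenChange W t k) =
      ∑ c, (X c - N * t / 3) * (G (some (c, true)) - G none) + dev := by
    have h1 : N * eventAverage U col old N (frozenChange W t k) =
        ∑ j ∈ U, G (some (col j, old j)) + (N - U.card) * G none := by
      unfold eventAverage
      simp only [hG]
      field_simp
    rw [h1, hsum, hcard]
    rw [Fin.sum_univ_three] at hbal ⊢
    simp only [Fin.sum_univ_three]
    linear_combination N * hbal
  have habs : |N * eventAverage U col old N (frozenChange W t k)| ≤
      500 * (∑ c, |X c - N * t / 3| + 1) := by
    rw [hkey]
    refine (abs_add_le _ _).trans ?_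
    have h1 : |∑ c, (X c - N * t / 3) * (G (some (c, true)) - G none)| ≤
        ∑ c, |X c - N * t / 3| * 500 := by
      refine (Finset.abs_sum_le_sum_abs _ _).trans (Finset.sum_le_sum fun c _ => ?_)
      rw [abs_mul]
      exact mul_le_mul_of_nonneg_left (hsub _ _) (abs_nonneg _)
    rw [← Finset.sum_mul] at h1
    linarith
  rw [le_div_iff₀ hN]
  rw [abs_mul, abs_of_pos hN] at habs
  linarith

end Average

/-! ### The quadratic potential of the corrected imbalances. -/

section Potential

/-- The corrected imbalance of the colour `k` at time `i`. -/
noncomputable def correctedImbalance (n i : ℕ) (W : RunType) (X : Fin 3 → ℝ) (k : Fin 3) : ℝ :=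
  corrScale (i / n) * (X k - ((n : ℝ) - i) * (i / n) / 3) + corrector W (i / n) k

/-- The sum of the squares of the corrected imbalances. -/
noncomputable def potential (n i : ℕ) (W : RunType) (X : Fin 3 → ℝ) : ℝ :=
  ∑ k, correctedImbalance n i W X k ^ 2

lemma potential_nonneg (n i : ℕ) (W : RunType) (X : Fin 3 → ℝ) : 0 ≤ potential n i W X :=
  Finset.sum_nonneg fun _ _ => sq_nonneg _

lemma div_mem_Icc {n i : ℕ} (hi : i ≤ n) : (i / n : ℝ) ∈ Set.Icc (0 : ℝ) 1 :=
  ⟨by positivity, div_le_one_of_le₀ (by exact_mod_cast hi) (by positivity)⟩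

lemma abs_imbalance_le {n i : ℕ} (hi : i ≤ n) (W : RunType) (X : Fin 3 → ℝ) (k : Fin 3) :
    |X k - ((n : ℝ) - i) * (i / n) / 3| ≤ |correctedImbalance n i W X k| + 60 := by
  have ht := div_mem_Icc hi
  have h1 := one_le_corrScale ht
  have h2 := abs_corrector_le W ht k
  have h3 : corrScale (i / n) * (X k - ((n : ℝ) - i) * (i / n) / 3) =
      correctedImbalance n i W X k - corrector W (i / n) k := by
    unfold correctedImbalance; ring
  calc |X k - ((n : ℝ) - i) * (i / n) / 3|
      ≤ corrScale (i / n) * |X k - ((n : ℝ) - i) * (i / n) / 3| :=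
        le_mul_of_one_le_left (abs_nonneg _) h1
    _ = |corrScale (i / n) * (X k - ((n : ℝ) - i) * (i / n) / 3)| := by
        rw [abs_mul, abs_of_nonneg (zero_le_one.trans h1)]
    _ ≤ |correctedImbalance n i W X k| + |corrector W (i / n) k| := by
        rw [h3]; exact abs_sub _ _
    _ ≤ _ := by linarith

lemma correctedImbalance_le {n i : ℕ} (hi : i ≤ n) (W : RunType) (X : Fin 3 → ℝ) (k : Fin 3) :
    |correctedImbalance n i W X k| ≤ 50 * |X k - ((n : ℝ) - i) * (i / n) / 3| + 60 := by
  have ht := div_mem_Icc hi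
  refine (abs_add_le _ _).trans (add_le_add ?_ (abs_corrector_le W ht k))
  rw [abs_mul]
  exact mul_le_mul_of_nonneg_right (abs_corrScale_le ht) (abs_nonneg _)

/-- The step of a corrected imbalance, up to the change of the coefficients. -/
lemma abs_correctedImbalance_sub_le {n i : ℕ} (hi : i < n) (W : RunType) (X : Fin 3 → ℝ)
    (k : Fin 3) (e : Option (Fin 3 × Bool)) (b : Bool) :
    |correctedImbalance n (i + 1) (nextType W e b)
        (fun k => X k + countChange e (nextType W e b) k) k -
      correctedImbalance n i W X k - frozenChange W (i / n) k e b| ≤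
      (50 * |X k - ((n : ℝ) - i) * (i / n) / 3| + 400) / n := by
  have hn : (0 : ℝ) < n := by exact_mod_cast (Nat.zero_le i).trans_lt hi
  have hn1 : (1 : ℝ) ≤ n := by exact_mod_cast (Nat.zero_le i).trans_lt hi
  have ht := div_mem_Icc hi.le
  have ht' := div_mem_Icc (n := n) (i := i + 1) hi
  set W' := nextType W e b
  set Y := X k - ((n : ℝ) - i) * (i / n) / 3 with hY
  set t : ℝ := i / n with hteq
  set t' : ℝ := ((i + 1 : ℕ) : ℝ) / n with hteq'
  have htt : t' - t = 1 / n := by rw [hteq, hteq']; push_cast; ring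
  have htt' : |t' - t| = 1 / n := by rw [htt, abs_of_pos (by positivity)]
  -- The target (n - i)(i/n)/3 moves by (1 - 2t - 1/n)/3 in one step; the term 1/(3n) is the
  -- discretisation error against `frozenChange`.
  set Y' : ℝ := Y + countChange e W' k - (1 - 2 * t) / 3 + 1 / (3 * n) with hY'
  have hYeq : X k + countChange e W' k - ((n : ℝ) - (i + 1 : ℕ)) * t' / 3 = Y' := by
    rw [hY', hY, hteq, hteq']
    push_cast
    field_simp
    ring
  have hYb : |Y'| ≤ |Y| + 2 := by
    have h1 := abs_countChange_le e W' k
    have h2 : 1 / (3 * (n : ℝ)) ≤ 1 / 3 := by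
      apply one_div_le_one_div_of_le <;> linarith
    have h3 : 0 < 1 / (3 * (n : ℝ)) := by positivity
    have h4 := le_abs_self Y
    have h5 := neg_abs_le Y
    rw [abs_le] at h1 ⊢
    obtain ⟨h6, h7⟩ := ht
    constructor <;> linarith [h1.1, h1.2]
  have e1 : correctedImbalance n (i + 1) W' (fun k => X k + countChange e W' k) k -
      correctedImbalance n i W X k - frozenChange W t k e b =
      corrScale t * (1 / (3 * n)) + (corrScale t' - corrScale t) * Y' +
        (corrector W' t' k - corrector W' t k) := by
    unfold correctedImbalance frozenChange
    simp only [← hteq, ← hteq', ← hY]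
    rw [hYeq]
    change corrScale t' * Y' + corrector W' t' k - (corrScale t * Y + corrector W t k) -
      (corrScale t * (countChange e W' k - (1 - 2 * t) / 3) +
        (corrector W' t k - corrector W t k)) = _
    rw [hY']
    ring
  rw [e1]
  have b1 : |corrScale t * (1 / (3 * n))| ≤ 50 * (1 / n) := by
    rw [abs_mul, abs_of_pos (show (0 : ℝ) < 1 / (3 * n) by positivity)]
    refine mul_le_mul (abs_corrScale_le ht) ?_ (by positivity) (by norm_num)
    apply one_div_le_one_div_of_le <;> linarith
  have b2 : |(corrScale t' - corrScale t) * Y'| ≤ 50 * (1 / n) * (|Y| + 2) := by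
    rw [abs_mul]
    have := abs_corrScale_sub_le ht' ht
    rw [htt'] at this
    exact mul_le_mul this hYb (abs_nonneg _) (by positivity)
  have b3 := abs_corrector_sub_le W' ht' ht k
  rw [htt'] at b3
  refine (abs_add_three _ _ _).trans ?_
  have : (50 * |Y| + 400) / n = (50 * |Y| + 400) * (1 / n) := by ring
  rw [this]
  have : 0 < 1 / (n : ℝ) := by positivity
  linarith

/-- The potential grows slowly on average. -/
theorem eventAverage_potential_le {n i : ℕ} (hi : i < n) {W : RunType} (hW : IsValidType W)
    {U : Finset ℕ} {col : ℕ → Fin 3} {old : ℕ → Bool} (hU : (U.card : ℝ) ≤ (n : ℝ) - i)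
    (hold : (U.filter fun j => old j = false).card ≤ 1) {X : Fin 3 → ℝ}
    (hX : ∀ k, X k = ((U.filter fun j => col j = k).card : ℝ)) :
    eventAverage U col old ((n : ℝ) - i) (fun e b => potential n (i + 1) (nextType W e b)
        fun k => X k + countChange e (nextType W e b) k) ≤
      (1 + 12000 / ((n : ℝ) - i)) * potential n i W X + 10 ^ 8 := by
  have hn : (0 : ℝ) < n := by exact_mod_cast (Nat.zero_le i).trans_lt hi
  have hN1 : (1 : ℝ) ≤ (n : ℝ) - i := by
    have : ((i + 1 : ℕ) : ℝ) ≤ n := by exact_mod_cast hi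
    push_cast at this
    linarith
  have hi0 : (0 : ℝ) ≤ i := by positivity
  have ht := div_mem_Icc hi.le
  set N : ℝ := (n : ℝ) - i with hNdef
  have hN : 0 < N := by linarith
  have hNn : N ≤ n := by rw [hNdef]; linarith
  set m : Fin 3 → ℝ := correctedImbalance n i W X with hm
  set Y : Fin 3 → ℝ := fun k => X k - N * (i / n) / 3 with hY
  have hYm : ∀ k, |Y k| ≤ |m k| + 60 := fun k => abs_imbalance_le hi.le W X k
  have hYn : ∀ k, |Y k| ≤ n := by
    intro k
    have h1 : (0 : ℝ) ≤ X k := by rw [hX]; positivity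
    have h2 : X k ≤ N := by
      rw [hX]
      refine le_trans ?_ hU
      exact_mod_cast Finset.card_filter_le _ _
    have h3 : 0 ≤ N * (i / n) := mul_nonneg hN.le ht.1
    have h4 : N * (i / n) ≤ N * 1 := mul_le_mul_of_nonneg_left ht.2 hN.le
    simp only [hY]
    rw [abs_le]
    constructor <;> linarith
  set S : ℝ := ∑ k, |m k| with hS
  have hS0 : 0 ≤ S := Finset.sum_nonneg fun _ _ => abs_nonneg _
  have hYS : ∑ k, |Y k| ≤ S + 180 := by
    refine (Finset.sum_le_sum fun k _ => hYm k).trans ?_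
    rw [Finset.sum_add_distrib]
    simp [hS]
    norm_num
  have hmS : ∀ k, |m k| ≤ S := fun k =>
    Finset.single_le_sum (f := fun k => |m k|) (fun _ _ => abs_nonneg _) (Finset.mem_univ k)
  -- the step and its remainder
  set δ : Fin 3 → Option (Fin 3 × Bool) → Bool → ℝ := fun k e b =>
    correctedImbalance n (i + 1) (nextType W e b)
      (fun k => X k + countChange e (nextType W e b) k) k - m k with hδ
  set R : Fin 3 → Option (Fin 3 × Bool) → Bool → ℝ := fun k e b =>
    δ k e b - frozenChange W (i / n) k e b with hR
  have hRb : ∀ k e b, |R k e b| ≤ (50 * |Y k| + 400) / n := fun k e b =>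
    abs_correctedImbalance_sub_le hi W X k e b
  have hRb2 : ∀ k e b, |R k e b| ≤ 450 := by
    intro k e b
    refine (hRb k e b).trans ?_
    rw [div_le_iff₀ hn]
    have := hYn k
    have : (1 : ℝ) ≤ n := hN1.trans hNn
    linarith
  have hδb : ∀ k e b, δ k e b ^ 2 ≤ 700 ^ 2 := by
    intro k e b
    rw [sq_le_sq, abs_of_pos (by norm_num : (0 : ℝ) < 700)]
    have h1 := hRb2 k e b
    have h2 := abs_frozenChange_le W ht k e b
    have h3 : δ k e b = R k e b + frozenChange W (i / n) k e b := by simp only [hR]; ring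
    rw [h3]
    exact (abs_add_le _ _).trans (by linarith)
  have hdrift : ∀ k, |eventAverage U col old N (δ k)| ≤ 1000 * (S + 181) / N := by
    intro k
    have h1 : eventAverage U col old N (δ k) = eventAverage U col old N (frozenChange W (i / n) k) +
        eventAverage U col old N (R k) := by
      rw [← eventAverage_add]
      congr 1
      funext e b
      simp only [hR]
      ring
    have h2 := abs_eventAverage_frozenChange_le hN hW ht hold k (col := col)
    have h3 : |eventAverage U col old N (R k)| ≤ (50 * |Y k| + 400) / n := by
      rw [abs_le]
      constructor
      · rw [← eventAverage_const (U := U) (col := col) (old := old) hN (-((50 * |Y k| + 400) / n))]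
        exact eventAverage_mono hN hU fun e b => (abs_le.1 (hRb k e b)).1
      · rw [← eventAverage_const (U := U) (col := col) (old := old) hN ((50 * |Y k| + 400) / n)]
        exact eventAverage_mono hN hU fun e b => (abs_le.1 (hRb k e b)).2
    have h4 : ∑ c : Fin 3, |((U.filter fun j => col j = c).card : ℝ) - N * (i / n) / 3| ≤ S + 180 := by
      simpa only [← hX] using hYS
    have h5 : (50 * |Y k| + 400) / n ≤ (50 * (S + 60) + 400) / N := by
      have := hYm k
      have := hmS k
      gcongr
      linarith
    have h6 : 500 * (∑ c : Fin 3, |((U.filter fun j => col j = c).card : ℝ) - N * (i / n) / 3| + 1) / N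
        ≤ 500 * (S + 181) / N := by
      refine div_le_div_of_nonneg_right ?_ hN.le
      linarith
    rw [h1]
    refine (abs_add_le _ _).trans ((add_le_add (h2.trans h6) (h3.trans h5)).trans ?_)
    rw [← add_div]
    refine div_le_div_of_nonneg_right ?_ hN.le
    linarith
  -- expand the square
  have hexp : (fun e b => potential n (i + 1) (nextType W e b)
      fun k => X k + countChange e (nextType W e b) k) =
      fun e b => ∑ k, (m k ^ 2 + (2 * m k * δ k e b + δ k e b ^ 2)) := by
    funext e b
    unfold potential
    refine Finset.sum_congr rfl fun k _ => ?_
    simp only [hδ]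
    ring
  rw [hexp, eventAverage_sum]
  have hterm : ∀ k, eventAverage U col old N
      (fun e b => m k ^ 2 + (2 * m k * δ k e b + δ k e b ^ 2)) ≤
      m k ^ 2 + (2 * |m k| * (1000 * (S + 181) / N) + 700 ^ 2) := by
    intro k
    rw [eventAverage_add, eventAverage_add, eventAverage_mul_left, eventAverage_const hN]
    have h1 : eventAverage U col old N (fun e b => δ k e b ^ 2) ≤ 700 ^ 2 := by
      rw [← eventAverage_const (U := U) (col := col) (old := old) hN ((700 : ℝ) ^ 2)]
      exact eventAverage_mono hN hU fun e b => hδb k e b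
    have h2 : 2 * m k * eventAverage U col old N (fun e b => δ k e b) ≤
        2 * |m k| * (1000 * (S + 181) / N) := by
      refine (le_abs_self _).trans ?_
      rw [abs_mul, abs_mul, abs_two]
      exact mul_le_mul_of_nonneg_left (hdrift k) (by positivity)
    linarith
  refine (Finset.sum_le_sum fun k _ => hterm k).trans ?_
  rw [Finset.sum_add_distrib, Finset.sum_add_distrib, ← Finset.sum_mul, ← Finset.mul_sum, ← hS]
  have hpot : potential n i W X = ∑ k, m k ^ 2 := rfl
  rw [hpot]
  set Ψ := ∑ k, m k ^ 2 with hΨ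
  have hSΨ : S ^ 2 ≤ 3 * Ψ := by
    have := sq_sum_le_card_mul_sum_sq (s := Finset.univ) (f := fun k => |m k|)
    simpa [sq_abs] using this
  -- From S(S + 181) ≤ 2S² + 181² and S² ≤ 3Ψ the factor becomes 2000 · 2 · 3 = 12000, the later
  -- exponent of the weight.
  have hmain : 2 * S * (1000 * (S + 181) / N) ≤ 12000 / N * Ψ + 2000 * 181 ^ 2 := by
    have h1 : 2 * S * (1000 * (S + 181) / N) = 2000 * (S * (S + 181)) / N := by ring
    have h2 : 12000 / N * Ψ + 2000 * 181 ^ 2 / N = (12000 * Ψ + 2000 * 181 ^ 2) / N := by ring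
    have h3 : 2000 * (181 : ℝ) ^ 2 / N ≤ 2000 * 181 ^ 2 := div_le_self (by norm_num) hN1
    have h4 : 2000 * (S * (S + 181)) / N ≤ (12000 * Ψ + 2000 * 181 ^ 2) / N := by
      gcongr
      nlinarith [sq_nonneg (S - 181)]
    linarith
  simp only [Finset.sum_const, Finset.card_univ, Fintype.card_fin, nsmul_eq_mul]
  push_cast
  linarith

end Potential

/-! ### The dynamics of `Sudoku` -/

lemma thirdColour_ne : ∀ a b : Fin 3, a ≠ b → thirdColour a b ≠ a ∧ thirdColour a b ≠ b := by
  decide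

lemma coinColour_ne : ∀ (b : Bool) (l : Fin 3), coinColour b l ≠ l := by decide

/-- The colour which together with `c(i)` forms the set `C_{i+1}`. -/
def previousColour (p : ℕ → ℕ) (i : ℕ) (s : State) : Fin 3 :=
  if i < p i then s.col (i - 1) else s.col (p i)

/-- The type of the vertex `i` if `s` is the state at time `i`. -/
def runType (p : ℕ → ℕ) (i : ℕ) (s : State) : RunType :=
  if s.ptr = i then Sum.inl (s.col i) else Sum.inr (previousColour p i s, s.col i)

/-- The invariant of `Sudoku` at time `i`. -/
structure IsRegularState (p : ℕ → ℕ) (i : ℕ) (s : State) : Prop where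
  ptr_le : s.ptr ≤ i
  previousColour_ne : s.ptr < i → previousColour p i s ≠ s.col i
  eq_of_unsaturated : ∀ j, s.ptr < j → j ≤ i → i < p j → j = s.ptr + 1

lemma IsRegularState.isValidType {p : ℕ → ℕ} {i : ℕ} {s : State} (h : IsRegularState p i s) :
    IsValidType (runType p i s) := by
  unfold runType
  split_ifs with h1
  · trivial
  · exact h.previousColour_ne (lt_of_le_of_ne h.ptr_le h1)

/-- The event at the vertex `v` in the state `s`. -/
def stepEvent (s : State) (o : Option ℕ) : Option (Fin 3 × Bool) :=
  o.map fun j => (s.col j, decide (j ≤ s.ptr))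

lemma lastColour_runType (p : ℕ → ℕ) (i : ℕ) (s : State) : lastColour (runType p i s) = s.col i := by
  unfold runType
  split_ifs <;> rfl

lemma sudokuStep_col (p : ℕ → ℕ) (ξ : ℕ → Bool) (i : ℕ) (s : State) {v : ℕ} (hv : v ≠ i + 1) :
    (sudokuStep p ξ i s).col v = s.col v := by
  unfold sudokuStep
  simp only
  split_ifs <;> exact Function.update_of_ne hv _ _

/-- A run of type B opens with (A2) and is prolonged only by (B1), whose vertices have backward
edges. So only the first vertex after the pointer can be unsaturated. The next type is a function of
the present type, the event and the coin, which makes the types comparable with a Markov chain. -/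
lemma sudokuStep_spec {p : ℕ → ℕ} {ξ : ℕ → Bool} {i : ℕ} {s : State} (hs : IsRegularState p i s)
    (hp : p (i + 1) ≠ i + 1) :
    IsRegularState p (i + 1) (sudokuStep p ξ i s) ∧
    runType p (i + 1) (sudokuStep p ξ i s) = nextType (runType p i s)
      (stepEvent s (if p (i + 1) < i + 1 then some (p (i + 1)) else none)) (ξ (i + 1)) := by
  obtain ⟨h1, h2, h3⟩ := hs
  -- a new run of type `A` starts
  have hA : ∀ c S (W : RunType), W = Sum.inl (c (i + 1)) →
      IsRegularState p (i + 1) ⟨c, i + 1, S⟩ ∧ runType p (i + 1) ⟨c, i + 1, S⟩ = W := by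
    rintro c S W rfl
    refine ⟨⟨le_rfl, fun h => absurd h (lt_irrefl _), fun j hj hj' => by
      simp only at hj; omega⟩, ?_⟩
    simp [runType]
  by_cases hptr : s.ptr = i
  · have hcoin : ∀ b : Bool, (if b then s.col i + 1 else s.col i + 2) = coinColour b (s.col i) :=
      fun _ => rfl
    rw [show runType p i s = Sum.inl (s.col i) by simp [runType, hptr]]
    unfold sudokuStep
    simp only [if_pos hptr, hcoin]
    by_cases h5 : p (i + 1) < i + 1
    · rw [if_pos h5]
      by_cases h6 : s.col (p (i + 1)) = s.col i
      · rw [if_neg (by tauto)]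
        -- (A2) with a backward edge happens only if the partner has the colour c(i). The new pair
        -- of colours is then the same as after a forward edge.
        have hprev : previousColour p (i + 1) ⟨Function.update s.col (i + 1)
            (coinColour (ξ (i + 1)) (s.col i)), s.ptr, s.S⟩ = s.col i := by
          unfold previousColour
          rw [if_neg (by omega)]
          simp only [Function.update_of_ne hp, h6]
        refine ⟨⟨by simp only; omega, fun _ => ?_, fun j hj hj' _ => by simp only at *; omega⟩, ?_⟩
        · rw [hprev]
          simpa using (coinColour_ne _ _).symm
        · rw [runType, if_neg (by simp only; omega), hprev]
          simp [stepEvent, nextType, h6]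
      · rw [if_pos ⟨h5, h6⟩]
        refine hA _ _ _ ?_
        simp [stepEvent, nextType, h6]
    · rw [if_neg h5, if_neg (by tauto)]
      have hprev : previousColour p (i + 1) ⟨Function.update s.col (i + 1)
          (coinColour (ξ (i + 1)) (s.col i)), s.ptr, s.S⟩ = s.col i := by
        unfold previousColour
        rw [if_pos (by omega)]
        simp
      refine ⟨⟨by simp only; omega, fun _ => ?_, fun j hj hj' _ => by simp only at *; omega⟩, ?_⟩
      · rw [hprev]
        simpa using (coinColour_ne _ _).symm
      · rw [runType, if_neg (by simp only; omega), hprev]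
        simp [stepEvent, nextType]
  · have hlt : s.ptr < i := by omega
    have hne := h2 hlt
    have hprev0 : (if i < p i then s.col (i - 1) else s.col (p i)) = previousColour p i s := rfl
    rw [show runType p i s = Sum.inr (previousColour p i s, s.col i) by simp [runType, hptr]]
    unfold sudokuStep
    simp only [if_neg hptr, hprev0]
    set a := previousColour p i s with ha
    by_cases h4 : i + 1 < p (i + 1)
    · rw [if_pos h4, if_neg (by omega)]
      refine hA _ _ _ ?_
      simp [stepEvent, nextType]
    · rw [if_neg h4, if_pos (by omega : p (i + 1) < i + 1)]
      by_cases h5 : p (i + 1) ≤ s.ptr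
      · rw [if_pos h5]
        by_cases h6 : s.col (p (i + 1)) = a ∨ s.col (p (i + 1)) = s.col i
        · rw [if_pos h6]
          have hprev : previousColour p (i + 1) ⟨Function.update s.col (i + 1)
              (thirdColour a (s.col i)), s.ptr, s.S⟩ = s.col (p (i + 1)) := by
            unfold previousColour
            rw [if_neg (by omega)]
            simp only [Function.update_of_ne hp]
          -- In (B1) the partner's colour lies in the set C and the new colour does not, so the next
          -- pair again consists of two distinct colours.
          have h7 := thirdColour_ne a (s.col i) hne
          refine ⟨⟨by simp only; omega, fun _ => ?_, fun j hj hj' hj'' => ?_⟩, ?_⟩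
          · rw [hprev]
            simp only [Function.update_self]
            rcases h6 with h6 | h6 <;> rw [h6]
            · exact h7.1.symm
            · exact h7.2.symm
          · simp only at *
            rcases Nat.lt_succ_iff_lt_or_eq.1 (Nat.lt_succ_of_le hj') with h8 | rfl
            · exact h3 j hj (by omega) (by omega)
            · omega
          · rw [runType, if_neg (by simp only; omega), hprev]
            simp [stepEvent, nextType, h5, h6]
        · rw [if_neg h6]
          refine hA _ _ _ ?_
          simp [stepEvent, nextType, h5, h6]
      · rw [if_neg h5]
        by_cases h6 : s.col (p (i + 1)) = a ∨ s.col (p (i + 1)) = s.col i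
        · rw [if_pos h6]
          refine hA _ _ _ ?_
          simp [stepEvent, nextType, h5, h6]
        · rw [if_neg h6]
          refine hA _ _ _ ?_
          simp [stepEvent, nextType, h5, h6]

lemma isRegularState_initial (p : ℕ → ℕ) (i : ℕ) (c : ℕ → Fin 3) (S : Finset ℕ) :
    IsRegularState p i ⟨c, i, S⟩ :=
  ⟨le_rfl, fun h => absurd h (lt_irrefl _), fun j hj hj' => by simp only at hj; omega⟩

/-! ### The information used by `Sudoku` -/

/-- The partner function with all partners of forward edges replaced by the next vertex. -/
def maskedPartner {n : ℕ} (M : PerfectMatching n) (v : ℕ) : ℕ :=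
  if partner M v < v then partner M v else v + 1

lemma maskedPartner_congr {n : ℕ} {M M' : PerfectMatching n} {i v : ℕ}
    (h : history M i = history M' i) (hv : v ≤ i) : maskedPartner M v = maskedPartner M' v := by
  unfold maskedPartner
  split_ifs with h1 h2 h2
  · exact (partner_eq_of_history_eq h hv h1).symm
  · exact absurd (partner_eq_of_history_eq h hv h1) (by omega)
  · exact absurd (partner_eq_of_history_eq h.symm hv h2) (by omega)
  · rfl

lemma runType_congr {p q : ℕ → ℕ} {i : ℕ} (s : State) (h : i < p i ↔ i < q i)
    (h' : ¬ i < p i → p i = q i) : runType p i s = runType q i s := by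
  unfold runType previousColour
  by_cases h1 : i < p i
  · simp only [if_pos h1, if_pos (h.1 h1)]
  · simp only [if_neg (mt h.2 h1), h' h1]

lemma sudokuStep_congr {p q : ℕ → ℕ} {ξ ζ : ℕ → Bool} {i : ℕ} (s : State) (h : i < p i ↔ i < q i)
    (h' : ¬ i < p i → p i = q i) (hs : i + 1 < p (i + 1) ↔ i + 1 < q (i + 1))
    (hs' : ¬ i + 1 < p (i + 1) → p (i + 1) = q (i + 1))
    (hξ : ξ (i + 1) = ζ (i + 1)) : sudokuStep p ξ i s = sudokuStep q ζ i s := by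
  have ha : (if i < p i then s.col (i - 1) else s.col (p i)) =
      if i < q i then s.col (i - 1) else s.col (q i) := by
    by_cases h1 : i < p i
    · rw [if_pos h1, if_pos (h.1 h1)]
    · rw [if_neg h1, if_neg (mt h.2 h1), h' h1]
  unfold sudokuStep
  simp only [ha, hξ]
  by_cases h1 : i + 1 < p (i + 1)
  · have h2 := hs.1 h1
    simp only [if_pos h1, if_pos h2, show ¬ p (i + 1) < i + 1 by omega,
      show ¬ q (i + 1) < i + 1 by omega, false_and, if_false]
  · rw [hs' h1]

section Adapted

variable {n i₀ : ℕ} {rule : (ℕ → ℕ) → ℕ → Fin 3}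

/-- `Sudoku` uses a forward partner only through the fact that it is forward; any larger value, such
as the next vertex, has the same effect. The masked partners can be read off the history, and this
makes the state adapted. -/
lemma sudokuState_maskedPartner {M : PerfectMatching n} (ξ : ℕ → Bool) (c : ℕ → Fin 3) (h0 : 1 ≤ i₀)
    {m : ℕ} (hm : i₀ + m ≤ n) :
    sudokuState (partner M) ξ i₀ c m = sudokuState (maskedPartner M) ξ i₀ c m := by
  have key : ∀ v ∈ Finset.Icc 1 n, (v < partner M v ↔ v < maskedPartner M v) ∧
      (¬ v < partner M v → partner M v = maskedPartner M v) := by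
    intro v hv
    have := partner_ne M hv
    unfold maskedPartner
    split_ifs <;> omega
  induction m with
  | zero => rfl
  | succ m ih =>
    rw [sudokuState, sudokuState, ih (by omega)]
    have h1 := key (i₀ + m) (Finset.mem_Icc.2 (by omega))
    have hmem : i₀ + m + 1 ∈ Finset.Icc 1 n := Finset.mem_Icc.2 (by omega)
    have h2 := key _ hmem
    exact sudokuStep_congr _ h1.1 h1.2 h2.1 h2.2 rfl

lemma isAdapted_runState (h0 : 1 ≤ i₀) {m : ℕ} (hm : i₀ + m ≤ n) :
    IsAdapted (i₀ + m) fun x : Sample n => runState i₀ rule x m := by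
  intro x y h h'
  simp only [runState]
  rw [sudokuState_maskedPartner _ _ h0 hm, sudokuState_maskedPartner _ _ h0 hm]
  induction m with
  | zero =>
    simp only [sudokuState]
    rw [show history x.1 i₀ = history y.1 i₀ from h]
  | succ m ih =>
    rw [sudokuState, sudokuState, ih (by omega) (history_eq_of_le (by omega) h)
      fun v hv => h' v (by omega)]
    have e : ∀ v ≤ i₀ + m + 1, maskedPartner x.1 v = maskedPartner y.1 v := fun v hv =>
      maskedPartner_congr h hv
    exact sudokuStep_congr _ (by rw [e _ (by omega)]) (fun _ => e _ (by omega))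
      (by rw [e _ le_rfl]) (fun _ => e _ le_rfl) (h' _ le_rfl)

lemma isAdapted_runType (h0 : 1 ≤ i₀) {m : ℕ} (hm : i₀ + m ≤ n) :
    IsAdapted (i₀ + m) fun x : Sample n =>
      runType (partner x.1) (i₀ + m) (runState i₀ rule x m) := by
  intro x y h h'
  have key : ∀ x : Sample n, runType (partner x.1) (i₀ + m) (runState i₀ rule x m) =
      runType (maskedPartner x.1) (i₀ + m) (runState i₀ rule x m) := by
    intro x
    have := partner_ne x.1 (i := i₀ + m) (Finset.mem_Icc.2 (by omega))
    apply runType_congr <;> unfold maskedPartner <;> split_ifs <;> omega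
  simp only [key]
  rw [show runState i₀ rule x m = runState i₀ rule y m from isAdapted_runState h0 hm x y h h']
  have e := maskedPartner_congr h le_rfl
  exact runType_congr _ (by rw [e]) fun _ => e

lemma isRegularState_runState (x : Sample n) {m : ℕ} (hm : i₀ + m ≤ n) :
    IsRegularState (partner x.1) (i₀ + m) (runState i₀ rule x m) := by
  induction m with
  | zero => exact isRegularState_initial _ _ _ _
  | succ m ih =>
    exact (sudokuStep_spec (ih (by omega))
      (partner_ne x.1 (Finset.mem_Icc.2 (by omega)))).1

/-- The type of the vertex processed at time `i₀ + m`. -/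
def typeAt (i₀ : ℕ) (rule : (ℕ → ℕ) → ℕ → Fin 3) (x : Sample n) (m : ℕ) : RunType :=
  runType (partner x.1) (i₀ + m) (runState i₀ rule x m)

lemma typeAt_succ (x : Sample n) {m : ℕ} (hm : i₀ + m < n) :
    typeAt i₀ rule x (m + 1) = nextType (typeAt i₀ rule x m)
      (stepEvent (runState i₀ rule x m) (backwardPartner x.1 (i₀ + m + 1)))
      (coin x.2 (i₀ + m + 1)) :=
  (sudokuStep_spec (isRegularState_runState x hm.le)
      (partner_ne x.1 (Finset.mem_Icc.2 (by omega)))).2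

/-- The number of unsaturated vertices of colour `k` as a real number. -/
noncomputable def countAt (i₀ : ℕ) (rule : (ℕ → ℕ) → ℕ → Fin 3) (x : Sample n) (m : ℕ)
    (k : Fin 3) : ℝ :=
  (((unsaturatedSet x.1 (i₀ + m)).filter fun v => (runState i₀ rule x m).col v = k).card : ℝ)

lemma cast_unsaturated (x : Sample n) (m : ℕ) (k : Fin 3) :
    (unsaturated i₀ rule x m k : ℝ) = countAt i₀ rule x m k := by
  unfold unsaturated countAt unsaturatedSet
  rw [Finset.filter_filter]

lemma unsaturatedSet_succ (M : PerfectMatching n) {i : ℕ} (hi : i < n) :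
    unsaturatedSet M (i + 1) = match backwardPartner M (i + 1) with
      | none => insert (i + 1) (unsaturatedSet M i)
      | some j => (unsaturatedSet M i).erase j := by
  have hmem : i + 1 ∈ Finset.Icc 1 n := Finset.mem_Icc.2 (by omega)
  have h1 := partner_ne M hmem
  have h2 : ∀ v ∈ Finset.Icc 1 n, partner M v = i + 1 ↔ v = partner M (i + 1) := fun v hv => by
    rw [partner_eq_iff M hv hmem, eq_comm]
  unfold backwardPartner
  split_ifs with h
  · ext v
    simp only [unsaturatedSet, Finset.mem_filter, Finset.mem_Icc, Finset.mem_erase]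
    by_cases hv : v ∈ Finset.Icc 1 n
    · have h3 := h2 v hv
      rw [Finset.mem_Icc] at hv
      by_cases h4 : v = i + 1
      · subst h4; omega
      · omega
    · rw [partner_of_notMem M hv]
      omega
  · ext v
    simp only [unsaturatedSet, Finset.mem_filter, Finset.mem_Icc, Finset.mem_insert]
    by_cases hv : v ∈ Finset.Icc 1 n
    · have h3 := h2 v hv
      rw [Finset.mem_Icc] at hv
      by_cases h4 : v = i + 1
      · subst h4; omega
      · omega
    · rw [Finset.mem_Icc] at hv
      omega

lemma backwardPartner_mem_unsaturatedSet {M : PerfectMatching n} {i j : ℕ} (hi : i < n)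
    (h : backwardPartner M (i + 1) = some j) : j ∈ unsaturatedSet M i := by
  have hmem : i + 1 ∈ Finset.Icc 1 n := Finset.mem_Icc.2 (by omega)
  have h1 := Finset.mem_Icc.1 (partner_mem M hmem)
  have h2 := partner_partner M hmem
  unfold backwardPartner at h
  split_ifs at h with h3
  cases h
  rw [unsaturatedSet, Finset.mem_filter, Finset.mem_Icc]
  omega

lemma countAt_succ (x : Sample n) {m : ℕ} (hm : i₀ + m < n) (k : Fin 3) :
    countAt i₀ rule x (m + 1) k = countAt i₀ rule x m k +
      countChange (stepEvent (runState i₀ rule x m) (backwardPartner x.1 (i₀ + m + 1)))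
        (typeAt i₀ rule x (m + 1)) k := by
  have hcol : ∀ v, v ≠ i₀ + m + 1 →
      (runState i₀ rule x (m + 1)).col v = (runState i₀ rule x m).col v := fun v hv =>
    sudokuStep_col _ _ _ _ hv
  have hlast : lastColour (typeAt i₀ rule x (m + 1)) =
      (runState i₀ rule x (m + 1)).col (i₀ + m + 1) := lastColour_runType _ _ _
  have hset := unsaturatedSet_succ x.1 hm
  have hold : ((unsaturatedSet x.1 (i₀ + m)).filter
      fun v => (runState i₀ rule x (m + 1)).col v = k) =
      (unsaturatedSet x.1 (i₀ + m)).filter fun v => (runState i₀ rule x m).col v = k := by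
    refine Finset.filter_congr fun v hv => ?_
    rw [unsaturatedSet, Finset.mem_filter, Finset.mem_Icc] at hv
    rw [hcol v (by omega)]
  unfold countAt
  rw [← add_assoc, hset]
  rcases hb : backwardPartner x.1 (i₀ + m + 1) with _ | j
  · simp only [stepEvent, countChange, Option.map_none, hlast]
    rw [Finset.filter_insert, hold]
    split_ifs with h1
    · rw [Finset.card_insert_of_notMem]
      · push_cast; ring
      · simp [unsaturatedSet]
    · ring
  · have hj := backwardPartner_mem_unsaturatedSet hm hb
    simp only [stepEvent, countChange, Option.map_some]
    rw [Finset.filter_erase, hold]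
    split_ifs with h1
    · rw [Finset.cast_card_erase_of_mem (Finset.mem_filter.2 ⟨hj, h1⟩)]
      ring
    · rw [Finset.erase_eq_of_notMem (by simp [h1])]
      ring

/-- The partners of the unsaturated vertices are distinct and lie after i. -/
lemma card_unsaturatedSet_le (M : PerfectMatching n) {i : ℕ} (hi : i ≤ n) :
    ((unsaturatedSet M i).card : ℝ) ≤ (n : ℝ) - i := by
  rw [← Nat.cast_sub hi]
  norm_cast
  have h1 : (unsaturatedSet M i).card ≤ (Finset.Icc (i + 1) n).card := by
    refine Finset.card_le_card_of_injOn (partner M) ?_ ?_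
    · intro v hv
      simp only [unsaturatedSet, Finset.coe_filter, Finset.mem_Icc, Set.mem_ofPred_eq] at hv
      simp only [Finset.coe_Icc, Set.mem_Icc]
      exact ⟨by omega, partner_le M v⟩
    · intro u hu v hv huv
      simp only [unsaturatedSet, Finset.coe_filter, Finset.mem_Icc, Set.mem_ofPred_eq] at hu hv
      rw [← partner_partner M (i := u) (Finset.mem_Icc.2 (by omega)), huv,
        partner_partner M (Finset.mem_Icc.2 (by omega))]
  rw [Nat.card_Icc] at h1
  omega

lemma card_recent_le_one (x : Sample n) {m : ℕ} (hm : i₀ + m ≤ n) :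
    ((unsaturatedSet x.1 (i₀ + m)).filter fun j =>
      decide (j ≤ (runState i₀ rule x m).ptr) = false).card ≤ 1 := by
  have h := (isRegularState_runState (rule := rule) x hm).eq_of_unsaturated
  rw [Finset.card_le_one]
  intro u hu v hv
  simp only [unsaturatedSet, Finset.mem_filter, Finset.mem_Icc, decide_eq_false_iff_not, not_le]
    at hu hv
  rw [h u hu.2 hu.1.1.2 hu.1.2, h v hv.2 hv.1.1.2 hv.1.2]

end Adapted

/-! ### A nonnegative supermartingale -/

section Supermartingale

variable {n i₀ : ℕ} {rule : (ℕ → ℕ) → ℕ → Fin 3}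

lemma isAdapted_countAt (h0 : 1 ≤ i₀) {m : ℕ} (hm : i₀ + m ≤ n) :
    IsAdapted (i₀ + m) fun x : Sample n => countAt i₀ rule x m := by
  have h := (isAdapted_unsaturatedSet (n := n) (i₀ + m)).comp₂ (isAdapted_runState (rule := rule)
    h0 hm) fun (U : Finset ℕ) (s : State) (k : Fin 3) =>
      ((U.filter fun v => s.col v = k).card : ℝ)
  exact h

/-- The potential at time `i₀ + m`. -/
noncomputable def potentialAt (i₀ : ℕ) (rule : (ℕ → ℕ) → ℕ → Fin 3) (x : Sample n) (m : ℕ) : ℝ :=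
  potential n (i₀ + m) (typeAt i₀ rule x m) (countAt i₀ rule x m)

lemma isAdapted_potentialAt (h0 : 1 ≤ i₀) {m : ℕ} (hm : i₀ + m ≤ n) :
    IsAdapted (i₀ + m) fun x : Sample n => potentialAt i₀ rule x m :=
  (isAdapted_runType h0 hm).comp₂ (isAdapted_countAt h0 hm) fun W X => potential n (i₀ + m) W X

/-- The conditional expectation bound in weak form, tested against every nonnegative function of the
history and the past coins. `sum_step_eq` replaces the actual next event by its average, and then
the drift estimate applies to each sample. -/
lemma sum_potentialAt_succ_le (h0 : 1 ≤ i₀) {m : ℕ} (hm : i₀ + m < n) {G : Sample n → ℝ}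
    (hG : IsAdapted (i₀ + m) G) (hG0 : ∀ x, 0 ≤ G x) :
    ∑ x : Sample n, G x * potentialAt i₀ rule x (m + 1) ≤
      ∑ x : Sample n, G x * ((1 + 12000 / ((n : ℝ) - (i₀ + m : ℕ))) * potentialAt i₀ rule x m +
        10 ^ 8) := by
  set h : Sample n → Option ℕ → Bool → ℝ := fun x o b =>
    G x * potential n (i₀ + m + 1)
      (nextType (typeAt i₀ rule x m) (stepEvent (runState i₀ rule x m) o) b)
      (fun k => countAt i₀ rule x m k + countChange (stepEvent (runState i₀ rule x m) o)
        (nextType (typeAt i₀ rule x m) (stepEvent (runState i₀ rule x m) o) b) k) with hh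
  have hadapted : ∀ o b, IsAdapted (i₀ + m) fun x => h x o b := by
    intro o b x y h1 h2
    have e1 : typeAt i₀ rule x m = typeAt i₀ rule y m := isAdapted_runType h0 hm.le x y h1 h2
    have e2 : runState i₀ rule x m = runState i₀ rule y m := isAdapted_runState h0 hm.le x y h1 h2
    have e3 : countAt i₀ rule x m = countAt i₀ rule y m := isAdapted_countAt h0 hm.le x y h1 h2
    simp only [hh, e1, e2, e3, hG x y h1 h2]
  have hlhs : ∀ x : Sample n, G x * potentialAt i₀ rule x (m + 1) =
      h x (backwardPartner x.1 (i₀ + m + 1)) (coin x.2 (i₀ + m + 1)) := by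
    intro x
    simp only [hh]
    rw [← typeAt_succ x hm]
    unfold potentialAt
    rw [← add_assoc]
    congr 2
    funext k
    exact countAt_succ x hm k
  rw [Finset.sum_congr rfl fun x _ => hlhs x, sum_step_eq hm hadapted]
  refine Finset.sum_le_sum fun x _ => ?_
  have hstep := eventAverage_potential_le hm
    (isRegularState_runState (rule := rule) x hm.le).isValidType
    (card_unsaturatedSet_le x.1 hm.le) (card_recent_le_one (rule := rule) x hm.le)
    (X := countAt i₀ rule x m) fun k => rfl
  refine le_trans (le_of_eq ?_) (mul_le_mul_of_nonneg_left hstep (hG0 x))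
  unfold stepAverage
  simp only [hh]
  rw [← eventAverage_mul_left]
  rfl

/-- Bernoulli's inequality gives 1 + C/N ≤ (1 + 1/N)^C, and (N - 1)(1 + 1/N) ≤ N. The loss of the
weight in one step thus pays for the growth factor of the potential. -/
lemma pow_mul_one_add_div_le {N n : ℝ} (hN : 1 ≤ N) (hn : 0 < n) (C : ℕ) :
    ((N - 1) / n) ^ C * (1 + C / N) ≤ (N / n) ^ C := by
  have h1 : 1 + (C : ℝ) / N ≤ (1 + 1 / N) ^ C := by
    have h0 : (0 : ℝ) ≤ 1 / N := by positivity
    have := one_add_mul_le_pow (a := 1 / N) (by linarith) C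
    rwa [mul_one_div] at this
  calc ((N - 1) / n) ^ C * (1 + C / N) ≤ ((N - 1) / n) ^ C * (1 + 1 / N) ^ C := by
        apply mul_le_mul_of_nonneg_left h1
        exact pow_nonneg (div_nonneg (by linarith) hn.le) C
    _ = ((N - 1) / n * (1 + 1 / N)) ^ C := (mul_pow _ _ _).symm
    _ ≤ (N / n) ^ C := by
        apply pow_le_pow_left₀
        · exact mul_nonneg (div_nonneg (by linarith) hn.le) (by positivity)
        · rw [div_mul_eq_mul_div]
          apply div_le_div_of_nonneg_right _ hn.le
          have h2 : (N - 1) * (1 + 1 / N) = N - 1 / N := by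
            field_simp
            ring
          have : 0 ≤ 1 / N := by positivity
          linarith

/-- The exponent of the weight which compensates the growth of the potential. -/
def weightExponent : ℕ := 12000

/-- The weighted potential, a nonnegative supermartingale. -/
noncomputable def weightedPotential (i₀ : ℕ) (rule : (ℕ → ℕ) → ℕ → Fin 3) (m : ℕ)
    (x : Sample n) : ℝ :=
  (((n : ℝ) - (i₀ + m : ℕ)) / n) ^ weightExponent * potentialAt i₀ rule x m +
    10 ^ 8 * ((n : ℝ) - (i₀ + m : ℕ))

lemma isAdapted_weightedPotential (h0 : 1 ≤ i₀) {m : ℕ} (hm : i₀ + m ≤ n) :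
    IsAdapted (i₀ + m) fun x : Sample n => weightedPotential i₀ rule m x :=
  (isAdapted_potentialAt h0 hm).comp fun r =>
    (((n : ℝ) - (i₀ + m : ℕ)) / n) ^ weightExponent * r + 10 ^ 8 * ((n : ℝ) - (i₀ + m : ℕ))

lemma weightedPotential_nonneg {m : ℕ} (hm : i₀ + m ≤ n) (x : Sample n) :
    0 ≤ weightedPotential i₀ rule m x := by
  have h : (0 : ℝ) ≤ (n : ℝ) - (i₀ + m : ℕ) := by
    rw [← Nat.cast_sub hm]; positivity
  have h1 : 0 ≤ potentialAt i₀ rule x m := potential_nonneg _ _ _ _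
  unfold weightedPotential
  positivity

/-- The decay of the weight absorbs the multiplicative growth. The linear term loses 10^8 in each
step and so absorbs the additive growth, as the weight is at most 1. -/
lemma sum_weightedPotential_succ_le (h0 : 1 ≤ i₀) {m : ℕ} (hm : i₀ + m < n) {G : Sample n → ℝ}
    (hG : IsAdapted (i₀ + m) G) (hG0 : ∀ x, 0 ≤ G x) :
    ∑ x : Sample n, G x * weightedPotential i₀ rule (m + 1) x ≤
      ∑ x : Sample n, G x * weightedPotential i₀ rule m x := by
  have hn : (0 : ℝ) < n := by exact_mod_cast (Nat.zero_le _).trans_lt hm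
  set N : ℝ := (n : ℝ) - (i₀ + m : ℕ) with hN
  have hN1 : 1 ≤ N := by
    have : ((i₀ + m + 1 : ℕ) : ℝ) ≤ n := by exact_mod_cast hm
    rw [hN]
    push_cast at this ⊢
    linarith
  have hNn : N ≤ n := by
    rw [hN]
    have : (0 : ℝ) ≤ (i₀ + m : ℕ) := by positivity
    linarith
  have hN' : (n : ℝ) - (i₀ + (m + 1) : ℕ) = N - 1 := by
    rw [hN]; push_cast; ring
  set w' := ((N - 1) / n) ^ weightExponent with hw'
  have hw0 : 0 ≤ w' := pow_nonneg (div_nonneg (by linarith) hn.le) _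
  have hw1 : w' ≤ 1 := pow_le_one₀ (div_nonneg (by linarith) hn.le)
    ((div_le_one hn).2 (by linarith))
  have hw : w' * (1 + 12000 / N) ≤ (N / n) ^ weightExponent := by
    have := pow_mul_one_add_div_le hN1 hn weightExponent
    rwa [show ((weightExponent : ℕ) : ℝ) = 12000 by unfold weightExponent; norm_num] at this
  have h1 := mul_le_mul_of_nonneg_left (sum_potentialAt_succ_le (rule := rule) h0 hm hG hG0) hw0
  rw [← hN] at h1
  have h2 : ∑ x : Sample n, G x * weightedPotential i₀ rule (m + 1) x =
      w' * ∑ x : Sample n, G x * potentialAt i₀ rule x (m + 1) +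
        10 ^ 8 * (N - 1) * ∑ x : Sample n, G x := by
    rw [Finset.mul_sum, Finset.mul_sum, ← Finset.sum_add_distrib]
    refine Finset.sum_congr rfl fun x _ => ?_
    unfold weightedPotential
    rw [hN']
    ring
  rw [h2]
  refine (add_le_add_left h1 _).trans ?_
  rw [Finset.mul_sum, Finset.mul_sum, ← Finset.sum_add_distrib]
  refine Finset.sum_le_sum fun x _ => ?_
  unfold weightedPotential
  rw [← hN]
  have hp : 0 ≤ potentialAt i₀ rule x m := potential_nonneg _ _ _ _
  have h3 := mul_le_mul_of_nonneg_right hw hp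
  have h4 := mul_le_mul_of_nonneg_left h3 (hG0 x)
  have h5 : G x * w' ≤ G x := mul_le_of_le_one_right (hG0 x) hw1
  linarith

/-- The pointwise form of stopping: a sample whose value v first exceeds c trades v for the smaller
amount c. -/
lemma stopped_step_le (a P : Prop) (v c : ℝ) [Decidable (a ∧ P ∧ v ≤ c)]
    [Decidable (a ∧ ¬ (P ∧ v ≤ c))] [Decidable (a ∧ P)] [Decidable (a ∧ ¬ P)] :
    (if a ∧ P ∧ v ≤ c then 1 else 0) * v + c * (if a ∧ ¬ (P ∧ v ≤ c) then (1 : ℝ) else 0) ≤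
      (if a ∧ P then 1 else 0) * v + c * (if a ∧ ¬ P then (1 : ℝ) else 0) := by
  by_cases ha : a <;> by_cases hP : P <;> by_cases hv : v ≤ c <;>
    (simp [ha, hP, hv]; try linarith)

open Classical in
/-- The maximal inequality for nonnegative supermartingales, restricted to an event known at the
beginning. -/
lemma maximal_inequality {V : ℕ → Sample n → ℝ} {T : ℕ} {c : ℝ} {A : Set (Sample n)}
    (hA : IsAdapted i₀ fun x => x ∈ A) (hV : ∀ m ≤ T, IsAdapted (i₀ + m) (V m))
    (hV0 : ∀ m ≤ T + 1, ∀ x, 0 ≤ V m x)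
    (hstep : ∀ m ≤ T, ∀ G : Sample n → ℝ, IsAdapted (i₀ + m) G → (∀ x, 0 ≤ G x) →
      ∑ x, G x * V (m + 1) x ≤ ∑ x, G x * V m x) :
    c * ((Finset.univ.filter fun x => x ∈ A ∧ ∃ m ≤ T, c < V m x).card : ℝ) ≤
      ∑ x ∈ Finset.univ.filter (fun x => x ∈ A), V 0 x := by
  -- The values of the samples still running, plus c for each sample that has already exceeded c:
  -- this total never increases.
  have key : ∀ m ≤ T + 1,
      ∑ x, (if x ∈ A ∧ ∀ l < m, V l x ≤ c then 1 else 0) * V m x +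
        c * ∑ x, (if x ∈ A ∧ ∃ l < m, c < V l x then (1 : ℝ) else 0) ≤
      ∑ x ∈ Finset.univ.filter (fun x => x ∈ A), V 0 x := by
    intro m
    induction m with
    | zero =>
      intro _
      simp [Finset.sum_filter, ite_mul]
    | succ m ih =>
      intro hm
      refine le_trans ?_ (ih (by omega))
      have hG : IsAdapted (i₀ + m) fun x : Sample n =>
          (if x ∈ A ∧ ∀ l < m + 1, V l x ≤ c then (1 : ℝ) else 0) := by
        intro x y h1 h2
        have e1 : (x ∈ A) = (y ∈ A) := hA.mono (Nat.le_add_right _ _) x y h1 h2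
        have e2 : ∀ l < m + 1, V l x = V l y := fun l hl =>
          (hV l (by omega)).mono (by omega) x y h1 h2
        refine if_congr (and_congr (iff_of_eq e1) (forall₂_congr fun l hl => ?_)) rfl rfl
        rw [e2 l hl]
      have h1 := hstep m (by omega) _ hG fun x => by positivity
      refine (add_le_add_left h1 _).trans ?_
      rw [Finset.mul_sum, Finset.mul_sum, ← Finset.sum_add_distrib, ← Finset.sum_add_distrib]
      refine Finset.sum_le_sum fun x _ => ?_
      have e1 : (∀ l < m + 1, V l x ≤ c) ↔ (∀ l < m, V l x ≤ c) ∧ V m x ≤ c :=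
        Nat.forall_lt_succ_right
      have e2 : ∀ m, (∃ l < m, c < V l x) ↔ ¬ ∀ l < m, V l x ≤ c := fun m => by push Not; rfl
      simp only [e2, e1]
      exact stopped_step_le _ _ _ _
  have h1 := key (T + 1) le_rfl
  have h2 : 0 ≤ ∑ x, (if x ∈ A ∧ ∀ l < T + 1, V l x ≤ c then 1 else 0) * V (T + 1) x :=
    Finset.sum_nonneg fun x _ => mul_nonneg (by positivity) (hV0 _ le_rfl x)
  have h3 : ((Finset.univ.filter fun x => x ∈ A ∧ ∃ m ≤ T, c < V m x).card : ℝ) =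
      ∑ x, (if x ∈ A ∧ ∃ l < T + 1, c < V l x then (1 : ℝ) else 0) := by
    rw [← Finset.sum_filter, Finset.sum_const, nsmul_eq_mul, mul_one]
    simp only [Nat.lt_succ_iff]
  rw [h3]
  linarith

end Supermartingale

/-! ### The number of unsaturated vertices -/

section Unsaturated

variable {n : ℕ}

/-- The deviation of the number of unsaturated vertices from its expected trajectory. -/
noncomputable def unsaturatedDeviation (i : ℕ) (x : Sample n) : ℝ :=
  ((unsaturatedSet x.1 i).card : ℝ) - ((n : ℝ) - i) * (i / n)

lemma card_unsaturatedSet_succ (M : PerfectMatching n) {i : ℕ} (hi : i < n) :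
    ((unsaturatedSet M (i + 1)).card : ℝ) = (unsaturatedSet M i).card +
      match backwardPartner M (i + 1) with
      | none => 1
      | some _ => -1 := by
  rw [unsaturatedSet_succ M hi]
  rcases hb : backwardPartner M (i + 1) with _ | j
  · simp only
    rw [Finset.card_insert_of_notMem (by simp [unsaturatedSet])]
    push_cast
    ring
  · simp only
    rw [Finset.cast_card_erase_of_mem (backwardPartner_mem_unsaturatedSet hi hb)]
    ring

/-- The deviation z has mean change -2z/(n - i) + 1/n, so it is pulled back to 0. The cross term
contributes at most 2z/n ≤ 2 to the square, and the squared increment at most 4. -/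
lemma sum_unsaturatedDeviation_sq_succ_le {i : ℕ} (hi : i < n) :
    ∑ x : Sample n, unsaturatedDeviation (i + 1) x ^ 2 ≤
      ∑ x : Sample n, (unsaturatedDeviation i x ^ 2 + 6) := by
  have hn : (0 : ℝ) < n := by exact_mod_cast (Nat.zero_le _).trans_lt hi
  set d : ℝ := ((n : ℝ) - 2 * i - 1) / n with hd
  set h : Sample n → Option ℕ → Bool → ℝ := fun x o _ =>
    (unsaturatedDeviation i x + (match o with
      | none => 1
      | some _ => -1) - d) ^ 2 with hh
  have hadapted : ∀ o b, IsAdapted i fun x => h x o b := by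
    intro o b x y h1 h2
    have e : unsaturatedSet x.1 i = unsaturatedSet y.1 i := isAdapted_unsaturatedSet i x y h1 h2
    simp only [hh, unsaturatedDeviation, e]
  have hlhs : ∀ x : Sample n, unsaturatedDeviation (i + 1) x ^ 2 =
      h x (backwardPartner x.1 (i + 1)) (coin x.2 (i + 1)) := by
    intro x
    simp only [hh, unsaturatedDeviation]
    rw [card_unsaturatedSet_succ x.1 hi, hd]
    congr 1
    push_cast
    field_simp
    ring
  rw [Finset.sum_congr rfl fun x _ => hlhs x, sum_step_eq hi hadapted]
  refine Finset.sum_le_sum fun x _ => ?_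
  have hu0 : (0 : ℝ) ≤ (unsaturatedSet x.1 i).card := by positivity
  have hu1 := card_unsaturatedSet_le x.1 hi.le
  have hi1 : ((i + 1 : ℕ) : ℝ) ≤ n := by exact_mod_cast hi
  have hi0 : (0 : ℝ) ≤ i := by positivity
  push_cast at hi1
  set u : ℝ := ((unsaturatedSet x.1 i).card : ℝ) with hu
  set N : ℝ := (n : ℝ) - i with hN
  have hNpos : 0 < N := by linarith
  have ht := div_mem_Icc hi.le
  set z : ℝ := unsaturatedDeviation i x with hz
  have hzu : u = z + N * (i / n) := by rw [hz, unsaturatedDeviation]; ring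
  have hNt : 0 ≤ N * (i / n) := mul_nonneg hNpos.le ht.1
  have hNt' : N * (i / n) ≤ N * 1 := mul_le_mul_of_nonneg_left ht.2 hNpos.le
  have hzn : |z| ≤ n := by rw [abs_le]; constructor <;> linarith
  have hd1 : |d| ≤ 1 := by
    rw [hd, abs_le]
    constructor
    · rw [le_div_iff₀ hn]; linarith
    · rw [div_le_iff₀ hn]; linarith
  have havg : stepAverage i h x = u / N * (z - 1 - d) ^ 2 + (1 - u / N) * (z + 1 - d) ^ 2 := by
    unfold stepAverage
    simp only [hh, Finset.sum_const, nsmul_eq_mul, ← hu, ← hN, ← hz]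
    ring
  have hr : u / N = z / N + i / n := by
    rw [hzu]; field_simp
  have hdn : d = 1 - 2 * (i / n) - 1 / n := by rw [hd]; field_simp
  have h1 : u / N * (z - 1 - d) ^ 2 + (1 - u / N) * (z + 1 - d) ^ 2 =
      z ^ 2 - 4 * (z ^ 2 / N) + 2 * (z / n) +
        (u / N * (1 + d) ^ 2 + (1 - u / N) * (1 - d) ^ 2) := by
    have e : z ^ 2 - 4 * (z ^ 2 / N) + 2 * (z / n) = z ^ 2 + 2 * z * (1 - 2 * (u / N) - d) := by
      rw [hr, hdn]; ring
    rw [e]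
    ring
  have h2 : 0 ≤ z ^ 2 / N := by positivity
  have h3 : z / n ≤ 1 := (div_le_one hn).2 ((le_abs_self z).trans hzn)
  have h4 : u / N ≤ 1 := (div_le_one hNpos).2 hu1
  have h5 : 0 ≤ u / N := by positivity
  rw [abs_le] at hd1
  have h6 : (1 + d) ^ 2 ≤ 4 := by nlinarith [hd1.1, hd1.2]
  have h7 : (1 - d) ^ 2 ≤ 4 := by nlinarith [hd1.1, hd1.2]
  have h8 : u / N * (1 + d) ^ 2 ≤ u / N * 4 := mul_le_mul_of_nonneg_left h6 h5
  have h9 : (1 - u / N) * (1 - d) ^ 2 ≤ (1 - u / N) * 4 :=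
    mul_le_mul_of_nonneg_left h7 (by linarith)
  rw [havg, h1]
  linarith

lemma sum_unsaturatedDeviation_sq_le {i : ℕ} (hi : i ≤ n) :
    ∑ x : Sample n, unsaturatedDeviation i x ^ 2 ≤ 6 * i * Fintype.card (Sample n) := by
  induction i with
  | zero => simp [unsaturatedDeviation, unsaturatedSet]
  | succ i ih =>
    refine (sum_unsaturatedDeviation_sq_succ_le hi).trans ?_
    rw [Finset.sum_add_distrib, Finset.sum_const, Finset.card_univ, nsmul_eq_mul]
    have := ih (by omega)
    push_cast
    linarith

open Classical in
lemma card_unsaturatedDeviation_gt_le {i : ℕ} (hi : i ≤ n) {θ : ℝ} (hθ : 0 < θ) :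
    θ ^ 2 * ((Finset.univ.filter fun x : Sample n => θ < |unsaturatedDeviation i x|).card : ℝ) ≤
      6 * n * Fintype.card (Sample n) := by
  have h1 : θ ^ 2 * ((Finset.univ.filter fun x : Sample n => θ < |unsaturatedDeviation i x|).card
      : ℝ) ≤ ∑ x : Sample n, unsaturatedDeviation i x ^ 2 := by
    rw [mul_comm, ← nsmul_eq_mul, ← Finset.sum_const]
    refine le_trans (Finset.sum_le_sum fun x hx => ?_)
      (Finset.sum_le_sum_of_subset_of_nonneg (Finset.filter_subset _ _)
        fun x _ _ => sq_nonneg (unsaturatedDeviation i x))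
    rw [← sq_abs (unsaturatedDeviation i x)]
    exact pow_le_pow_left₀ hθ.le (Finset.mem_filter.1 hx).2.le 2
  refine h1.trans ((sum_unsaturatedDeviation_sq_le hi).trans ?_)
  have : (i : ℝ) ≤ n := by exact_mod_cast hi
  gcongr

end Unsaturated

/-! ### The trajectory bound -/

section Trajectory

variable {n i₀ : ℕ} {rule : (ℕ → ℕ) → ℕ → Fin 3}

lemma card_saturatedSet_eq (M : PerfectMatching n) (i : ℕ) :
    ((saturatedSet M i).card : ℝ) = i - (unsaturatedSet M i).card := by
  have h := Finset.card_filter_add_card_filter_not (s := Finset.Icc 1 i) fun v => partner M v ≤ i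
  simp only [not_le, Nat.card_Icc, Nat.add_sub_cancel] at h
  rw [eq_sub_iff_add_eq]
  exact_mod_cast h

/-- After a typical burn-in phase the weighted potential is small. -/
lemma weightedPotential_zero_le (hi : i₀ < n) (hrule : IsBalancedGreedyRule n i₀ rule)
    {θ : ℝ} (hi₀ : 56 * ((i₀ : ℝ) * (i₀ / n) + θ) + 49 ≤ i₀) (x : Sample n)
    (hx : |unsaturatedDeviation i₀ x| ≤ θ) :
    weightedPotential i₀ rule 0 x ≤ 3 * (50 * θ + 110) ^ 2 + 10 ^ 8 * n := by
  have hn : (0 : ℝ) < n := by exact_mod_cast (Nat.zero_le _).trans_lt hi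
  have hθ : 0 ≤ θ := (abs_nonneg _).trans hx
  have hU := abs_le.1 hx
  unfold unsaturatedDeviation at hU
  have hmul : ((n : ℝ) - i₀) * (i₀ / n) = i₀ - i₀ * (i₀ / n) := by field_simp
  -- The number of saturated vertices is i₀ · (i₀/n) up to θ; `hi₀` is the required inequality
  -- multiplied by 7.
  have hs : 8 * (saturatedSet x.1 i₀).card + 7 ≤ i₀ / 7 := by
    have h1 : 56 * ((saturatedSet x.1 i₀).card : ℝ) + 49 ≤ i₀ := by
      rw [card_saturatedSet_eq]
      linarith
    have h2 : 56 * (saturatedSet x.1 i₀).card + 49 ≤ i₀ := by exact_mod_cast h1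
    omega
  have hbal : ∀ k l, countAt i₀ rule x 0 k ≤ countAt i₀ rule x 0 l + 1 := by
    intro k l
    have := card_unsaturated_le_of_isBalancedGreedy x.1 (hrule x.1) hs k l
    have h : ((((unsaturatedSet x.1 i₀).filter fun v => rule (history x.1 i₀) v = k).card : ℕ) : ℝ)
        ≤ ((unsaturatedSet x.1 i₀).filter fun v => rule (history x.1 i₀) v = l).card + 1 := by
      exact_mod_cast this
    exact h
  have hsum : ((unsaturatedSet x.1 i₀).card : ℝ) = ∑ k, countAt i₀ rule x 0 k := by
    unfold countAt
    rw [← Nat.cast_sum, add_zero, ← Finset.card_eq_sum_card_fiberwise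
      fun j _ => Finset.mem_univ ((runState i₀ rule x 0).col j)]
  rw [Fin.sum_univ_three] at hsum
  have hY : ∀ k, |countAt i₀ rule x 0 k - ((n : ℝ) - i₀) * (i₀ / n) / 3| ≤ θ + 1 := by
    intro k
    have h1 := hbal k 0
    have h2 := hbal k 1
    have h3 := hbal k 2
    have h4 := hbal 0 k
    have h5 := hbal 1 k
    have h6 := hbal 2 k
    rw [abs_le]
    constructor <;> linarith [hU.1, hU.2]
  -- Each imbalance is at most θ + 1, and 50(θ + 1) + 60 = 50θ + 110.
  have hpot : potentialAt i₀ rule x 0 ≤ 3 * (50 * θ + 110) ^ 2 := by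
    have h1 : ∀ k, correctedImbalance n i₀ (typeAt i₀ rule x 0) (countAt i₀ rule x 0) k ^ 2 ≤
        (50 * θ + 110) ^ 2 := by
      intro k
      rw [← sq_abs]
      apply pow_le_pow_left₀ (abs_nonneg _)
      have := correctedImbalance_le hi.le (typeAt i₀ rule x 0) (countAt i₀ rule x 0) k
      have := hY k
      linarith
    unfold potentialAt potential
    exact (Finset.sum_le_sum fun k _ => h1 k).trans (by simp)
  have hpot0 : 0 ≤ potentialAt i₀ rule x 0 := potential_nonneg _ _ _ _
  have hi' : (i₀ : ℝ) ≤ n := by exact_mod_cast hi.le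
  have hi0 : (0 : ℝ) ≤ i₀ := by positivity
  unfold weightedPotential
  rw [add_zero]
  have hw : (((n : ℝ) - i₀) / n) ^ weightExponent ≤ 1 :=
    pow_le_one₀ (div_nonneg (by linarith) hn.le) ((div_le_one hn).2 (by linarith))
  have := mul_le_of_le_one_left hpot0 hw
  linarith

/-- A bound on the weighted potential controls the number of unsaturated vertices. -/
lemma abs_countAt_sub_le {m i₁ : ℕ} (hm : i₀ + m ≤ i₁) (hi₁ : i₁ < n) {c B : ℝ} (hB : 0 ≤ B)
    (hc : c ≤ (((n : ℝ) - i₁) / n) ^ weightExponent * B ^ 2) (x : Sample n)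
    (hx : weightedPotential i₀ rule m x ≤ c) (k : Fin 3) :
    |countAt i₀ rule x m k - ((n : ℝ) - (i₀ + m : ℕ)) * ((i₀ + m : ℕ) / n) / 3| ≤ B + 60 := by
  have hn : (0 : ℝ) < n := by exact_mod_cast (Nat.zero_le _).trans_lt hi₁
  have h1 : ((i₀ + m : ℕ) : ℝ) ≤ i₁ := by exact_mod_cast hm
  have h2 : (i₁ : ℝ) < n := by exact_mod_cast hi₁
  set w : ℝ := (((n : ℝ) - (i₀ + m : ℕ)) / n) ^ weightExponent with hw
  have hw0 : 0 < w := pow_pos (div_pos (by linarith) hn) _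
  have hww : (((n : ℝ) - i₁) / n) ^ weightExponent ≤ w := by
    apply pow_le_pow_left₀ (div_nonneg (by linarith) hn.le)
    apply div_le_div_of_nonneg_right _ hn.le
    linarith
  have hpot : potentialAt i₀ rule x m ≤ B ^ 2 := by
    have h3 : w * potentialAt i₀ rule x m ≤ w * B ^ 2 := by
      unfold weightedPotential at hx
      have h4 := mul_le_mul_of_nonneg_right hww (sq_nonneg B)
      linarith
    exact le_of_mul_le_mul_left h3 hw0
  have hk : correctedImbalance n (i₀ + m) (typeAt i₀ rule x m) (countAt i₀ rule x m) k ^ 2 ≤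
      potentialAt i₀ rule x m :=
    Finset.single_le_sum (f := fun k => correctedImbalance n (i₀ + m) (typeAt i₀ rule x m)
      (countAt i₀ rule x m) k ^ 2) (fun _ _ => sq_nonneg _) (Finset.mem_univ k)
  have h5 := abs_le_of_sq_le_sq (hk.trans hpot) hB
  have h6 := abs_imbalance_le (n := n) (i := i₀ + m) (by omega) (typeAt i₀ rule x m)
    (countAt i₀ rule x m) k
  linarith

open Classical in
/-- Outside a small exceptional set the weighted potential stays bounded. -/
theorem card_exceptional_le {i₁ : ℕ} (h0 : 1 ≤ i₀) (h01 : i₀ ≤ i₁) (hi₁ : i₁ < n)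
    (hrule : IsBalancedGreedyRule n i₀ rule) {θ c : ℝ} (hθ : 0 < θ) (hc : 0 < c)
    (hi₀ : 56 * ((i₀ : ℝ) * (i₀ / n) + θ) + 49 ≤ i₀) :
    ((Finset.univ.filter fun x : Sample n =>
        ∃ m ≤ i₁ - i₀, c < weightedPotential i₀ rule m x).card : ℝ) ≤
      (6 * n / θ ^ 2 + (3 * (50 * θ + 110) ^ 2 + 10 ^ 8 * n) / c) * Fintype.card (Sample n) := by
  set A : Set (Sample n) := {x | |unsaturatedDeviation i₀ x| ≤ θ} with hAdef
  have hA : IsAdapted i₀ fun x : Sample n => x ∈ A := by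
    intro x y h1 h2
    have e : unsaturatedSet x.1 i₀ = unsaturatedSet y.1 i₀ := isAdapted_unsaturatedSet i₀ x y h1 h2
    simp only [hAdef, Set.mem_ofPred_eq, unsaturatedDeviation, e]
  have h1 := card_unsaturatedDeviation_gt_le (n := n) (i := i₀) (by omega) hθ
  have h2 := maximal_inequality (n := n) (i₀ := i₀) (V := weightedPotential i₀ rule)
    (T := i₁ - i₀) (c := c) hA (fun m hm => isAdapted_weightedPotential h0 (by omega))
    (fun m hm => weightedPotential_nonneg (by omega))
    (fun m hm G hG hG0 => sum_weightedPotential_succ_le h0 (by omega) hG hG0)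
  have hbound0 : (0 : ℝ) ≤ 3 * (50 * θ + 110) ^ 2 + 10 ^ 8 * n := by positivity
  have h3 : ∑ x ∈ Finset.univ.filter (fun x => x ∈ A), weightedPotential i₀ rule 0 x ≤
      (3 * (50 * θ + 110) ^ 2 + 10 ^ 8 * n) * Fintype.card (Sample n) := by
    refine (Finset.sum_le_card_nsmul _ _ (3 * (50 * θ + 110) ^ 2 + 10 ^ 8 * (n : ℝ))
      fun x hx => weightedPotential_zero_le (by omega) hrule hi₀ x (Finset.mem_filter.1 hx).2).trans ?_
    rw [nsmul_eq_mul, mul_comm]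
    apply mul_le_mul_of_nonneg_left _ hbound0
    exact_mod_cast Finset.card_filter_le _ _
  have h4 : (Finset.univ.filter fun x : Sample n =>
        ∃ m ≤ i₁ - i₀, c < weightedPotential i₀ rule m x).card ≤
      (Finset.univ.filter fun x : Sample n => θ < |unsaturatedDeviation i₀ x|).card +
      (Finset.univ.filter fun x : Sample n =>
        x ∈ A ∧ ∃ m ≤ i₁ - i₀, c < weightedPotential i₀ rule m x).card := by
    refine (Finset.card_le_card ?_).trans (Finset.card_union_le _ _)
    intro x hx
    simp only [Finset.mem_filter, Finset.mem_univ, true_and, Finset.mem_union] at hx ⊢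
    by_cases h : x ∈ A
    · exact Or.inr ⟨h, hx⟩
    · exact Or.inl (not_le.1 h)
  have h4' : ((Finset.univ.filter fun x : Sample n =>
        ∃ m ≤ i₁ - i₀, c < weightedPotential i₀ rule m x).card : ℝ) ≤
      (Finset.univ.filter fun x : Sample n => θ < |unsaturatedDeviation i₀ x|).card +
      (Finset.univ.filter fun x : Sample n =>
        x ∈ A ∧ ∃ m ≤ i₁ - i₀, c < weightedPotential i₀ rule m x).card := by
    exact_mod_cast h4
  refine h4'.trans ?_
  rw [add_mul]
  apply add_le_add
  · rw [div_mul_eq_mul_div, le_div_iff₀ (by positivity), mul_comm]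
    exact h1
  · rw [div_mul_eq_mul_div, le_div_iff₀ hc, mul_comm]
    exact h2.trans h3

end Trajectory

/-- Each odd vertex is paired with its successor. Without a sample `prob` would be 0/0, that is 0.
-/
lemma nonempty_perfectMatching {n : ℕ} (hn : Even n) : Nonempty (PerfectMatching n) := by
  obtain ⟨k, rfl⟩ := hn
  let f : Vertex (k + k) → Vertex (k + k) := fun v =>
    ⟨if (v : ℕ) % 2 = 1 then v + 1 else v - 1, by
      have := Finset.mem_Icc.1 v.2
      rw [Finset.mem_Icc]
      split_ifs <;> omega⟩
  have hf : Function.Involutive f := fun v => by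
    have := Finset.mem_Icc.1 v.2
    apply Subtype.ext
    simp only [f]
    split_ifs <;> omega
  refine ⟨⟨hf.toPerm, fun v => ⟨fun h => ?_, hf v⟩⟩⟩
  have h1 := congrArg Subtype.val h
  have := Finset.mem_Icc.1 v.2
  change (if (v : ℕ) % 2 = 1 then (v : ℕ) + 1 else v - 1) = v at h1
  split_ifs at h1 <;> omega

lemma prob_ge_of_compl_subset {Ω : Type} [Fintype Ω] [Nonempty Ω] {E : Set Ω} {F : Finset Ω} {δ : ℝ}
    (hEF : ∀ x, x ∉ F → x ∈ E) (hF : (F.card : ℝ) ≤ δ * Fintype.card Ω) : 1 - δ ≤ prob E := by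
  classical
  unfold prob
  have hpos : (0 : ℝ) < Nat.card Ω := by
    rw [Nat.card_eq_fintype_card]; exact_mod_cast Fintype.card_pos
  rw [le_div_iff₀ hpos]
  rw [Nat.card_eq_fintype_card] at *
  have h1 : (Fᶜ : Finset Ω).card ≤ E.ncard := by
    rw [← Set.ncard_coe_finset]
    apply Set.ncard_le_ncard _ (Set.toFinite E)
    intro x hx
    exact hEF x (by simpa using hx)
  have h2 := Finset.card_add_card_compl F
  have h3 : ((Fᶜ : Finset Ω).card : ℝ) ≤ E.ncard := by exact_mod_cast h1
  have h4 : (F.card : ℝ) + (Fᶜ : Finset Ω).card = Fintype.card Ω := by exact_mod_cast h2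
  linarith

/-! ### Asymptotics -/

lemma IsRounding.bounds {x : ℝ} (hx : 0 ≤ x) {m : ℕ} (h : IsRounding x m) :
    x - 1 ≤ m ∧ (m : ℝ) ≤ x + 1 := by
  rcases h with rfl | rfl
  · have h1 := Nat.floor_le hx
    have h2 := Nat.lt_floor_add_one x
    constructor <;> linarith
  · have h1 := Nat.le_ceil x
    have h2 := Nat.ceil_lt_add_one hx
    constructor <;> linarith

lemma tendsto_log_log_nat : Tendsto (fun n : ℕ => Real.log (Real.log n)) atTop atTop :=
  Real.tendsto_log_atTop.comp (Real.tendsto_log_atTop.comp tendsto_natCast_atTop_atTop)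

/-- Eventually (log log n)^k ≤ log n, and log n is negligible against any power of n. The case k = 0
serves for plain constants. -/
lemma eventually_mul_log_log_pow_le (K : ℝ) (k : ℕ) {r : ℝ} (hr : 0 < r) :
    ∀ᶠ n : ℕ in atTop, K * Real.log (Real.log n) ^ k ≤ (n : ℝ) ^ r := by
  have h1 : ∀ᶠ x : ℝ in atTop, Real.log x ^ k ≤ x := by
    have := (Real.isLittleO_pow_log_id_atTop (n := k)).bound one_pos
    filter_upwards [this, eventually_ge_atTop (0 : ℝ)] with x hx hx0
    simp only [one_mul, Real.norm_eq_abs, id, abs_of_nonneg hx0] at hx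
    exact (le_abs_self _).trans hx
  have h2 : ∀ᶠ x : ℝ in atTop, (|K| + 1) * Real.log x ≤ x ^ r := by
    have := (isLittleO_log_rpow_atTop hr).bound (show (0 : ℝ) < (|K| + 1)⁻¹ by positivity)
    filter_upwards [this, eventually_ge_atTop (0 : ℝ)] with x hx hx0
    rw [Real.norm_eq_abs, Real.norm_eq_abs, abs_of_nonneg (Real.rpow_nonneg hx0 r),
      ← div_eq_inv_mul, le_div_iff₀ (by positivity)] at hx
    have := le_abs_self (Real.log x)
    nlinarith [abs_nonneg K]
  filter_upwards [(Real.tendsto_log_atTop.comp tendsto_natCast_atTop_atTop).eventually h1,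
    tendsto_natCast_atTop_atTop.eventually h2,
    (Real.tendsto_log_atTop.comp tendsto_natCast_atTop_atTop).eventually_ge_atTop (0 : ℝ),
    tendsto_log_log_nat.eventually_ge_atTop (0 : ℝ)]
    with n hn1 hn2 hn3 hn4
  simp only [Function.comp_apply] at hn1 hn2 hn3
  calc K * Real.log (Real.log n) ^ k ≤ (|K| + 1) * Real.log (Real.log n) ^ k := by
        apply mul_le_mul_of_nonneg_right _ (pow_nonneg hn4 k)
        linarith [le_abs_self K]
    _ ≤ (|K| + 1) * Real.log n := mul_le_mul_of_nonneg_left hn1 (by positivity)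
    _ ≤ _ := hn2

/-- The error function dominates `n^{-1/3}`. -/
lemma inv_le_errFun {n : ℕ} {C t : ℝ} (hn : 0 < n) (hlog : 1 ≤ Real.log n) (hC : 0 ≤ C) (ht0 : 0 ≤ t)
    (ht1 : t < 1) : 1 / (n : ℝ) ^ (1 / 3 : ℝ) ≤ errFun n C t := by
  unfold errFun
  have h1 : 0 < (1 - t) ^ C := Real.rpow_pos_of_pos (by linarith) C
  have h2 : (1 - t) ^ C ≤ 1 := Real.rpow_le_one (by linarith) (by linarith) hC
  have h3 : (0 : ℝ) < (n : ℝ) ^ (1 / 3 : ℝ) := Real.rpow_pos_of_pos (by exact_mod_cast hn) _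
  apply div_le_div₀ (by positivity) (one_le_pow₀ hlog) (by positivity)
  exact mul_le_of_le_one_right h3.le h2

end SudokuColouring

/-! ### The choice of scales and the conclusion. -/

theorem mainTheorem2 :
    (∃ K : ℝ, IsConditionConstant K) ∧
    ∀ K : ℝ, IsConditionConstant K →
      ∀ δ : ℝ, 0 < δ → ∀ᶠ n : ℕ in atTop, Even n →
        ∀ ω i₀ i₁ : ℕ,
          IsRounding ((n : ℝ) ^ (1 / 3 : ℝ)) ω →
          IsRounding ((n : ℝ) / Real.log (Real.log n)) i₀ →
          IsRounding ((n : ℝ) - (n : ℝ) / Real.log (Real.log n)) i₁ →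
          (∃ rule : (ℕ → ℕ) → ℕ → Fin 3, IsBalancedGreedyRule n i₀ rule) ∧
          ∀ rule : (ℕ → ℕ) → ℕ → Fin 3, IsBalancedGreedyRule n i₀ rule →
            1 - δ ≤ prob (trajectoryEvent n ω i₀ i₁ (54 * K + 2) rule) := by
  refine ⟨exists_isConditionConstant, fun K hK δ hδ => ?_⟩
  -- All scales become integer powers of y = n^(1/60): n = y^60, ω ≈ y^20, θ = y^36, c = y^75 and B
  -- = y^40/6. They satisfy n ≪ θ² ≪ c ≪ B², with at least a factor y in reserve each time.
  have hr : (0 : ℝ) < 1 / 60 := by norm_num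
  filter_upwards [eventually_mul_log_log_pow_le (10 ^ 9 / δ + 1000) 0 hr,
    eventually_mul_log_log_pow_le (36 * 2 ^ weightExponent) weightExponent hr,
    eventually_mul_log_log_pow_le 1000 1 hr,
    tendsto_log_log_nat.eventually_ge_atTop (1000 : ℝ),
    (Real.tendsto_log_atTop.comp tendsto_natCast_atTop_atTop).eventually_ge_atTop (1 : ℝ),
    eventually_gt_atTop 0] with n hy1 hy2 hy3 hL hlog hn0 heven ω i₀ i₁ hω hi₀ hi₁
  simp only [Function.comp_apply] at hlog
  rw [pow_zero, mul_one] at hy1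
  rw [pow_one] at hy3
  have hn : (0 : ℝ) < n := by exact_mod_cast hn0
  set L := Real.log (Real.log n) with hLdef
  set y : ℝ := (n : ℝ) ^ (1 / 60 : ℝ) with hy
  have hyn : y ^ 60 = n := by
    rw [hy, ← Real.rpow_natCast, ← Real.rpow_mul hn.le]
    norm_num
  have hyn3 : (n : ℝ) ^ (1 / 3 : ℝ) = y ^ 20 := by
    rw [hy, ← Real.rpow_natCast, ← Real.rpow_mul hn.le]
    norm_num
  have hδ9 : 0 < 10 ^ 9 / δ := by positivity
  have hy1000 : 1000 ≤ y := by linarith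
  have hyδ : 10 ^ 9 / δ ≤ y := by linarith
  have hypos : 0 < y := by linarith
  have hyone : 1 ≤ y := by linarith
  have hLpos : 0 < L := by linarith
  set a : ℝ := n / L with ha
  have haL : a * L = n := by rw [ha]; field_simp
  have ha1 : 1000 * a ≤ n := by
    have ha0 : 0 < a := by rw [ha]; positivity
    nlinarith
  have ha2 : 1000 * y ^ 36 ≤ a := by
    rw [ha, le_div_iff₀ hLpos]
    calc 1000 * y ^ 36 * L = y ^ 36 * (1000 * L) := by ring
      _ ≤ y ^ 36 * y := mul_le_mul_of_nonneg_left hy3 (by positivity)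
      _ = y ^ 37 := by ring
      _ ≤ y ^ 60 := pow_le_pow_right₀ hyone (by norm_num)
      _ = n := hyn
  have hy36 : 1 ≤ y ^ 36 := one_le_pow₀ hyone
  have hωb := hω.bounds (by positivity)
  have hi₀b := hi₀.bounds (by positivity)
  have hi₁b := hi₁.bounds (by linarith)
  rw [hyn3] at hωb
  have hω0 : (0 : ℝ) < ω := by
    have : y ^ 1 ≤ y ^ 20 := pow_le_pow_right₀ hyone (by norm_num)
    rw [pow_one] at this
    linarith
  have hi01 : i₀ ≤ i₁ := by
    have : (i₀ : ℝ) ≤ i₁ := by linarith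
    exact_mod_cast this
  have hi1n : i₁ < n := by
    have : (i₁ : ℝ) < n := by linarith
    exact_mod_cast this
  have h1i0 : 1 ≤ i₀ := by
    have : ((1 : ℕ) : ℝ) ≤ i₀ := by push_cast; linarith
    exact_mod_cast this
  refine ⟨exists_isBalancedGreedyRule (hi01.trans_lt hi1n), fun rule hrule => ?_⟩
  -- The fraction i₀/n is about 1/log log n, so the typical number of saturated vertices is a small
  -- part of i₀.
  have hsat : 56 * ((i₀ : ℝ) * (i₀ / n) + y ^ 36) + 49 ≤ i₀ := by
    have h1 : (i₀ : ℝ) / n ≤ 1 / 500 := by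
      rw [div_le_iff₀ hn]
      linarith
    have h2 : (i₀ : ℝ) * (i₀ / n) ≤ i₀ * (1 / 500) :=
      mul_le_mul_of_nonneg_left h1 (by positivity)
    linarith
  have hexc := card_exceptional_le h1i0 hi01 hi1n hrule (θ := y ^ 36) (c := y ^ 75)
    (by positivity) (by positivity) hsat
  -- Stopping at i₁ keeps (n - i₁)/n above 1/(2 log log n). The weight therefore costs a power of
  -- log log n, which is less than one factor y.
  have hcB : y ^ 75 ≤ (((n : ℝ) - i₁) / n) ^ weightExponent * (y ^ 40 / 6) ^ 2 := by
    have h1 : 1 / (2 * L) ≤ ((n : ℝ) - i₁) / n := by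
      rw [div_le_div_iff₀ (by positivity) hn]
      have h2 : a / 2 ≤ n - i₁ := by linarith
      have h3 := mul_le_mul_of_nonneg_right h2 (show 0 ≤ 2 * L by positivity)
      linarith
    have h2 : (1 / (2 * L)) ^ weightExponent ≤ (((n : ℝ) - i₁) / n) ^ weightExponent :=
      pow_le_pow_left₀ (by positivity) h1 _
    have h3 : y ^ 75 ≤ (1 / (2 * L)) ^ weightExponent * (y ^ 40 / 6) ^ 2 := by
      rw [one_div, inv_pow, ← div_eq_inv_mul, le_div_iff₀ (by positivity), mul_pow]
      calc y ^ 75 * (2 ^ weightExponent * L ^ weightExponent)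
          = y ^ 75 * (36 * 2 ^ weightExponent * L ^ weightExponent) / 36 := by ring
        _ ≤ y ^ 75 * y / 36 := by gcongr
        _ = y ^ 76 / 36 := by ring
        _ ≤ y ^ 80 / 36 := by
          apply div_le_div_of_nonneg_right _ (by norm_num)
          exact pow_le_pow_right₀ hyone (by norm_num)
        _ = (y ^ 40 / 6) ^ 2 := by ring
    exact h3.trans (mul_le_mul_of_nonneg_right h2 (by positivity))
  have hfail : 6 * (n : ℝ) / (y ^ 36) ^ 2 + (3 * (50 * y ^ 36 + 110) ^ 2 + 10 ^ 8 * n) / y ^ 75 ≤ δ := by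
    have hn72 : (n : ℝ) * y ≤ y ^ 72 := by
      rw [← hyn, ← pow_succ]
      exact pow_le_pow_right₀ hyone (by norm_num)
    have e1 : 6 * (n : ℝ) / (y ^ 36) ^ 2 ≤ 6 / y := by
      have h3 : (y ^ 36) ^ 2 = y ^ 72 := by ring
      rw [h3, div_le_div_iff₀ (by positivity) hypos]
      linarith
    have e2 : (3 * (50 * y ^ 36 + 110) ^ 2 + 10 ^ 8 * n) / y ^ 75 ≤ (10 ^ 9 - 6) / y := by
      rw [div_le_div_iff₀ (by positivity) hypos]
      have h3 : (50 * y ^ 36 + 110) ^ 2 ≤ (160 * y ^ 36) ^ 2 :=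
        pow_le_pow_left₀ (by positivity) (by linarith) 2
      have h4 : (160 * y ^ 36) ^ 2 = 25600 * y ^ 72 := by ring
      have h5 : y ^ 72 * y ≤ y ^ 75 := by
        rw [← pow_succ]
        exact pow_le_pow_right₀ hyone (by norm_num)
      have h6 : y ^ 72 ≤ y ^ 75 := pow_le_pow_right₀ hyone (by norm_num)
      have h7 := mul_le_mul_of_nonneg_right (h4 ▸ h3) hypos.le
      have h8 : (0 : ℝ) ≤ y ^ 75 := by positivity
      linarith
    have e3 : 6 / y + (10 ^ 9 - 6) / y = 10 ^ 9 / y := by ring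
    have e4 : 10 ^ 9 / y ≤ δ := by
      rw [div_le_iff₀ hypos]
      rw [div_le_iff₀ hδ] at hyδ
      linarith
    linarith
  classical
  have : Nonempty (Sample n) :=
    ⟨((nonempty_perfectMatching heven).some, fun _ => true)⟩
  refine prob_ge_of_compl_subset ?_ (hexc.trans
    (mul_le_mul_of_nonneg_right hfail (Nat.cast_nonneg _)))
  intro x hx i hi k
  simp only [Finset.mem_filter, Finset.mem_univ, true_and, not_exists, not_and, not_lt] at hx
  have hmi : i * ω ≤ i₁ - i₀ := (Nat.mul_le_mul_right ω hi).trans (Nat.div_mul_le_self _ _)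
  have hmain := abs_countAt_sub_le (m := i * ω) (by omega) hi1n (B := y ^ 40 / 6) (by positivity)
    hcB x (hx _ hmi) k
  have hti : ((i₀ : ℝ) + i * ω) / n = ((i₀ + i * ω : ℕ) : ℝ) / n := by push_cast; rfl
  have hlt : ((i₀ + i * ω : ℕ) : ℝ) < n := by
    have : i₀ + i * ω < n := by omega
    exact_mod_cast this
  simp only
  rw [hti, cast_unsaturated]
  set t : ℝ := ((i₀ + i * ω : ℕ) : ℝ) / n with ht
  have herr := inv_le_errFun (C := 54 * K + 2) (t := t) hn0 hlog (by linarith [hK.1])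
    (by positivity) ((div_lt_one hn).2 hlt)
  rw [hyn3] at herr
  have hx1 : ((n : ℝ) - (i₀ + i * ω : ℕ)) * t / 3 = n / 3 * xFun t := by
    unfold xFun
    rw [ht]
    field_simp
  rw [hx1] at hmain
  have e1 : countAt i₀ rule x (i * ω) k / ω - (n : ℝ) / ω / 3 * xFun t =
      (countAt i₀ rule x (i * ω) k - n / 3 * xFun t) / ω := by ring
  rw [e1, abs_div, abs_of_pos hω0, div_le_iff₀ hω0]
  refine hmain.trans ?_
  have e2 : (n : ℝ) / ω / 3 * errFun n (54 * K + 2) t * ω = n / 3 * errFun n (54 * K + 2) t := by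
    field_simp
  rw [e2]
  -- The permitted error is at least twice B = y^40/6; the second half absorbs the bound 60 on the
  -- corrector.
  have e3 : y ^ 40 / 3 ≤ n / 3 * errFun n (54 * K + 2) t := by
    have h1 := mul_le_mul_of_nonneg_left herr (show (0 : ℝ) ≤ n / 3 by positivity)
    have h2 : (n : ℝ) / 3 * (1 / y ^ 20) = y ^ 40 / 3 := by
      rw [← hyn]; field_simp
    linarith
  have e4 : y ^ 1 ≤ y ^ 40 := pow_le_pow_right₀ hyone (by norm_num)
  rw [pow_one] at e4
  linarith
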